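/- Let $n\in\{2,3\}$ and let $\Omega\subset\mathbb{R}^n$ be an admissible domain with inlet $\Gamma_I$, outlet $\Gamma_O$ and walls $\Gamma_W=\partial\Omega\setminus(\Gamma_I\cup\Gamma_O)$, in the following sense. The set $\Omega$ is open, bounded and simply connected, and contains two disjoint straight pieces $\Omega_1,\Omega_2$. If $n=2$, then, in suitable Cartesian coordinate systems (one for each $j$), $\Omega_j=(0,\ell_j)\times(-h_j,h_j)$ with $\ell_j,h_j>0$, and $\Gamma_I=\{0\}\times(-h_1,h_1)$ (coordinates of $\Omega_1$), $\Gamma_O=\{\ell_2\}\times(-h_2,h_2)$ (coordinates of $\Omega_2$). If $n=3$, then, in suitable Cartesian coordinate systems with parallel third axes, $\Omega_j=\Theta_j\times(0,\ell_j)$ with $\ell_j>0$ and $\Theta_j\subset\mathbb{R}^2$ a bounded domain with boundary of class $\mathcal{C}^2$, and $\Gamma_I=\Theta_1\times\{0\}$, $\Gamma_O=\Theta_2\times\{\ell_2\}$. The domain is truncated orthogonally by its inlet and outlet: $\Omega$ coincides with $\Omega_1$ in a neighborhood of $\overline{\Gamma_I}$ and with $\Omega_2$ in a neighborhood of $\overline{\Gamma_O}$.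 Finally, $\partial\Omega$ is of class $\mathcal{C}^2$ near each of its points outside $\overline{\Gamma_I}\cup\overline{\Gamma_O}$. Then there is a constant $C_*>0$, depending only on $\Omega$ (with its inlet and outlet), such that for every $q\in L^2(\Omega;\mathbb{R})$, not necessarily of zero mean, there exists a vector field $X\in W^{1,2}(\Omega;\mathbb{R}^n)$ with $$\nabla\cdot X=q\ \text{ in }\Omega,\qquad X=0\ \text{ on }\Gamma_I\cup\Gamma_W\ \text{ in the sense of traces},\qquad \|\nabla X\|_{L^2(\Omega)}\le C_*\,\|q\|_{L^2(\Omega)}.$$ -/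

import Mathlib

open MeasureTheory Filter Topology Set
open scoped ContDiff ENNReal

noncomputable section

namespace Pipe

/-- Euclidean `n`-space. -/
abbrev E (n : ℕ) : Type := EuclideanSpace ℝ (Fin n)

/-! ### Admissible domains -/

/-- `D` has boundary of class `C²` near its boundary point `x`: in suitable orthonormal coordinates,
whose last axis points in the direction `ν`, the set `D` coincides near `x` with the strict epigraph
of a `C²` function of the remaining variables (the point `y - ⟪ν, y⟫ ν` of the hyperplane `ν^⊥`). -/
def IsC2BoundaryPoint {n : ℕ} (D : Set (E n)) (x : E n) : Prop :=
  ∃ (ν : E n) (φ : E n → ℝ), ‖ν‖ = 1 ∧ ContDiff ℝ 2 φ ∧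
    ∀ᶠ y in 𝓝 x, (y ∈ D ↔ φ (y - inner ℝ ν y • ν) < inner ℝ ν y)

/-- The rectangle `(0, ℓ) × (-h, h)`. -/
def rectangle (ℓ h : ℝ) : Set (E 2) := {p | p 0 ∈ Ioo 0 ℓ ∧ p 1 ∈ Ioo (-h) h}

/-- The cross-section `{t} × (-h, h)`. -/
def rectangleSection (h t : ℝ) : Set (E 2) := {p | p 0 = t ∧ p 1 ∈ Ioo (-h) h}

/-- The cylinder `Θ × (0, ℓ)`. -/
def cylinder (Θ : Set (E 2)) (ℓ : ℝ) : Set (E 3) := {p | !₂[p 0, p 1] ∈ Θ ∧ p 2 ∈ Ioo 0 ℓ}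

/-- The cross-section `Θ × {t}`. -/
def cylinderSection (Θ : Set (E 2)) (t : ℝ) : Set (E 3) := {p | !₂[p 0, p 1] ∈ Θ ∧ p 2 = t}

/-- The requirements on the domain `Ω`, its two straight end pieces `Ω₁`, `Ω₂`, its inlet `Γ_I` and
its outlet `Γ_O` that are common to both dimensions. The remaining part of `Ω` is
`Ω₀ = Ω \ (Ω₁ ∪ Ω₂)`. -/
structure IsChannel {n : ℕ} (Ω Ω₁ Ω₂ Γ_I Γ_O : Set (E n)) : Prop where
  isOpen : IsOpen Ω
  isBounded : Bornology.IsBounded Ω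
  isSimplyConnected : IsSimplyConnected Ω
  subset₁ : Ω₁ ⊆ Ω
  subset₂ : Ω₂ ⊆ Ω
  disjoint : Disjoint Ω₁ Ω₂
  /-- The domain is truncated orthogonally by the inlet: around the closed inlet it is the straight
  piece `Ω₁`. -/
  inlet : ∀ᶠ y in 𝓝ˢ (closure Γ_I), (y ∈ Ω ↔ y ∈ Ω₁)
  /-- The domain is truncated orthogonally by the outlet: around the closed outlet it is the
  straight piece `Ω₂`. -/
  outlet : ∀ᶠ y in 𝓝ˢ (closure Γ_O), (y ∈ Ω ↔ y ∈ Ω₂)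
  /-- Off the closed inlet and outlet the boundary is of class `C²`. -/
  c2 : ∀ x ∈ frontier Ω \ (closure Γ_I ∪ closure Γ_O), IsC2BoundaryPoint Ω x

/-- Admissible planar domains `Ω`, with inlet `Γ_I` and outlet `Γ_O`. The two rigid motions `e₁`, `e₂`
are the coordinate systems of the two rectangles. -/
def IsAdmissiblePlanar (Ω Γ_I Γ_O : Set (E 2)) : Prop :=
  ∃ (e₁ e₂ : E 2 ≃ᵃⁱ[ℝ] E 2) (ℓ₁ h₁ ℓ₂ h₂ : ℝ),
    0 < ℓ₁ ∧ 0 < h₁ ∧ 0 < ℓ₂ ∧ 0 < h₂ ∧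
    Γ_I = e₁ '' rectangleSection h₁ 0 ∧ Γ_O = e₂ '' rectangleSection h₂ ℓ₂ ∧
    IsChannel Ω (e₁ '' rectangle ℓ₁ h₁) (e₂ '' rectangle ℓ₂ h₂) Γ_I Γ_O

/-- Bounded planar domains with boundary of class `C²`. -/
structure IsCrossSection (Θ : Set (E 2)) : Prop where
  isOpen : IsOpen Θ
  isBounded : Bornology.IsBounded Θ
  isConnected : IsConnected Θ
  c2 : ∀ x ∈ frontier Θ, IsC2BoundaryPoint Θ x

/-- Admissible spatial domains `Ω`, with inlet `Γ_I` and outlet `Γ_O`. The two rigid motions `e₁`, `e₂`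
are the coordinate systems of the two cylinders, whose axes are parallel. -/
def IsAdmissibleSpatial (Ω Γ_I Γ_O : Set (E 3)) : Prop :=
  ∃ (e₁ e₂ : E 3 ≃ᵃⁱ[ℝ] E 3) (Θ₁ Θ₂ : Set (E 2)) (ℓ₁ ℓ₂ : ℝ),
    0 < ℓ₁ ∧ 0 < ℓ₂ ∧ IsCrossSection Θ₁ ∧ IsCrossSection Θ₂ ∧
    (e₂.linearIsometryEquiv (EuclideanSpace.single 2 1) =
        e₁.linearIsometryEquiv (EuclideanSpace.single 2 1) ∨
      e₂.linearIsometryEquiv (EuclideanSpace.single 2 1) =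
        -e₁.linearIsometryEquiv (EuclideanSpace.single 2 1)) ∧
    Γ_I = e₁ '' cylinderSection Θ₁ 0 ∧ Γ_O = e₂ '' cylinderSection Θ₂ ℓ₂ ∧
    IsChannel Ω (e₁ '' cylinder Θ₁ ℓ₁) (e₂ '' cylinder Θ₂ ℓ₂) Γ_I Γ_O

/-- Admissible domains in dimension `n ∈ {2, 3}` (there are none in other dimensions). -/
def IsAdmissible : (n : ℕ) → (Ω Γ_I Γ_O : Set (E n)) → Prop
  | 2 => IsAdmissiblePlanar
  | 3 => IsAdmissibleSpatial
  | _ => fun _ _ _ => False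

/-- The physical walls: the part of the boundary outside the inlet and the outlet. -/
def wall {n : ℕ} (Ω Γ_I Γ_O : Set (E n)) : Set (E n) := frontier Ω \ (Γ_I ∪ Γ_O)

/-! ### Sobolev vector fields and traces -/

/-- `n × n` matrices with the Frobenius norm. -/
abbrev Mat (n : ℕ) : Type := EuclideanSpace ℝ (Fin n × Fin n)

/-- The classical gradient of a vector field: the entry `(i, j)` is `∂ⱼ uᵢ`. -/
def classicalGradient {n : ℕ} (u : E n → E n) (x : E n) : Mat n :=
  WithLp.toLp 2 fun p => fderiv ℝ u x (EuclideanSpace.single p.2 1) p.1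

/-- `X ∈ W^{1,2}(Ω; ℝⁿ)`, with weak gradient `G`: the entry `(i, j)` of `G` is the weak partial
derivative `∂ⱼ Xᵢ`. -/
structure HasW12Gradient {n : ℕ} (Ω : Set (E n)) (X : E n → E n) (G : E n → Mat n) : Prop where
  memLp : MemLp X 2 (volume.restrict Ω)
  memLp_gradient : MemLp G 2 (volume.restrict Ω)
  integral_eq : ∀ φ : E n → ℝ, ContDiff ℝ ∞ φ → HasCompactSupport φ → tsupport φ ⊆ Ω →
    ∀ i j : Fin n, ∫ x in Ω, X x i * fderiv ℝ φ x (EuclideanSpace.single j 1) =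
      -∫ x in Ω, G x (i, j) * φ x

/-- The field `X ∈ W^{1,2}(Ω; ℝⁿ)` with weak gradient `G` has trace `g` on the part `Γ` of the boundary
of `Ω`: there are fields `uₖ`, smooth up to the boundary, with `uₖ → X` in `W^{1,2}(Ω; ℝⁿ)` and
`uₖ → g` in `L²(Γ; ℝⁿ)` for the surface measure. -/
def HasTrace {n : ℕ} (Ω Γ : Set (E n)) (X : E n → E n) (G : E n → Mat n) (g : E n → E n) : Prop :=
  ∃ u : ℕ → E n → E n, (∀ k, ContDiff ℝ ∞ (u k)) ∧
    Tendsto (fun k => eLpNorm (u k - X) 2 (volume.restrict Ω)) atTop (𝓝 0) ∧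
    Tendsto (fun k => eLpNorm (classicalGradient (u k) - G) 2 (volume.restrict Ω)) atTop (𝓝 0) ∧
    Tendsto (fun k => eLpNorm (u k - g) 2 (μHE[n - 1].restrict Γ)) atTop (𝓝 0)

/-- The divergence, as the trace of the gradient matrix. -/
def divergence {n : ℕ} (G : E n → Mat n) (x : E n) : ℝ := ∑ i, G x (i, i)

end Pipe

end

/-! Let `U` be the complement of the closure of `∂Ω \ Γ_O`, and let `H` be the closure in
`W^{1,2}(Ω)` of the smooth fields with compact support in `U`: they vanish on the inlet and the
walls and are free on the outlet. The claim is that the divergence maps `H` onto `L²(Ω)`; the open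
mapping theorem then supplies the constant. By `surjective_of_adjoint_bounded_below` it suffices
that the adjoint, in substance `p ↦ -∇p` with values in the dual `H'`, is bounded below. This is a
Nečas inequality `‖p‖ ≤ C ‖∇p‖_{H'}`, and it has two ingredients.

The inequality modulo finite rank. On the whole space, `P = (1 - cΔ)⁻¹ Q` gives the solution `V =
-c∇P`, `W = P` of `div V + W = Q` with `V` and `W` in `W^{1,2}` (`divParametrix_univ`).
`DivParametrix.inter_epigraphOf` carries this over to a set cut off by a `C²` graph, with zero
boundary values: two Piola-transformed reflections are added to `V`, weighted so that the sum
vanishes on the graph, and above the graph the divergence is right because `Q` vanishes below it. At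
the rim of the inlet the construction is used twice, first for the plane of the inlet and then for
the wall, whose chart direction is parallel to that plane. At the outlet nothing is reflected across
the outlet. Solving locally with `Q = p` and testing `∇p` against the solution bounds `‖p‖` by
`‖∇p‖_{H'}` and the norm of `p` in the dual of `W^{1,2}` (`HasLocalParametrix.exists_eLpNorm_le`).
The latter norm is a small multiple of `‖p‖` plus finitely many means (`exists_finite_rank_bound`),
and the small multiple is absorbed.

Injectivity of the gradient. If `∇p = 0` on `H`, then the extension of `p` by zero has vanishing
gradient in `U`, so it is locally constant there. Since `U` contains a neighborhood of a point of
`Γ_O`, it reaches out of `Ω`, where the extension is zero; as `Ω` is connected, `p = 0`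
(`HasZeroGradient.ae_eq_zero`). For this reason no zero mean condition on `q` appears. Compactness
of the finite rank part, in `exists_bound_of_finite_rank`, combines both ingredients. -/

open scoped NNReal

set_option linter.unusedSectionVars false

namespace Pipe

/-! ### Calculus of compactly supported Lipschitz maps and their `W^{1,2}` norm. -/

section LipschitzFields

variable {E : Type*} [NormedAddCommGroup E] [InnerProductSpace ℝ E] [FiniteDimensional ℝ E]
  [MeasurableSpace E] [BorelSpace E]
variable {F : Type*} [NormedAddCommGroup F] [NormedSpace ℝ F] [FiniteDimensional ℝ F]
variable {G : Type*} [NormedAddCommGroup G] [NormedSpace ℝ G] [FiniteDimensional ℝ G]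
variable {H : Type*} [NormedAddCommGroup H] [NormedSpace ℝ H] [FiniteDimensional ℝ H]

/-- Lipschitz maps with compact support. -/
structure CompactLipschitz (u : E → F) : Prop where
  exists_lipschitz : ∃ K, LipschitzWith K u
  hasCompactSupport : HasCompactSupport u

/-- The `W^{1,2}` norm of a Lipschitz map, computed from its almost everywhere derivative. -/
noncomputable def sobolevNorm (u : E → F) : ℝ≥0∞ :=
  eLpNorm u 2 volume + eLpNorm (fun x => ‖fderiv ℝ u x‖) 2 volume

/-- The divergence of a field, as the trace of its derivative. -/
noncomputable def fieldDiv (u : E → E) (x : E) : ℝ := LinearMap.trace ℝ E (fderiv ℝ u x).toLinearMap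

lemma aestronglyMeasurable_norm_fderiv (u : E → F) (μ : Measure E) :
    AEStronglyMeasurable (fun x => ‖fderiv ℝ u x‖) μ :=
  (measurable_fderiv ℝ u).norm.aestronglyMeasurable

/-- The trace of an endomorphism as a continuous linear functional. -/
noncomputable def traceCLM (E : Type*) [NormedAddCommGroup E] [InnerProductSpace ℝ E]
    [FiniteDimensional ℝ E] : (E →L[ℝ] E) →L[ℝ] ℝ :=
  LinearMap.toContinuousLinearMap
    ((LinearMap.trace ℝ E).comp (ContinuousLinearMap.coeLM ℝ))

lemma traceCLM_apply (A : E →L[ℝ] E) : traceCLM E A = LinearMap.trace ℝ E A.toLinearMap := rfl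

lemma fieldDiv_eq (u : E → E) : fieldDiv u = fun x => traceCLM E (fderiv ℝ u x) := rfl

lemma traceCLM_smulRight (l : E →L[ℝ] ℝ) (v : E) : traceCLM E (l.smulRight v) = l v := by
  rw [traceCLM_apply]
  exact LinearMap.trace_smulRight l.toLinearMap v

lemma measurable_fieldDiv (u : E → E) : Measurable (fieldDiv u) :=
  (traceCLM E).measurable.comp (measurable_fderiv ℝ u)

namespace CompactLipschitz

lemma continuous {u : E → F} (hu : CompactLipschitz u) : Continuous u :=
  hu.exists_lipschitz.choose_spec.continuous

lemma ae_differentiableAt {u : E → F} (hu : CompactLipschitz u) :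
    ∀ᵐ x, DifferentiableAt ℝ u x :=
  hu.exists_lipschitz.choose_spec.ae_differentiableAt

lemma aestronglyMeasurable {u : E → F} (hu : CompactLipschitz u) (μ : Measure E) :
    AEStronglyMeasurable u μ :=
  hu.continuous.aestronglyMeasurable

lemma memLp {u : E → F} (hu : CompactLipschitz u) : MemLp u 2 (volume : Measure E) :=
  hu.continuous.memLp_of_hasCompactSupport hu.hasCompactSupport

lemma exists_norm_le {u : E → F} (hu : CompactLipschitz u) : ∃ M : ℝ, 0 ≤ M ∧ ∀ x, ‖u x‖ ≤ M := by
  obtain ⟨C, hC⟩ := hu.continuous.bounded_above_of_compact_support hu.hasCompactSupport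
  exact ⟨max C 0, le_max_right _ _, fun x => (hC x).trans (le_max_left _ _)⟩

lemma memLp_norm_fderiv {u : E → F} (hu : CompactLipschitz u) :
    MemLp (fun x => ‖fderiv ℝ u x‖) 2 (volume : Measure E) := by
  obtain ⟨K, hK⟩ := hu.exists_lipschitz
  have hc : HasCompactSupport (fun x => ‖fderiv ℝ u x‖) :=
    (hu.hasCompactSupport.fderiv (𝕜 := ℝ)).norm
  have hind : (fun x => ‖fderiv ℝ u x‖) =
      (tsupport fun x => ‖fderiv ℝ u x‖).indicator (fun x => ‖fderiv ℝ u x‖) := by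
    rw [eq_comm, Set.indicator_eq_self]
    exact subset_closure
  rw [hind, memLp_indicator_iff_restrict (isClosed_tsupport _).measurableSet]
  have : IsFiniteMeasure (volume.restrict (tsupport fun x => ‖fderiv ℝ u x‖) : Measure E) :=
    ⟨by simpa using hc.isCompact.measure_lt_top⟩
  refine MemLp.of_bound (aestronglyMeasurable_norm_fderiv u _) K (Eventually.of_forall fun x => ?_)
  rw [norm_norm]
  exact norm_fderiv_le_of_lipschitz ℝ hK

lemma add {u v : E → F} (hu : CompactLipschitz u) (hv : CompactLipschitz v) :
    CompactLipschitz (u + v) := by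
  obtain ⟨K, hK⟩ := hu.exists_lipschitz
  obtain ⟨L, hL⟩ := hv.exists_lipschitz
  exact ⟨⟨_, hK.add hL⟩, hu.hasCompactSupport.add hv.hasCompactSupport⟩

lemma of_contDiff {u : E → F} (hu : ContDiff ℝ 1 u) (hc : HasCompactSupport u) :
    CompactLipschitz u :=
  ⟨hu.lipschitzWith_of_hasCompactSupport hc one_ne_zero, hc⟩

end CompactLipschitz

lemma sobolevNorm_add_le {u v : E → F} (hu : CompactLipschitz u) (hv : CompactLipschitz v) :
    sobolevNorm (u + v) ≤ sobolevNorm u + sobolevNorm v := by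
  have h1 := eLpNorm_add_le (hu.aestronglyMeasurable volume) (hv.aestronglyMeasurable volume)
    (p := 2) (by norm_num)
  have h2 : eLpNorm (fun x => ‖fderiv ℝ (u + v) x‖) 2 volume ≤
      eLpNorm (fun x => ‖fderiv ℝ u x‖) 2 volume + eLpNorm (fun x => ‖fderiv ℝ v x‖) 2 volume := by
    refine (eLpNorm_mono_ae
      (g := (fun x => ‖fderiv ℝ u x‖) + fun x => ‖fderiv ℝ v x‖) ?_).trans (eLpNorm_add_le (aestronglyMeasurable_norm_fderiv u volume)
      (aestronglyMeasurable_norm_fderiv v volume) (by norm_num))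
    filter_upwards [hu.ae_differentiableAt, hv.ae_differentiableAt] with x hx hy
    rw [fderiv_add hx hy, norm_norm, Pi.add_apply, Real.norm_of_nonneg (by positivity)]
    exact norm_add_le _ _
  unfold sobolevNorm
  refine (add_le_add h1 h2).trans (le_of_eq ?_)
  abel

lemma fieldDiv_add_ae {u v : E → E} (hu : CompactLipschitz u) (hv : CompactLipschitz v) :
    fieldDiv (u + v) =ᵐ[volume] fieldDiv u + fieldDiv v := by
  filter_upwards [hu.ae_differentiableAt, hv.ae_differentiableAt] with x hx hy
  simp [fieldDiv_eq, fderiv_add hx hy]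

/-- A continuous bilinear image of a bounded Lipschitz map and a compactly supported Lipschitz map
is Lipschitz with compact support. -/
lemma CompactLipschitz.bilin (L : G →L[ℝ] F →L[ℝ] H) {g : E → G} {K M : ℝ≥0}
    (hgK : LipschitzWith K g) (hgM : ∀ x, ‖g x‖ ≤ M) {u : E → F} (hu : CompactLipschitz u) :
    CompactLipschitz (fun x => L (g x) (u x)) := by
  obtain ⟨N, hN, hNu⟩ := hu.exists_norm_le
  obtain ⟨J, hJ⟩ := hu.exists_lipschitz
  refine ⟨⟨⟨‖L‖ * (M * J + K * N), by positivity⟩, ?_⟩, ?_⟩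
  · refine LipschitzWith.of_dist_le_mul fun x y => ?_
    have e : L (g x) (u x) - L (g y) (u y) = L (g x) (u x - u y) + L (g x - g y) (u y) := by
      simp
    rw [dist_eq_norm, e]
    have h1 : ‖L (g x) (u x - u y)‖ ≤ ‖L‖ * M * (J * dist x y) := by
      refine (L.le_opNorm₂ _ _).trans ?_
      gcongr
      · exact hgM x
      · rw [← dist_eq_norm]; exact hJ.dist_le_mul x y
    have h2 : ‖L (g x - g y) (u y)‖ ≤ ‖L‖ * (K * dist x y) * N := by
      refine (L.le_opNorm₂ _ _).trans ?_
      gcongr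
      · rw [← dist_eq_norm]; exact hgK.dist_le_mul x y
      · exact hNu y
    refine (norm_add_le _ _).trans ((add_le_add h1 h2).trans (le_of_eq ?_))
    change _ = (‖L‖ * (M * J + K * N)) * dist x y
    ring
  · exact hu.hasCompactSupport.mono fun x hx h => hx (by simp [h])

lemma sobolevNorm_bilin_le (L : G →L[ℝ] F →L[ℝ] H) {g : E → G} {K M : ℝ≥0}
    (hgK : LipschitzWith K g) (hgM : ∀ x, ‖g x‖ ≤ M) {u : E → F} (hu : CompactLipschitz u) :
    sobolevNorm (fun x => L (g x) (u x)) ≤ (‖L‖₊ * (M + K) : ℝ≥0) * sobolevNorm u := by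
  have h1 : eLpNorm (fun x => L (g x) (u x)) 2 volume ≤ (‖L‖₊ * M : ℝ≥0) * eLpNorm u 2 volume := by
    refine eLpNorm_le_nnreal_smul_eLpNorm_of_ae_le_mul (Eventually.of_forall fun x => ?_) _
    refine (L.le_opNorm₂ _ _).trans ?_
    simp only [NNReal.val_eq_coe, NNReal.coe_mul, coe_nnnorm]
    gcongr
    exact hgM x
  have h2 : eLpNorm (fun x => ‖fderiv ℝ (fun x => L (g x) (u x)) x‖) 2 volume ≤
      (‖L‖₊ * M : ℝ≥0) * eLpNorm (fun x => ‖fderiv ℝ u x‖) 2 volume +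
      (‖L‖₊ * K : ℝ≥0) * eLpNorm u 2 volume := by
    have e : ∀ᵐ x, ‖‖fderiv ℝ (fun x => L (g x) (u x)) x‖‖ ≤
        ‖(‖L‖₊ * M : ℝ) * ‖fderiv ℝ u x‖ + (‖L‖₊ * K : ℝ) * ‖u x‖‖ := by
      filter_upwards [hu.ae_differentiableAt, hgK.ae_differentiableAt (μ := volume)] with x hx hg
      rw [(L.hasFDerivAt_of_bilinear hg.hasFDerivAt hx.hasFDerivAt).fderiv, norm_norm,
        Real.norm_of_nonneg (by positivity)]
      refine ContinuousLinearMap.opNorm_le_bound _ (by positivity) fun v => ?_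
      have h3 : ‖L (g x) (fderiv ℝ u x v)‖ ≤ ‖L‖ * M * (‖fderiv ℝ u x‖ * ‖v‖) := by
        refine (L.le_opNorm₂ _ _).trans ?_
        gcongr
        · exact hgM x
        · exact ContinuousLinearMap.le_opNorm _ _
      have h4 : ‖L (fderiv ℝ g x v) (u x)‖ ≤ ‖L‖ * (K * ‖v‖) * ‖u x‖ := by
        refine (L.le_opNorm₂ _ _).trans ?_
        gcongr
        exact (ContinuousLinearMap.le_opNorm _ _).trans
          (by gcongr; exact norm_fderiv_le_of_lipschitz ℝ hgK)
      refine (norm_add_le _ _).trans ((add_le_add h3 h4).trans (le_of_eq ?_))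
      simp only [coe_nnnorm]
      ring
    refine (eLpNorm_mono_ae e).trans ?_
    refine (eLpNorm_add_le ?_ ?_ (by norm_num)).trans (add_le_add ?_ ?_)
    · exact (aestronglyMeasurable_norm_fderiv u _).const_mul _
    · exact ((hu.aestronglyMeasurable _).norm.const_mul _)
    · refine eLpNorm_le_nnreal_smul_eLpNorm_of_ae_le_mul (Eventually.of_forall fun x => ?_) _
      rw [← NNReal.coe_le_coe]; simp
    · refine eLpNorm_le_nnreal_smul_eLpNorm_of_ae_le_mul (Eventually.of_forall fun x => ?_) _
      rw [← NNReal.coe_le_coe]; simp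
  unfold sobolevNorm
  generalize eLpNorm u 2 volume = a at *
  generalize eLpNorm (fun x => ‖fderiv ℝ u x‖) 2 volume = b at *
  calc _ ≤ (‖L‖₊ * M : ℝ≥0) * a + ((‖L‖₊ * M : ℝ≥0) * b + (‖L‖₊ * K : ℝ≥0) * a) := add_le_add h1 h2
    _ ≤ (‖L‖₊ * M : ℝ≥0) * a + ((‖L‖₊ * M : ℝ≥0) * b + (‖L‖₊ * K : ℝ≥0) * (a + b)) := by
        gcongr; exact le_self_add
    _ = _ := by push_cast; ring

/-- The derivative of a map to a finite-dimensional space vanishes at almost every zero of it. -/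
lemma ae_fderiv_eq_zero_of_eq_zero {u : E → F} (hu : Continuous u)
    (hd : ∀ᵐ x, DifferentiableAt ℝ u x) : ∀ᵐ x, u x = 0 → fderiv ℝ u x = 0 := by
  rcases subsingleton_or_nontrivial E with hE | hE
  · refine Eventually.of_forall fun x _ => ?_
    ext v
    simp [Subsingleton.elim v 0]
  obtain ⟨e, he⟩ := exists_ne (0 : E)
  let b := Module.finBasis ℝ F
  have key : ∀ i, ∀ᵐ x, u x = 0 → DifferentiableAt ℝ u x → ∀ v, b.coord i (fderiv ℝ u x v) = 0 := by
    intro i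
    -- `ApproximatesLinearOn.norm_fderiv_sub_le` speaks of maps of `E` to itself, so each coordinate
    -- of `u` is embedded in `E` along `e`. On the zero set the resulting map is approximated by `0`
    -- with constant `0`, which forces its derivative to vanish almost everywhere there.
    let l : F →L[ℝ] E := (b.coord i).toContinuousLinearMap.smulRight e
    let S : Set E := {x | u x = 0} ∩ {x | DifferentiableAt ℝ u x}
    have hS : MeasurableSet S :=
      (isClosed_eq hu continuous_const).measurableSet.inter (measurableSet_of_differentiableAt ℝ u)
    have ha : ApproximatesLinearOn (fun x => l (u x)) (0 : E →L[ℝ] E) S 0 := by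
      intro x hx y hy
      have h1 : u x = 0 := hx.1
      have h2 : u y = 0 := hy.1
      simp [h1, h2]
    have := ha.norm_fderiv_sub_le volume hS (fun x => l.comp (fderiv ℝ u x)) (fun x hx =>
      (l.hasFDerivAt.comp x hx.2.hasFDerivAt).hasFDerivWithinAt)
    rw [ae_restrict_iff' hS] at this
    filter_upwards [this] with x hx h0 hdx v
    have h3 : l.comp (fderiv ℝ u x) = 0 := by simpa using hx ⟨h0, hdx⟩
    have h4 : b.coord i (fderiv ℝ u x v) • e = 0 := congrArg (fun T : E →L[ℝ] E => T v) h3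
    exact (smul_eq_zero.1 h4).resolve_right he
  filter_upwards [hd, ae_all_iff.2 key] with x hx hk h0
  ext v
  refine b.ext_elem fun i => ?_
  simpa using hk i h0 hx v

/-- Restriction to an open set of a Lipschitz map vanishing on its boundary. -/
lemma LipschitzWith.indicator_of_frontier {K : ℝ≥0} {u : E → F} (hu : LipschitzWith K u) {A : Set E}
    (h0 : ∀ x ∈ frontier A, u x = 0) : LipschitzWith K (A.indicator u) := by
  have key : ∀ x ∈ A, ∀ y ∉ A, ‖u x‖ ≤ K * dist x y := by
    intro x hx y hy
    -- A segment leaving `A` meets the frontier, where `u` vanishes; otherwise the interiors of `A`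
    -- and of its complement would disconnect it.
    obtain ⟨z, hz, hzA⟩ : ∃ z ∈ segment ℝ x y, z ∈ frontier A := by
      by_contra! hno
      have hc : IsPreconnected (segment ℝ x y) := (convex_segment x y).isPreconnected
      have hsub : ∀ z ∈ segment ℝ x y, z ∈ interior A ∨ z ∈ interior Aᶜ := by
        intro z hz
        by_contra! h
        refine hno z hz ⟨?_, h.1⟩
        by_contra h'
        exact h.2 (by rwa [interior_compl])
      obtain ⟨z, -, h1, h2⟩ := hc _ _ isOpen_interior isOpen_interior hsub
        ⟨x, left_mem_segment ℝ x y, (hsub x (left_mem_segment ℝ x y)).resolve_right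
          fun h => interior_subset h hx⟩
        ⟨y, right_mem_segment ℝ x y, (hsub y (right_mem_segment ℝ x y)).resolve_left
          fun h => hy (interior_subset h)⟩
      exact interior_subset h2 (interior_subset h1)
    have h1 := hu.dist_le_mul x z
    rw [h0 z hzA, dist_zero_right] at h1
    refine h1.trans ?_
    gcongr
    have := dist_add_dist_of_mem_segment hz
    linarith [dist_nonneg (x := z) (y := y)]
  refine LipschitzWith.of_dist_le_mul fun x y => ?_
  by_cases hx : x ∈ A <;> by_cases hy : y ∈ A
  · simpa [hx, hy] using hu.dist_le_mul x y
  · simpa [hx, hy] using key x hx y hy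
  · simpa [hx, hy, dist_comm] using key y hy x hx
  · simp only [hx, hy, not_false_eq_true, indicator_of_notMem, dist_self]; positivity

lemma CompactLipschitz.indicator {u : E → F} (hu : CompactLipschitz u) {A : Set E}
    (h0 : ∀ x ∈ frontier A, u x = 0) : CompactLipschitz (A.indicator u) := by
  obtain ⟨K, hK⟩ := hu.exists_lipschitz
  refine ⟨⟨K, LipschitzWith.indicator_of_frontier hK h0⟩, hu.hasCompactSupport.mono ?_⟩
  intro x hx h
  exact hx (by simp [Set.indicator, h])

/-- Off `A` the restricted map is zero, and a Lipschitz map has zero derivative at almost all of its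
zeros. Hence the frontier of `A` need not be a null set. -/
lemma ae_fderiv_indicator {u : E → F} (hu : CompactLipschitz u) {A : Set E} (hA : IsOpen A)
    (h0 : ∀ x ∈ frontier A, u x = 0) : ∀ᵐ x,
      (x ∈ A → fderiv ℝ (A.indicator u) x = fderiv ℝ u x) ∧
      (x ∉ A → fderiv ℝ (A.indicator u) x = 0) := by
  have h := hu.indicator h0
  filter_upwards [ae_fderiv_eq_zero_of_eq_zero h.continuous h.ae_differentiableAt] with x hx
  refine ⟨fun hxA => Filter.EventuallyEq.fderiv_eq ?_, fun hxA => hx (by simp [hxA])⟩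
  filter_upwards [hA.mem_nhds hxA] with y hy
  simp [hy]

lemma sobolevNorm_indicator_le {u : E → F} (hu : CompactLipschitz u) {A : Set E} (hA : IsOpen A)
    (h0 : ∀ x ∈ frontier A, u x = 0) : sobolevNorm (A.indicator u) ≤ sobolevNorm u := by
  refine add_le_add (eLpNorm_indicator_le _) (eLpNorm_mono_ae ?_)
  filter_upwards [ae_fderiv_indicator hu hA h0] with x hx
  by_cases hxA : x ∈ A
  · rw [hx.1 hxA]
  · rw [hx.2 hxA]; simp

lemma fieldDiv_indicator_ae {u : E → E} (hu : CompactLipschitz u) {A : Set E} (hA : IsOpen A)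
    (h0 : ∀ x ∈ frontier A, u x = 0) :
    fieldDiv (A.indicator u) =ᵐ[volume] A.indicator (fieldDiv u) := by
  filter_upwards [ae_fderiv_indicator hu hA h0] with x hx
  by_cases hxA : x ∈ A
  · simp [fieldDiv_eq, hx.1 hxA, hxA]
  · simp [fieldDiv_eq, hx.2 hxA, hxA]

end LipschitzFields

end Pipe

namespace Pipe

/-! ### Operations on Lipschitz maps that are bounded in `W^{1,2}`. -/

section BoundedOperators

variable {E : Type*} [NormedAddCommGroup E] [InnerProductSpace ℝ E] [FiniteDimensional ℝ E]
  [MeasurableSpace E] [BorelSpace E]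
variable {F : Type*} [NormedAddCommGroup F] [NormedSpace ℝ F] [FiniteDimensional ℝ F]
variable {G : Type*} [NormedAddCommGroup G] [NormedSpace ℝ G] [FiniteDimensional ℝ G]
variable {H : Type*} [NormedAddCommGroup H] [NormedSpace ℝ H] [FiniteDimensional ℝ H]

/-- Composition with an antilipschitz map multiplies volumes by a bounded factor at most. -/
lemma exists_map_volume_le {R : E → E} (hR : Measurable R) {K : ℝ≥0} (hK : AntilipschitzWith K R) :
    ∃ C : ℝ≥0, Measure.map R (volume : Measure E) ≤ C • (volume : Measure E) := by
  let d := Module.finrank ℝ E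
  refine ⟨K ^ d, Measure.le_iff.2 fun s hs => ?_⟩
  rw [Measure.map_apply hR hs]
  -- Volume is a multiple of the Hausdorff measure of dimension `d`, for which preimages under
  -- antilipschitz maps are estimated; the multiple appears on both sides.
  have hc := Measure.isAddLeftInvariant_eq_smul (volume : Measure E) μH[(d : ℝ)]
  rw [hc]
  simp only [Measure.smul_apply, ENNReal.smul_def, smul_eq_mul]
  have := hK.hausdorffMeasure_preimage_le (d := d) (by positivity) s
  rw [ENNReal.rpow_natCast] at this
  refine (mul_le_mul_right this _).trans (le_of_eq ?_)
  push_cast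
  ring

lemma ae_comp_of_map_le {R : E → E} (hR : Measurable R) {C : ℝ≥0}
    (hC : Measure.map R (volume : Measure E) ≤ C • (volume : Measure E)) {P : E → Prop}
    (hP : ∀ᵐ x, P x) : ∀ᵐ x, P (R x) := by
  have h : ∀ᵐ x ∂(Measure.map R (volume : Measure E)), P x := by
    refine (Measure.absolutelyContinuous_of_le hC).trans ?_ hP
    exact Measure.smul_absolutelyContinuous
  exact ae_of_ae_map hR.aemeasurable h

lemma exists_eLpNorm_comp_le {R : E → E} (hR : Measurable R) {K : ℝ≥0}
    (hK : AntilipschitzWith K R) :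
    ∃ C : ℝ≥0, ∀ f : E → ℝ, AEStronglyMeasurable f volume →
      eLpNorm (fun x => f (R x)) 2 volume ≤ C * eLpNorm f 2 volume := by
  obtain ⟨C, hC⟩ := exists_map_volume_le hR hK
  refine ⟨C ^ (1 / 2 : ℝ), fun f hf => ?_⟩
  have hac : Measure.map R (volume : Measure E) ≪ volume :=
    (Measure.absolutelyContinuous_of_le hC).trans Measure.smul_absolutelyContinuous
  have h1 := eLpNorm_map_measure (p := 2) (hf.mono_ac hac) hR.aemeasurable
  change eLpNorm (f ∘ R) 2 volume ≤ _
  rw [← h1]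
  refine (eLpNorm_mono_measure f hC).trans ?_
  have h2 := eLpNorm_smul_measure_of_ne_top (p := 2) (by norm_num) (f := f) (μ := volume) (C : ℝ≥0∞)
  have h3 : (C • (volume : Measure E)) = (C : ℝ≥0∞) • volume := rfl
  rw [h3, h2]
  simp [ENNReal.coe_rpow_of_nonneg]

/-- An operation on compactly supported Lipschitz maps that is bounded in `W^{1,2}`. -/
def BoundedOperation (T : (E → F) → E → G) : Prop :=
  ∃ C : ℝ≥0, ∀ u, CompactLipschitz u →
    CompactLipschitz (T u) ∧ sobolevNorm (T u) ≤ C * sobolevNorm u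

namespace BoundedOperation

lemma add {T S : (E → F) → E → G} (hT : BoundedOperation T) (hS : BoundedOperation S) :
    BoundedOperation (fun u => T u + S u) := by
  obtain ⟨C, hC⟩ := hT
  obtain ⟨D, hD⟩ := hS
  refine ⟨C + D, fun u hu => ⟨(hC u hu).1.add (hD u hu).1, ?_⟩⟩
  refine (sobolevNorm_add_le (hC u hu).1 (hD u hu).1).trans ?_
  rw [ENNReal.coe_add, add_mul]
  exact add_le_add (hC u hu).2 (hD u hu).2

lemma comp {S : (E → G) → E → H} {T : (E → F) → E → G} (hS : BoundedOperation S)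
    (hT : BoundedOperation T) : BoundedOperation (fun u => S (T u)) := by
  obtain ⟨C, hC⟩ := hT
  obtain ⟨D, hD⟩ := hS
  refine ⟨D * C, fun u hu => ⟨(hD _ (hC u hu).1).1, ?_⟩⟩
  refine (hD _ (hC u hu).1).2.trans ?_
  rw [ENNReal.coe_mul, mul_assoc]
  gcongr
  exact (hC u hu).2

lemma id : BoundedOperation (fun u : E → F => u) :=
  ⟨1, fun u hu => ⟨hu, by simp⟩⟩

lemma bilin (L : G →L[ℝ] F →L[ℝ] H) {g : E → G} {K M : ℝ≥0}
    (hgK : LipschitzWith K g) (hgM : ∀ x, ‖g x‖ ≤ M) :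
    BoundedOperation (fun (u : E → F) x => L (g x) (u x)) :=
  ⟨_, fun _ hu => ⟨hu.bilin L hgK hgM, sobolevNorm_bilin_le L hgK hgM hu⟩⟩

lemma const_smul (c : ℝ) : BoundedOperation (fun (u : E → F) x => c • u x) :=
  bilin (ContinuousLinearMap.lsmul ℝ ℝ) (LipschitzWith.const c) (M := ‖c‖₊) (fun _ => le_rfl)

/-- The Lipschitz bound enters through the chain rule. The antilipschitz bound limits the distortion
of volume, lets null sets pull back to null sets, and makes `R` a closed embedding, so that supports
stay compact. -/
lemma precomp {R : E → E} {K J : ℝ≥0} (hK : LipschitzWith K R) (hJ : AntilipschitzWith J R) :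
    BoundedOperation (fun (u : E → F) x => u (R x)) := by
  obtain ⟨C, hC⟩ := exists_eLpNorm_comp_le hK.continuous.measurable hJ
  obtain ⟨D, hD⟩ := exists_map_volume_le hK.continuous.measurable hJ
  refine ⟨C + K * C, fun u hu => ⟨?_, ?_⟩⟩
  · obtain ⟨L, hL⟩ := hu.exists_lipschitz
    exact ⟨⟨_, hL.comp hK⟩,
      hu.hasCompactSupport.comp_isClosedEmbedding (hJ.isClosedEmbedding hK.uniformContinuous)⟩
  · have h1 : eLpNorm (fun x => u (R x)) 2 volume ≤ C * eLpNorm u 2 volume := by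
      have := hC (fun x => ‖u x‖) (hu.aestronglyMeasurable _).norm
      rwa [eLpNorm_norm, eLpNorm_norm] at this
    have h2 : eLpNorm (fun x => ‖fderiv ℝ (fun x => u (R x)) x‖) 2 volume ≤
        K * (C * eLpNorm (fun x => ‖fderiv ℝ u x‖) 2 volume) := by
      refine le_trans ?_ (mul_le_mul_right (hC _ (aestronglyMeasurable_norm_fderiv u volume)) _)
      refine eLpNorm_le_nnreal_smul_eLpNorm_of_ae_le_mul
        (g := fun x => ‖fderiv ℝ u (R x)‖) ?_ _
      filter_upwards [ae_comp_of_map_le hK.continuous.measurable hD hu.ae_differentiableAt,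
        hK.ae_differentiableAt (μ := volume)] with x hx hRx
      have h3 : fderiv ℝ (fun x => u (R x)) x = (fderiv ℝ u (R x)).comp (fderiv ℝ R x) :=
        (hx.hasFDerivAt.comp x hRx.hasFDerivAt).fderiv
      rw [← NNReal.coe_le_coe]
      simp only [NNReal.coe_mul, coe_nnnorm, norm_norm]
      rw [h3, mul_comm]
      refine (ContinuousLinearMap.opNorm_comp_le _ _).trans ?_
      gcongr
      exact norm_fderiv_le_of_lipschitz ℝ hK
    unfold sobolevNorm
    generalize eLpNorm u 2 volume = a at *
    generalize eLpNorm (fun x => ‖fderiv ℝ u x‖) 2 volume = b at *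
    refine (add_le_add h1 h2).trans ?_
    calc _ ≤ (C * a + K * (C * b)) + (C * b + K * (C * a)) := le_self_add
      _ = _ := by push_cast; ring

end BoundedOperation

end BoundedOperators

/-! ### Higher order reflection at a graph, compatible with the divergence. -/

section Reflection

variable {E : Type*} [NormedAddCommGroup E] [InnerProductSpace ℝ E] [FiniteDimensional ℝ E]
  [MeasurableSpace E] [BorelSpace E]

/-- A function whose epigraph in the direction `ν` is a uniformly `C^{1,1}` domain. -/
structure IsGraphFunction (ν : E) (Φ : E → ℝ) : Prop where
  norm_eq_one : ‖ν‖ = 1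
  contDiff : ContDiff ℝ 2 Φ
  invariant : ∀ y (t : ℝ), Φ (y + t • ν) = Φ y
  exists_lipschitz : ∃ K, LipschitzWith K Φ
  exists_lipschitz_fderiv : ∃ K, LipschitzWith K (fderiv ℝ Φ)

/-- The strict epigraph of `Φ` in the direction `ν`. -/
def epigraphOf (ν : E) (Φ : E → ℝ) : Set E := {x | Φ x < inner ℝ ν x}

/-- The height over the graph of `Φ`. -/
noncomputable def graphHeight (ν : E) (Φ : E → ℝ) (x : E) : ℝ := inner ℝ ν x - Φ x

/-- The map that multiplies the height over the graph of `Φ` by `-l`. -/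
noncomputable def graphReflection (ν : E) (Φ : E → ℝ) (l : ℝ) (x : E) : E :=
  x - ((1 + l) * graphHeight ν Φ x) • ν

/-- The Piola transform of a field under `graphReflection`, up to normalisation. -/
noncomputable def graphPiola (ν : E) (Φ : E → ℝ) (l : ℝ) (u : E → E) (x : E) : E :=
  u (graphReflection ν Φ l x) -
    ((1 + l) / l) • (fderiv ℝ (graphHeight ν Φ) x (u (graphReflection ν Φ l x)) • ν)

/-- The higher order reflection of a field which vanishes on the graph and below it. -/
noncomputable def reflectField (ν : E) (Φ : E → ℝ) (u : E → E) : E → E :=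
  (epigraphOf ν Φ).indicator (u + ((fun x => (3 : ℝ) • graphPiola ν Φ 1 u x) +
    fun x => (-4 : ℝ) • graphPiola ν Φ 2 u x))

/-- The higher order reflection of a function which vanishes on the graph and below it. -/
noncomputable def reflectFun (ν : E) (Φ : E → ℝ) (w : E → ℝ) : E → ℝ :=
  (epigraphOf ν Φ).indicator (w + ((fun x => (3 : ℝ) • w (graphReflection ν Φ 1 x)) +
    fun x => (-4 : ℝ) • w (graphReflection ν Φ 2 x)))

namespace IsGraphFunction

variable {ν : E} {Φ : E → ℝ}

lemma graphHeight_add_smul (h : IsGraphFunction ν Φ) (x : E) (t : ℝ) :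
    graphHeight ν Φ (x + t • ν) = graphHeight ν Φ x + t := by
  simp only [graphHeight, h.invariant, inner_add_right, inner_smul_right,
    real_inner_self_eq_norm_sq, h.norm_eq_one]
  ring

lemma graphHeight_graphReflection (h : IsGraphFunction ν Φ) (l : ℝ) (x : E) :
    graphHeight ν Φ (graphReflection ν Φ l x) = -l * graphHeight ν Φ x := by
  rw [graphReflection, sub_eq_add_neg, ← neg_smul, h.graphHeight_add_smul]
  ring

lemma graphReflection_graphReflection (h : IsGraphFunction ν Φ) {l : ℝ} (hl : l ≠ 0) (x : E) :
    graphReflection ν Φ l⁻¹ (graphReflection ν Φ l x) = x := by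
  have e := h.graphHeight_graphReflection l x
  unfold graphReflection at e ⊢
  rw [e, sub_sub, ← add_smul]
  have : (1 + l) * graphHeight ν Φ x + (1 + l⁻¹) * (-l * graphHeight ν Φ x) = 0 := by
    field_simp; ring
  rw [this]; simp

lemma contDiff_graphHeight (h : IsGraphFunction ν Φ) : ContDiff ℝ 2 (graphHeight ν Φ) :=
  (contDiff_const.inner ℝ contDiff_id).sub h.contDiff

lemma fderiv_graphHeight (h : IsGraphFunction ν Φ) (x : E) :
    fderiv ℝ (graphHeight ν Φ) x = innerSL ℝ ν - fderiv ℝ Φ x := by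
  have h1 : HasFDerivAt (fun y : E => inner ℝ ν y) (innerSL ℝ ν) x :=
    (innerSL ℝ ν).hasFDerivAt
  exact (h1.sub (h.contDiff.differentiable (by norm_num) x).hasFDerivAt).fderiv

lemma exists_lipschitz_graphHeight (h : IsGraphFunction ν Φ) :
    ∃ K, LipschitzWith K (graphHeight ν Φ) := by
  obtain ⟨K, hK⟩ := h.exists_lipschitz
  exact ⟨_, (innerSL ℝ ν : E →L[ℝ] ℝ).lipschitz.sub hK⟩

lemma exists_lipschitz_fderiv_graphHeight (h : IsGraphFunction ν Φ) :
    ∃ K, LipschitzWith K (fderiv ℝ (graphHeight ν Φ)) := by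
  obtain ⟨K, hK⟩ := h.exists_lipschitz_fderiv
  have : fderiv ℝ (graphHeight ν Φ) = fun x => innerSL ℝ ν - fderiv ℝ Φ x :=
    funext h.fderiv_graphHeight
  exact ⟨_, this ▸ (LipschitzWith.const (innerSL ℝ ν)).sub hK⟩

lemma exists_lipschitz_graphReflection (h : IsGraphFunction ν Φ) (l : ℝ) :
    ∃ K, LipschitzWith K (graphReflection ν Φ l) := by
  obtain ⟨K, hK⟩ := h.exists_lipschitz_graphHeight
  let T : ℝ →L[ℝ] E := (1 + l) • (ContinuousLinearMap.id ℝ ℝ).smulRight ν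
  have : graphReflection ν Φ l = fun x => x - T (graphHeight ν Φ x) := by
    ext x; simp [graphReflection, T, smul_smul]
  exact ⟨_, this ▸ LipschitzWith.id.sub (T.lipschitz.comp hK)⟩

/-- The reflection with ratio `l⁻¹` is a Lipschitz left inverse. -/
lemma exists_antilipschitz_graphReflection (h : IsGraphFunction ν Φ) {l : ℝ} (hl : l ≠ 0) :
    ∃ K, AntilipschitzWith K (graphReflection ν Φ l) := by
  obtain ⟨K, hK⟩ := h.exists_lipschitz_graphReflection l⁻¹
  exact ⟨K, hK.to_rightInverse (h.graphReflection_graphReflection hl)⟩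

lemma fderiv_graphHeight_self (h : IsGraphFunction ν Φ) (x : E) :
    fderiv ℝ (graphHeight ν Φ) x ν = 1 := by
  have h1 : HasDerivAt (fun t : ℝ => x + t • ν) ν 0 := by
    simpa using ((hasDerivAt_id (0 : ℝ)).smul_const ν).const_add x
  have h0 : x + (0 : ℝ) • ν = x := by simp
  have h2 : HasDerivAt (fun t : ℝ => graphHeight ν Φ (x + t • ν))
      (fderiv ℝ (graphHeight ν Φ) x ν) 0 := by
    refine HasFDerivAt.comp_hasDerivAt (l := graphHeight ν Φ) (0 : ℝ) ?_ h1
    rw [h0]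
    exact (h.contDiff_graphHeight.differentiable (by norm_num) x).hasFDerivAt
  have h3 : HasDerivAt (fun t : ℝ => graphHeight ν Φ (x + t • ν)) 1 0 := by
    simp only [h.graphHeight_add_smul]
    exact (hasDerivAt_id (0 : ℝ)).const_add _
  exact h2.unique h3

/-- The derivative of the height does not change in the direction `ν`. -/
lemma fderiv_fderiv_graphHeight_self (h : IsGraphFunction ν Φ) (x : E) :
    fderiv ℝ (fderiv ℝ (graphHeight ν Φ)) x ν = 0 := by
  have hinv : ∀ t : ℝ, fderiv ℝ (graphHeight ν Φ) (x + t • ν) = fderiv ℝ (graphHeight ν Φ) x := by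
    intro t
    have : (fun y => graphHeight ν Φ (y + t • ν)) = fun y => graphHeight ν Φ y + t :=
      funext fun y => h.graphHeight_add_smul y t
    rw [← fderiv_comp_add_right, this, fderiv_add_const]
  have hd : DifferentiableAt ℝ (fderiv ℝ (graphHeight ν Φ)) x :=
    (h.contDiff_graphHeight.fderiv_right (m := 1) (by norm_num)).differentiable (by norm_num) x
  have h1 : HasDerivAt (fun t : ℝ => x + t • ν) ν 0 := by
    simpa using ((hasDerivAt_id (0 : ℝ)).smul_const ν).const_add x
  have h0 : x + (0 : ℝ) • ν = x := by simp
  have h2 : HasDerivAt (fun t : ℝ => fderiv ℝ (graphHeight ν Φ) (x + t • ν))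
      (fderiv ℝ (fderiv ℝ (graphHeight ν Φ)) x ν) 0 := by
    refine HasFDerivAt.comp_hasDerivAt (0 : ℝ) ?_ h1
    rw [h0]
    exact hd.hasFDerivAt
  simp only [hinv] at h2
  exact h2.unique (hasDerivAt_const _ _)

lemma isOpen_epigraphOf (h : IsGraphFunction ν Φ) : IsOpen (epigraphOf ν Φ) :=
  isOpen_lt h.contDiff.continuous (continuous_const.inner continuous_id)

lemma mem_epigraphOf {x : E} : x ∈ epigraphOf ν Φ ↔ 0 < graphHeight ν Φ x := by
  simp [epigraphOf, graphHeight]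

lemma graphHeight_of_mem_frontier (h : IsGraphFunction ν Φ) {x : E}
    (hx : x ∈ frontier (epigraphOf ν Φ)) : graphHeight ν Φ x = 0 := by
  have := frontier_lt_subset_eq h.contDiff.continuous
    ((continuous_const (y := ν)).inner continuous_id) hx
  have h2 : Φ x = inner ℝ ν x := this
  simp [graphHeight, h2]

lemma graphReflection_of_height_eq_zero {x : E} (hx : graphHeight ν Φ x = 0) (l : ℝ) :
    graphReflection ν Φ l x = x := by
  simp [graphReflection, hx]

lemma graphReflection_notMem (h : IsGraphFunction ν Φ) {x : E} (hx : x ∈ epigraphOf ν Φ) {l : ℝ}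
    (hl : 0 < l) : graphReflection ν Φ l x ∉ epigraphOf ν Φ := by
  rw [mem_epigraphOf] at hx ⊢
  rw [h.graphHeight_graphReflection]
  nlinarith

lemma boundedOperation_precomp {F : Type*} [NormedAddCommGroup F] [NormedSpace ℝ F]
    [FiniteDimensional ℝ F] (h : IsGraphFunction ν Φ) {l : ℝ} (hl : l ≠ 0) :
    BoundedOperation (fun (u : E → F) x => u (graphReflection ν Φ l x)) := by
  obtain ⟨K, hK⟩ := h.exists_lipschitz_graphReflection l
  obtain ⟨J, hJ⟩ := h.exists_antilipschitz_graphReflection hl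
  exact BoundedOperation.precomp hK hJ

/-- The transform multiplies by the derivative of the height. This must be bounded and Lipschitz to
preserve `W^{1,2}`, which is the purpose of the two Lipschitz conditions in `IsGraphFunction`. -/
lemma boundedOperation_graphPiola (h : IsGraphFunction ν Φ) {l : ℝ} (hl : l ≠ 0) :
    BoundedOperation (graphPiola ν Φ l) := by
  obtain ⟨K, hK⟩ := h.exists_lipschitz_fderiv_graphHeight
  obtain ⟨M, hM⟩ := h.exists_lipschitz_graphHeight
  have hb := BoundedOperation.bilin (F := E) ((ContinuousLinearMap.smulRightL ℝ E E).flip ν) hK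
    (fun x => norm_fderiv_le_of_lipschitz ℝ hM (x₀ := x))
  have := (h.boundedOperation_precomp (F := E) hl).add
    (((BoundedOperation.const_smul (-((1 + l) / l))).comp hb).comp
      (h.boundedOperation_precomp (F := E) hl))
  convert this using 3 with u x
  funext x
  simp only [graphPiola, Pi.add_apply, sub_eq_add_neg, neg_smul]
  rfl

lemma ae_comp_graphReflection (h : IsGraphFunction ν Φ) {l : ℝ} (hl : l ≠ 0) {P : E → Prop}
    (hP : ∀ᵐ x, P x) : ∀ᵐ x, P (graphReflection ν Φ l x) := by
  obtain ⟨K, hK⟩ := h.exists_lipschitz_graphReflection l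
  obtain ⟨J, hJ⟩ := h.exists_antilipschitz_graphReflection hl
  obtain ⟨C, hC⟩ := exists_map_volume_le hK.continuous.measurable hJ
  exact ae_comp_of_map_le hK.continuous.measurable hC hP

lemma hasFDerivAt_graphReflection (h : IsGraphFunction ν Φ) (l : ℝ) (x : E) :
    HasFDerivAt (graphReflection ν Φ l)
      (ContinuousLinearMap.id ℝ E -
        ((1 + l) • fderiv ℝ (graphHeight ν Φ) x).smulRight ν) x := by
  have h1 := (h.contDiff_graphHeight.differentiable (by norm_num) x).hasFDerivAt
  exact (hasFDerivAt_id x).sub ((h1.const_mul (1 + l)).smul_const ν)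

/-- Put `R = graphReflection ν Φ l` and `g = fderiv ℝ (graphHeight ν Φ)`. Since `g ν = 1`, the
inverse of `DR = 1 - (1 + l) g ⊗ ν` is `1 - ((1 + l) / l) g ⊗ ν`, so `graphPiola` is `(DR)⁻¹ (u ∘
R)`. The determinant of `DR` is the constant `-l`, and the Piola identity needs no further factor.
-/
lemma fieldDiv_graphPiola_ae (h : IsGraphFunction ν Φ) {l : ℝ} (hl : l ≠ 0) {u : E → E}
    (hu : CompactLipschitz u) :
    ∀ᵐ x, fieldDiv (graphPiola ν Φ l u) x = fieldDiv u (graphReflection ν Φ l x) := by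
  filter_upwards [h.ae_comp_graphReflection hl hu.ae_differentiableAt] with x hx
  set R := graphReflection ν Φ l with hR
  set g := fderiv ℝ (graphHeight ν Φ) with hg
  set B := fderiv ℝ u (R x) with hB
  have hw := hx.hasFDerivAt.comp x (h.hasFDerivAt_graphReflection l x)
  have hdg : DifferentiableAt ℝ g x :=
    (h.contDiff_graphHeight.fderiv_right (m := 1) (by norm_num)).differentiable (by norm_num) x
  have hgw := hdg.hasFDerivAt.clm_apply hw
  have hP := hw.sub ((hgw.smul_const ν).const_smul ((1 + l) / l))
  have hP' : fderiv ℝ (graphPiola ν Φ l u) x = _ := hP.fderiv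
  simp only [fieldDiv_eq]
  rw [hP', map_sub, map_smul, traceCLM_smulRight]
  have e1 : traceCLM E (B.comp (ContinuousLinearMap.id ℝ E - ((1 + l) • g x).smulRight ν)) =
      traceCLM E B - (1 + l) * g x (B ν) := by
    have : B.comp (ContinuousLinearMap.id ℝ E - ((1 + l) • g x).smulRight ν) =
        B - ((1 + l) • g x).smulRight (B ν) := by
      ext v; simp
    rw [this, map_sub, traceCLM_smulRight]; simp
  rw [e1]
  have hν : g x ν = 1 := h.fderiv_graphHeight_self x
  -- The second derivatives of `Φ` enter the trace only through this value, so they drop out.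
  have hν2 : fderiv ℝ g x ν = 0 := h.fderiv_fderiv_graphHeight_self x
  simp only [add_apply, ContinuousLinearMap.comp_apply, ContinuousLinearMap.flip_apply, hν2,
    zero_apply, add_zero, sub_apply, ContinuousLinearMap.smulRight_apply,
    ContinuousLinearMap.id_apply, smul_apply, smul_eq_mul, map_sub, map_smul]
  change _ - _ - (1 + l) / l * ((g x) (B ν) - (1 + l) * g x ν * g x (B ν)) = traceCLM E B
  rw [hν]
  field_simp
  ring

/-! The reflected fields and functions. -/

lemma boundedOperation_sum (h : IsGraphFunction ν Φ) :
    BoundedOperation (fun u : E → E => u + ((fun x => (3 : ℝ) • graphPiola ν Φ 1 u x) +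
      fun x => (-4 : ℝ) • graphPiola ν Φ 2 u x)) :=
  BoundedOperation.id.add
    (((BoundedOperation.const_smul 3).comp (h.boundedOperation_graphPiola one_ne_zero)).add
      ((BoundedOperation.const_smul (-4)).comp (h.boundedOperation_graphPiola two_ne_zero)))

lemma boundedOperation_sum' (h : IsGraphFunction ν Φ) :
    BoundedOperation (fun w : E → ℝ => w + ((fun x => (3 : ℝ) • w (graphReflection ν Φ 1 x)) +
      fun x => (-4 : ℝ) • w (graphReflection ν Φ 2 x))) :=
  BoundedOperation.id.add
    (((BoundedOperation.const_smul 3).comp (h.boundedOperation_precomp one_ne_zero)).add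
      ((BoundedOperation.const_smul (-4)).comp (h.boundedOperation_precomp two_ne_zero)))

/-- On the graph both reflections are the identity, and the sum is `(1 + 3 - 4) u - (3 · 2 - 4 · (3
/ 2)) g(u) ν`, with `g` the derivative of the height. Annihilating both coefficients determines the
weights `3` and `-4`; a single reflection with positive ratio could not satisfy both equations. -/
lemma sum_eq_zero_of_mem_frontier (h : IsGraphFunction ν Φ) (u : E → E) :
    ∀ x ∈ frontier (epigraphOf ν Φ), (u + ((fun x => (3 : ℝ) • graphPiola ν Φ 1 u x) +
      fun x => (-4 : ℝ) • graphPiola ν Φ 2 u x)) x = 0 := by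
  intro x hx
  have h0 := h.graphHeight_of_mem_frontier hx
  simp only [Pi.add_apply, graphPiola, graphReflection_of_height_eq_zero h0]
  module

lemma sum_eq_zero_of_mem_frontier' (h : IsGraphFunction ν Φ) (w : E → ℝ) :
    ∀ x ∈ frontier (epigraphOf ν Φ), (w + ((fun x => (3 : ℝ) • w (graphReflection ν Φ 1 x)) +
      fun x => (-4 : ℝ) • w (graphReflection ν Φ 2 x))) x = 0 := by
  intro x hx
  have h0 := h.graphHeight_of_mem_frontier hx
  simp only [Pi.add_apply, graphReflection_of_height_eq_zero h0]
  module

lemma boundedOperation_reflectField (h : IsGraphFunction ν Φ) :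
    BoundedOperation (reflectField ν Φ) := by
  obtain ⟨C, hC⟩ := h.boundedOperation_sum
  exact ⟨C, fun u hu => ⟨(hC u hu).1.indicator (h.sum_eq_zero_of_mem_frontier u),
    (sobolevNorm_indicator_le (hC u hu).1 h.isOpen_epigraphOf
      (h.sum_eq_zero_of_mem_frontier u)).trans (hC u hu).2⟩⟩

lemma boundedOperation_reflectFun (h : IsGraphFunction ν Φ) :
    BoundedOperation (reflectFun ν Φ) := by
  obtain ⟨C, hC⟩ := h.boundedOperation_sum'
  exact ⟨C, fun u hu => ⟨(hC u hu).1.indicator (h.sum_eq_zero_of_mem_frontier' u),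
    (sobolevNorm_indicator_le (hC u hu).1 h.isOpen_epigraphOf
      (h.sum_eq_zero_of_mem_frontier' u)).trans (hC u hu).2⟩⟩

lemma fieldDiv_const_smul_ae (c : ℝ) {u : E → E} (hu : CompactLipschitz u) :
    ∀ᵐ x, fieldDiv (fun x => c • u x) x = c * fieldDiv u x := by
  filter_upwards [hu.ae_differentiableAt] with x hx
  simp only [fieldDiv_eq]
  rw [fderiv_fun_const_smul hx, map_smul, smul_eq_mul]

lemma fieldDiv_reflectField_ae (h : IsGraphFunction ν Φ) {u : E → E} (hu : CompactLipschitz u) :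
    fieldDiv (reflectField ν Φ u) =ᵐ[volume] (epigraphOf ν Φ).indicator (fun x =>
      fieldDiv u x + (3 * fieldDiv u (graphReflection ν Φ 1 x) +
        -4 * fieldDiv u (graphReflection ν Φ 2 x))) := by
  obtain ⟨C, hC⟩ := h.boundedOperation_sum
  obtain ⟨C1, hC1⟩ := h.boundedOperation_graphPiola one_ne_zero
  obtain ⟨C2, hC2⟩ := h.boundedOperation_graphPiola two_ne_zero
  have h1 := (hC1 u hu).1
  have h2 := (hC2 u hu).1
  obtain ⟨D1, hD1⟩ := BoundedOperation.const_smul (E := E) (F := E) 3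
  obtain ⟨D2, hD2⟩ := BoundedOperation.const_smul (E := E) (F := E) (-4)
  have h3 := (hD1 _ h1).1
  have h4 := (hD2 _ h2).1
  filter_upwards [fieldDiv_indicator_ae (hC u hu).1 h.isOpen_epigraphOf
    (h.sum_eq_zero_of_mem_frontier u), fieldDiv_add_ae hu (h3.add h4), fieldDiv_add_ae h3 h4,
    fieldDiv_const_smul_ae 3 h1, fieldDiv_const_smul_ae (-4) h2,
    h.fieldDiv_graphPiola_ae one_ne_zero hu, h.fieldDiv_graphPiola_ae two_ne_zero hu]
    with x e1 e2 e3 e4 e5 e6 e7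
  rw [reflectField, e1]
  by_cases hx : x ∈ epigraphOf ν Φ
  · rw [indicator_of_mem hx, indicator_of_mem hx, e2, Pi.add_apply, e3, Pi.add_apply, e4, e5, e6,
      e7]
  · rw [indicator_of_notMem hx, indicator_of_notMem hx]

end IsGraphFunction

end Reflection

end Pipe

namespace Pipe

/-! ### Parametrices for the divergence and their reflection. -/

section Parametrix

variable {E : Type*} [NormedAddCommGroup E] [InnerProductSpace ℝ E] [FiniteDimensional ℝ E]
  [MeasurableSpace E] [BorelSpace E]

/-- The equation `div V = Q` can be solved, up to an arbitrarily small error and up to a remainder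
`W` which is more regular than `Q`, with fields vanishing off `D`. -/
def DivParametrix (D : Set E) : Prop :=
  ∀ r : ℝ, ∃ C : ℝ≥0, ∀ Q : E → ℝ, MemLp Q 2 volume → (∀ x ∉ D, Q x = 0) →
    (∀ x, r < ‖x‖ → Q x = 0) → ∀ η : ℝ≥0, 0 < η →
    ∃ (V : E → E) (W : E → ℝ), CompactLipschitz V ∧ CompactLipschitz W ∧
      (∀ x ∉ D, V x = 0) ∧ (∀ x ∉ D, W x = 0) ∧
      eLpNorm (fun x => fieldDiv V x + W x - Q x) 2 volume ≤ η ∧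
      sobolevNorm V + sobolevNorm W ≤ C * eLpNorm Q 2 volume

/-- A parametrix on `D` can be reflected at a graph when reflection does not lead into `D`. -/
theorem DivParametrix.inter_epigraphOf {D : Set E} (hD : DivParametrix D) {ν : E} {Φ : E → ℝ}
    (h : IsGraphFunction ν Φ) (hinv : ∀ x ∉ D, ∀ t : ℝ, x + t • ν ∉ D) :
    DivParametrix (D ∩ epigraphOf ν Φ) := by
  intro r
  obtain ⟨C, hC⟩ := hD r
  obtain ⟨C1, hC1⟩ := h.boundedOperation_reflectField
  obtain ⟨C2, hC2⟩ := h.boundedOperation_reflectFun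
  obtain ⟨K1, hK1⟩ := h.exists_lipschitz_graphReflection 1
  obtain ⟨J1, hJ1⟩ := h.exists_antilipschitz_graphReflection one_ne_zero
  obtain ⟨K2, hK2⟩ := h.exists_lipschitz_graphReflection 2
  obtain ⟨J2, hJ2⟩ := h.exists_antilipschitz_graphReflection two_ne_zero
  obtain ⟨c1, hc1⟩ := exists_eLpNorm_comp_le hK1.continuous.measurable hJ1
  obtain ⟨c2, hc2⟩ := exists_eLpNorm_comp_le hK2.continuous.measurable hJ2
  obtain ⟨D1, hD1⟩ := exists_map_volume_le hK1.continuous.measurable hJ1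
  obtain ⟨D2, hD2⟩ := exists_map_volume_le hK2.continuous.measurable hJ2
  refine ⟨(C1 + C2) * C, fun Q hQ hQD hQr η hη => ?_⟩
  obtain ⟨V, W, hV, hW, hVD, hWD, herr, hnorm⟩ := hC Q hQ (fun x hx => hQD x fun h => hx h.1) hQr
    -- The error is reflected together with the solution and may grow by the factor `1 + 3 c1 + 4
    -- c2`.
    (η / (1 + (3 * c1 + 4 * c2))) (by positivity)
  -- Reflections move points along `ν` only, so the reflected fields still vanish off `D`.
  have hRD : ∀ l : ℝ, ∀ x ∉ D, graphReflection ν Φ l x ∉ D := by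
    intro l x hx
    have := hinv x hx (-((1 + l) * graphHeight ν Φ x))
    rwa [neg_smul, ← sub_eq_add_neg] at this
  refine ⟨reflectField ν Φ V, reflectFun ν Φ W, (hC1 V hV).1, (hC2 W hW).1, ?_, ?_, ?_, ?_⟩
  · intro x hx
    by_cases hxA : x ∈ epigraphOf ν Φ
    · have hxD : x ∉ D := fun hD => hx ⟨hD, hxA⟩
      simp [reflectField, hxA, graphPiola, hVD _ hxD, hVD _ (hRD 1 x hxD), hVD _ (hRD 2 x hxD)]
    · simp [reflectField, hxA]
  · intro x hx
    by_cases hxA : x ∈ epigraphOf ν Φ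
    · have hxD : x ∉ D := fun hD => hx ⟨hD, hxA⟩
      simp [reflectFun, hxA, hWD _ hxD, hWD _ (hRD 1 x hxD), hWD _ (hRD 2 x hxD)]
    · simp [reflectFun, hxA]
  · set e : E → ℝ := fun x => fieldDiv V x + W x - Q x with he
    have hem : AEStronglyMeasurable e volume :=
      ((measurable_fieldDiv V).aestronglyMeasurable.add (hW.aestronglyMeasurable _)).sub hQ.1
    have hem1 : AEStronglyMeasurable (fun x => e (graphReflection ν Φ 1 x)) volume :=
      (hem.mono_ac ((Measure.absolutelyContinuous_of_le hD1).trans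
        Measure.smul_absolutelyContinuous)).comp_aemeasurable hK1.continuous.aemeasurable
    have hem2 : AEStronglyMeasurable (fun x => e (graphReflection ν Φ 2 x)) volume :=
      (hem.mono_ac ((Measure.absolutelyContinuous_of_le hD2).trans
        Measure.smul_absolutelyContinuous)).comp_aemeasurable hK2.continuous.aemeasurable
    have hae : (fun x => fieldDiv (reflectField ν Φ V) x + reflectFun ν Φ W x - Q x) =ᵐ[volume]
        (epigraphOf ν Φ).indicator (e + ((fun x => (3 : ℝ) • e (graphReflection ν Φ 1 x)) +
          fun x => (-4 : ℝ) • e (graphReflection ν Φ 2 x))) := by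
      filter_upwards [h.fieldDiv_reflectField_ae hV] with x hx
      rw [hx, reflectFun]
      by_cases hxA : x ∈ epigraphOf ν Φ
      · have h1 := hQD (graphReflection ν Φ 1 x)
          fun h' => h.graphReflection_notMem hxA one_pos h'.2
        have h2 := hQD (graphReflection ν Φ 2 x)
          fun h' => h.graphReflection_notMem hxA two_pos h'.2
        simp only [indicator_of_mem hxA, Pi.add_apply, he, h1, h2, smul_eq_mul]
        ring
      · simp [hxA, hQD x fun h' => hxA h'.2]
    rw [eLpNorm_congr_ae hae]
    refine (eLpNorm_indicator_le _).trans ?_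
    refine (eLpNorm_add_le hem ((hem1.const_smul (3 : ℝ)).add (hem2.const_smul (-4 : ℝ)))
      (by norm_num)).trans ?_
    refine (add_le_add_right (eLpNorm_add_le (hem1.const_smul (3 : ℝ)) (hem2.const_smul (-4 : ℝ))
      (by norm_num)) _).trans ?_
    have n1 : eLpNorm (fun x => (3 : ℝ) • e (graphReflection ν Φ 1 x)) 2 volume ≤
        3 * (c1 * eLpNorm e 2 volume) := by
      have := eLpNorm_const_smul (3 : ℝ) (fun x => e (graphReflection ν Φ 1 x)) 2 volume
      refine (le_of_eq this).trans ?_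
      have h3 : ‖(3 : ℝ)‖ₑ = 3 := by simp [Real.enorm_eq_ofReal]
      rw [h3]
      exact mul_le_mul_right (hc1 e hem) _
    have n2 : eLpNorm (fun x => (-4 : ℝ) • e (graphReflection ν Φ 2 x)) 2 volume ≤
        4 * (c2 * eLpNorm e 2 volume) := by
      have := eLpNorm_const_smul (-4 : ℝ) (fun x => e (graphReflection ν Φ 2 x)) 2 volume
      refine (le_of_eq this).trans ?_
      have h3 : ‖(-4 : ℝ)‖ₑ = 4 := by rw [enorm_neg]; simp [Real.enorm_eq_ofReal]
      rw [h3]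
      exact mul_le_mul_right (hc2 e hem) _
    calc _ ≤ eLpNorm e 2 volume + (3 * (c1 * eLpNorm e 2 volume) + 4 * (c2 * eLpNorm e 2 volume)) :=
          add_le_add_right (add_le_add n1 n2) _
      _ = ((1 + (3 * c1 + 4 * c2) : ℝ≥0) : ℝ≥0∞) * eLpNorm e 2 volume := by push_cast; ring
      _ ≤ ((1 + (3 * c1 + 4 * c2) : ℝ≥0) : ℝ≥0∞) * (η / (1 + (3 * c1 + 4 * c2)) : ℝ≥0) :=
          mul_le_mul_right herr _
      _ = η := by
          rw [← ENNReal.coe_mul]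
          congr 1
          field_simp
  · calc _ ≤ C1 * sobolevNorm V + C2 * sobolevNorm W := add_le_add (hC1 V hV).2 (hC2 W hW).2
      _ ≤ C1 * (sobolevNorm V + sobolevNorm W) + C2 * (sobolevNorm V + sobolevNorm W) := by
          gcongr
          · exact le_self_add
          · exact le_add_self
      _ = (C1 + C2) * (sobolevNorm V + sobolevNorm W) := by ring
      _ ≤ (C1 + C2) * (C * eLpNorm Q 2 volume) := mul_le_mul_right hnorm _
      _ = _ := by push_cast; ring

end Parametrix

end Pipe

namespace Pipe

/-! ### The whole space: Bessel potentials and Plancherel. -/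

section WholeSpace

open SchwartzMap LineDeriv Real
open scoped FourierTransform

variable {E : Type*} [NormedAddCommGroup E] [InnerProductSpace ℝ E] [FiniteDimensional ℝ E]
  [MeasurableSpace E] [BorelSpace E]

lemma eLpNorm_fourier (f : 𝓢(E, ℂ)) : eLpNorm (𝓕 f : 𝓢(E, ℂ)) 2 volume = eLpNorm f 2 volume := by
  have h := SchwartzMap.norm_fourier_toL2_eq f
  rw [norm_toLp, norm_toLp] at h
  have h1 := ((𝓕 f : 𝓢(E, ℂ)).memLp 2 (volume : Measure E)).2.ne
  have h2 := (f.memLp 2 (volume : Measure E)).2.ne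
  exact (ENNReal.toReal_eq_toReal_iff' h1 h2).1 h

/-- Plancherel's theorem, applied on both sides of the multiplication by `m`. -/
lemma eLpNorm_fourierMultiplier_le {m : E → ℝ} (hm : m.HasTemperateGrowth) {M : ℝ}
    (hM : ∀ x, |m x| ≤ M) (f : 𝓢(E, ℂ)) :
    eLpNorm (fourierMultiplierCLM ℂ m f) 2 volume ≤ ENNReal.ofReal M * eLpNorm f 2 volume := by
  rw [fourierMultiplierCLM_apply, ← eLpNorm_fourier, FourierTransform.fourier_fourierInv_eq,
    ← eLpNorm_fourier f]
  refine eLpNorm_le_mul_eLpNorm_of_ae_le_mul (Eventually.of_forall fun x => ?_) _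
  rw [smulLeftCLM_apply_apply hm, norm_smul, Real.norm_eq_abs]
  gcongr
  exact hM x

/-- The Bessel potential of order two of a Schwartz function. -/
noncomputable def besselSmooth (g : 𝓢(E, ℂ)) : 𝓢(E, ℂ) :=
  fourierMultiplierCLM ℂ (fun x : E => (1 + ‖x‖ ^ 2) ^ (-1 : ℝ)) g

lemma hasTemperateGrowth_bessel : (fun x : E => (1 + ‖x‖ ^ 2) ^ (-1 : ℝ)).HasTemperateGrowth := by
  fun_prop

lemma lineDeriv_besselSmooth (a : E) (g : 𝓢(E, ℂ)) :
    ∂_{a} (besselSmooth g) = (2 * π * Complex.I) •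
      fourierMultiplierCLM ℂ (fun x : E => inner ℝ x a * (1 + ‖x‖ ^ 2) ^ (-1 : ℝ)) g := by
  rw [besselSmooth, lineDeriv_eq_fourierMultiplierCLM,
    fourierMultiplierCLM_fourierMultiplierCLM_apply (by fun_prop) (by fun_prop)]
  rfl

lemma lineDeriv_lineDeriv_besselSmooth (a b : E) (g : 𝓢(E, ℂ)) :
    ∂_{b} (∂_{a} (besselSmooth g)) = (2 * π * Complex.I) • (2 * π * Complex.I) •
      fourierMultiplierCLM ℂ
        (fun x : E => inner ℝ x b * (inner ℝ x a * (1 + ‖x‖ ^ 2) ^ (-1 : ℝ))) g := by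
  rw [lineDeriv_besselSmooth, lineDerivOp_smul, lineDeriv_eq_fourierMultiplierCLM,
    fourierMultiplierCLM_fourierMultiplierCLM_apply (by fun_prop) (by fun_prop)]
  rfl

/-- With this normalisation of the Fourier transform the Laplacian has the symbol `-(2π)²‖x‖²`. The
factor `((2π)²)⁻¹` turns `1 - cΔ` into multiplication by `1 + ‖x‖²`, which the Bessel multiplier
inverts. -/
lemma besselSmooth_sub_laplacian (g : 𝓢(E, ℂ)) {ι : Type*} [Fintype ι]
    (b : OrthonormalBasis ι ℝ E) :
    besselSmooth g - ((2 * π) ^ 2)⁻¹ • ∑ i, ∂_{b i} (∂_{b i} (besselSmooth g)) = g := by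
  rw [← laplacian_eq_sum b, laplacian_eq_fourierMultiplierCLM, besselSmooth,
    fourierMultiplierCLM_fourierMultiplierCLM_apply (by fun_prop) (by fun_prop)]
  have h1 : (2 * π) ^ 2 ≠ 0 := by positivity
  rw [smul_smul, mul_neg, inv_mul_cancel₀ h1, neg_smul, one_smul, sub_neg_eq_add,
    fourierMultiplierCLM_apply, fourierMultiplierCLM_apply, ← FourierTransform.fourierInv_add]
  have h2 : smulLeftCLM ℂ (fun x : E => (1 + ‖x‖ ^ 2) ^ (-1 : ℝ)) (𝓕 g) +
      smulLeftCLM ℂ ((fun x : E => ‖x‖ ^ 2) * fun x : E => (1 + ‖x‖ ^ 2) ^ (-1 : ℝ)) (𝓕 g) =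
      𝓕 g := by
    ext x
    have h3 : (0 : ℝ) < 1 + ‖x‖ ^ 2 := by positivity
    rw [add_apply, smulLeftCLM_apply_apply (by fun_prop),
      smulLeftCLM_apply_apply (by fun_prop), ← add_smul, Pi.mul_apply, ← one_add_mul,
      Real.rpow_neg_one, mul_inv_cancel₀ h3.ne', one_smul]
  erw [h2]
  rw [FourierTransform.fourierInv_fourier_eq]

lemma abs_inner_mul_bessel_le {a : E} (ha : ‖a‖ = 1) (x : E) :
    |inner ℝ x a * (1 + ‖x‖ ^ 2) ^ (-1 : ℝ)| ≤ 1 := by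
  have h3 : (0 : ℝ) < 1 + ‖x‖ ^ 2 := by positivity
  have h1 := abs_real_inner_le_norm x a
  rw [Real.rpow_neg_one, abs_mul, abs_of_pos (inv_pos.2 h3), ← div_eq_mul_inv, div_le_one h3]
  rw [ha] at h1
  nlinarith [sq_nonneg (‖x‖ - 1)]

lemma abs_inner_mul_inner_mul_bessel_le {a b : E} (ha : ‖a‖ = 1) (hb : ‖b‖ = 1) (x : E) :
    |inner ℝ x b * (inner ℝ x a * (1 + ‖x‖ ^ 2) ^ (-1 : ℝ))| ≤ 1 := by
  have h3 : (0 : ℝ) < 1 + ‖x‖ ^ 2 := by positivity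
  have h1 := abs_real_inner_le_norm x a
  have h2 := abs_real_inner_le_norm x b
  rw [Real.rpow_neg_one, ← mul_assoc, abs_mul, abs_of_pos (inv_pos.2 h3), ← div_eq_mul_inv,
    div_le_one h3, abs_mul]
  rw [ha, mul_one] at h1
  rw [hb, mul_one] at h2
  nlinarith [mul_le_mul h2 h1 (abs_nonneg _) (norm_nonneg _)]

lemma eLpNorm_besselSmooth_le (g : 𝓢(E, ℂ)) :
    eLpNorm (besselSmooth g) 2 volume ≤ eLpNorm g 2 volume := by
  have := eLpNorm_fourierMultiplier_le (hasTemperateGrowth_bessel (E := E)) (M := 1) (fun x => by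
    have h3 : (0 : ℝ) < 1 + ‖x‖ ^ 2 := by positivity
    rw [Real.rpow_neg_one, abs_of_pos (inv_pos.2 h3)]
    exact inv_le_one_of_one_le₀ (by nlinarith [sq_nonneg ‖x‖])) g
  rw [ENNReal.ofReal_one, one_mul] at this
  exact this

lemma eLpNorm_lineDeriv_besselSmooth_le {a : E} (ha : ‖a‖ = 1) (g : 𝓢(E, ℂ)) :
    eLpNorm (∂_{a} (besselSmooth g) : 𝓢(E, ℂ)) 2 volume ≤
      ENNReal.ofReal (2 * π) * eLpNorm g 2 volume := by
  have := eLpNorm_fourierMultiplier_le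
    (m := fun x : E => inner ℝ x a * (1 + ‖x‖ ^ 2) ^ (-1 : ℝ)) (by fun_prop) (M := 1)
    (abs_inner_mul_bessel_le ha) g
  rw [lineDeriv_besselSmooth]
  refine (eLpNorm_const_smul_le (c := (2 * π * Complex.I))).trans ?_
  have hn : ‖(2 * π * Complex.I)‖ₑ = ENNReal.ofReal (2 * π) := by
    rw [← ofReal_norm]; simp [abs_of_pos Real.pi_pos]
  rw [hn]
  gcongr
  simpa using this

lemma eLpNorm_lineDeriv_lineDeriv_besselSmooth_le {a b : E} (ha : ‖a‖ = 1) (hb : ‖b‖ = 1)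
    (g : 𝓢(E, ℂ)) : eLpNorm (∂_{b} (∂_{a} (besselSmooth g)) : 𝓢(E, ℂ)) 2 volume ≤
      ENNReal.ofReal (2 * π) * (ENNReal.ofReal (2 * π) * eLpNorm g 2 volume) := by
  have := eLpNorm_fourierMultiplier_le
    (m := fun x : E => inner ℝ x b * (inner ℝ x a * (1 + ‖x‖ ^ 2) ^ (-1 : ℝ))) (by fun_prop) (M := 1)
    (abs_inner_mul_inner_mul_bessel_le ha hb) g
  rw [lineDeriv_lineDeriv_besselSmooth]
  have hn : ‖(2 * π * Complex.I)‖ₑ = ENNReal.ofReal (2 * π) := by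
    rw [← ofReal_norm]; simp [abs_of_pos Real.pi_pos]
  refine (eLpNorm_const_smul_le (c := (2 * π * Complex.I))).trans ?_
  rw [hn]
  gcongr
  refine (eLpNorm_const_smul_le (c := (2 * π * Complex.I))).trans ?_
  rw [hn]
  gcongr
  simpa using this

lemma norm_le_sum_apply {ι : Type*} [Fintype ι] (b : OrthonormalBasis ι ℝ E) (l : E →L[ℝ] ℝ) :
    ‖l‖ ≤ ∑ i, |l (b i)| := by
  refine ContinuousLinearMap.opNorm_le_bound _ (by positivity) fun v => ?_
  conv_lhs => rw [← b.sum_repr' v]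
  rw [map_sum, Finset.sum_mul]
  refine (norm_sum_le _ _).trans (Finset.sum_le_sum fun i _ => ?_)
  rw [map_smul, norm_smul, Real.norm_eq_abs, Real.norm_eq_abs, mul_comm]
  gcongr
  simpa [b.norm_eq_one] using abs_real_inner_le_norm (b i) v

lemma hasFDerivAt_re (H : 𝓢(E, ℂ)) (x : E) :
    HasFDerivAt (fun x => (H x).re) (Complex.reCLM.comp (fderiv ℝ H x)) x :=
  Complex.reCLM.hasFDerivAt.comp x (H.differentiableAt (x := x)).hasFDerivAt

/-- Localisation of the real part of a Schwartz function. -/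
lemma exists_sobolevNorm_mul_re_le {ζ : E → ℝ} (hζ : ContDiff ℝ ∞ ζ) (hc : HasCompactSupport ζ)
    {ι : Type*} [Fintype ι] (b : OrthonormalBasis ι ℝ E) : ∃ C : ℝ≥0, ∀ H : 𝓢(E, ℂ),
      CompactLipschitz (fun x => ζ x * (H x).re) ∧ sobolevNorm (fun x => ζ x * (H x).re) ≤
        C * (eLpNorm H 2 volume + ∑ i, eLpNorm (∂_{b i} H : 𝓢(E, ℂ)) 2 volume) := by
  have hL : CompactLipschitz ζ := .of_contDiff (hζ.of_le (by simp)) hc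
  obtain ⟨K, hK⟩ := hL.exists_lipschitz
  obtain ⟨M, hM0, hM⟩ := hL.exists_norm_le
  lift M to ℝ≥0 using hM0
  refine ⟨M + K + M, fun H => ⟨?_, ?_⟩⟩
  · refine .of_contDiff ((hζ.of_le (by simp)).mul ?_) hc.mul_right
    exact Complex.reCLM.contDiff.comp (H.smooth 1)
  have h1 : eLpNorm (fun x => ζ x * (H x).re) 2 volume ≤ M * eLpNorm H 2 volume := by
    refine eLpNorm_le_nnreal_smul_eLpNorm_of_ae_le_mul (Eventually.of_forall fun x => ?_) _
    rw [← NNReal.coe_le_coe]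
    simp only [NNReal.coe_mul, coe_nnnorm, norm_mul]
    exact mul_le_mul (hM x) (Complex.abs_re_le_norm _) (norm_nonneg _) M.2
  have h2 : eLpNorm (fun x => ‖fderiv ℝ (fun x => ζ x * (H x).re) x‖) 2 volume ≤
      K * eLpNorm H 2 volume + M * ∑ i, eLpNorm (∂_{b i} H : 𝓢(E, ℂ)) 2 volume := by
    have e : ∀ x, ‖‖fderiv ℝ (fun x => ζ x * (H x).re) x‖‖ ≤
        ‖((fun x => (K : ℝ) • ‖H x‖) + fun x => (M : ℝ) •
          (∑ i, fun x => ‖(∂_{b i} H : 𝓢(E, ℂ)) x‖) x) x‖ := by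
      intro x
      have hd := ((hζ.differentiable (by simp)) x).hasFDerivAt.mul (hasFDerivAt_re H x)
      have hd' : fderiv ℝ (fun x => ζ x * (H x).re) x = _ := hd.fderiv
      rw [hd', norm_norm]
      simp only [Pi.add_apply, Finset.sum_apply, smul_eq_mul]
      rw [Real.norm_of_nonneg (by positivity)]
      refine (norm_add_le _ _).trans ?_
      rw [norm_smul, norm_smul, add_comm]
      refine add_le_add ?_ ?_
      · rw [mul_comm]
        exact mul_le_mul (norm_fderiv_le_of_lipschitz ℝ hK) (Complex.abs_re_le_norm _)
          (norm_nonneg _) K.2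
      · refine mul_le_mul (hM x) ?_ (norm_nonneg _) M.2
        refine (norm_le_sum_apply b _).trans (Finset.sum_le_sum fun i _ => ?_)
        exact Complex.abs_re_le_norm _
    have m1 : AEStronglyMeasurable (fun x => ‖H x‖) volume := H.continuous.norm.aestronglyMeasurable
    have m2 : ∀ i, AEStronglyMeasurable (fun x => ‖(∂_{b i} H : 𝓢(E, ℂ)) x‖) volume :=
      fun i => (∂_{b i} H : 𝓢(E, ℂ)).continuous.norm.aestronglyMeasurable
    have m3 : AEStronglyMeasurable (∑ i, fun x => ‖(∂_{b i} H : 𝓢(E, ℂ)) x‖) volume :=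
      Finset.aestronglyMeasurable_sum _ fun i _ => m2 i
    refine (eLpNorm_mono_ae (Eventually.of_forall e)).trans ?_
    refine (eLpNorm_add_le (m1.const_smul (K : ℝ)) (m3.const_smul (M : ℝ)) (by norm_num)).trans ?_
    refine add_le_add ?_ ?_
    · refine (eLpNorm_const_smul_le (c := (K : ℝ))).trans ?_
      rw [eLpNorm_norm]
      simp [Real.enorm_eq_ofReal]
    · refine (eLpNorm_const_smul_le (c := (M : ℝ))).trans ?_
      have : ‖(M : ℝ)‖ₑ = M := by simp [Real.enorm_eq_ofReal]
      rw [this]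
      refine mul_le_mul_right ?_ _
      refine (eLpNorm_sum_le (fun i _ => m2 i) (by norm_num)).trans (le_of_eq ?_)
      simp only [eLpNorm_norm]
  unfold sobolevNorm
  generalize eLpNorm H 2 volume = a at *
  generalize ∑ i, eLpNorm (∂_{b i} H : 𝓢(E, ℂ)) 2 volume = c at *
  calc _ ≤ M * a + (K * a + M * c) := add_le_add h1 h2
    _ ≤ (M * a + (K * a + M * c)) + (K * c + M * a + M * c) := le_self_add
    _ = _ := by push_cast; ring

lemma sobolevNorm_zero {F : Type*} [NormedAddCommGroup F] [NormedSpace ℝ F] :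
    sobolevNorm (0 : E → F) = 0 := by
  simp [sobolevNorm]

lemma compactLipschitz_zero {F : Type*} [NormedAddCommGroup F] :
    CompactLipschitz (0 : E → F) :=
  ⟨⟨0, LipschitzWith.const 0⟩, HasCompactSupport.zero⟩

lemma compactLipschitz_sum {F : Type*} [NormedAddCommGroup F] [NormedSpace ℝ F]
    [FiniteDimensional ℝ F] {ι : Type*} (s : Finset ι) {f : ι → E → F}
    (hf : ∀ i ∈ s, CompactLipschitz (f i)) :
    CompactLipschitz (∑ i ∈ s, f i) ∧ sobolevNorm (∑ i ∈ s, f i) ≤ ∑ i ∈ s, sobolevNorm (f i) := by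
  classical
  induction s using Finset.induction_on with
  | empty => simpa [sobolevNorm_zero] using compactLipschitz_zero
  | insert a s ha ih =>
    obtain ⟨h1, h2⟩ := ih fun i hi => hf i (Finset.mem_insert_of_mem hi)
    have h3 := hf a (Finset.mem_insert_self a s)
    rw [Finset.sum_insert ha, Finset.sum_insert ha]
    exact ⟨h3.add h1, (sobolevNorm_add_le h3 h1).trans (add_le_add_right h2 _)⟩

lemma BoundedOperation.postcomp {F G : Type*} [NormedAddCommGroup F] [NormedSpace ℝ F]
    [FiniteDimensional ℝ F] [NormedAddCommGroup G] [NormedSpace ℝ G] [FiniteDimensional ℝ G]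
    (T : F →L[ℝ] G) : BoundedOperation (fun (u : E → F) x => T (u x)) :=
  BoundedOperation.bilin (ContinuousLinearMap.id ℝ (F →L[ℝ] G)) (LipschitzWith.const T)
    (M := ‖T‖₊) (fun _ => le_rfl)

/-- The whole space has a parametrix, given by the Bessel potential. -/
theorem divParametrix_univ : DivParametrix (univ : Set E) := by
  intro r
  -- With a smooth approximation `g` of `Q`, its potential `P` and a cutoff `ζ` equal to `1` on the
  -- support of `Q`, the solution is `V = -c ζ ∇P` and `W = ζ P + c ∇ζ · ∇P`, real parts being
  -- understood. The terms with `∇ζ` cancel in `div V + W`, leaving `ζ (P - cΔP) = ζ g`.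
  let ζ : ContDiffBump (0 : E) := ⟨max r 0 + 1, max r 0 + 2, by positivity, by linarith⟩
  let b := stdOrthonormalBasis ℝ E
  set c : ℝ := ((2 * π) ^ 2)⁻¹ with hc
  let z : E → ℝ := ζ
  have hz : ContDiff ℝ ∞ z := ζ.contDiff
  have hzc : HasCompactSupport z := ζ.hasCompactSupport
  let zd : Fin (Module.finrank ℝ E) → E → ℝ := fun i x => fderiv ℝ z x (b i)
  have hzd : ∀ i, ContDiff ℝ ∞ (zd i) := fun i =>
    (hz.fderiv_right (m := ∞) (by simp)).clm_apply contDiff_const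
  have hzdc : ∀ i, HasCompactSupport (zd i) := fun i => hzc.fderiv_apply (𝕜 := ℝ) (b i)
  obtain ⟨C0, hC0⟩ := exists_sobolevNorm_mul_re_le hz hzc b
  choose C1 hC1 using fun i => exists_sobolevNorm_mul_re_le (hzd i) (hzdc i) b
  let T : Fin (Module.finrank ℝ E) → ℝ →L[ℝ] E := fun i =>
    (ContinuousLinearMap.id ℝ ℝ).smulRight (-c • b i)
  choose K hK using fun i => BoundedOperation.postcomp (E := E) (T i)
  obtain ⟨Kc, hKc⟩ := BoundedOperation.const_smul (E := E) (F := ℝ) c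
  let B : ℝ≥0 := (2 * π).toNNReal
  let d : ℝ≥0 := Module.finrank ℝ E
  let Cmain : ℝ≥0 := (∑ i, K i * (C0 * (B + d * (B * B)))) + (C0 * (1 + d * B) +
    ∑ i, Kc * (C1 i * (B + d * (B * B))))
  refine ⟨Cmain * 2, fun Q hQ _ hQr η hη => ?_⟩
  -- The approximation of `Q` must be closer than both `η` and `‖Q‖`, so `‖Q‖ = 0` is treated apart.
  -- Closeness `‖Q‖` gives `‖g‖ ≤ 2‖Q‖`, whence the factor `2` in the constant, which is independent
  -- of `η`.
  by_cases hQ0 : eLpNorm Q 2 volume = 0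
  · refine ⟨0, 0, compactLipschitz_zero, compactLipschitz_zero, by simp, by simp, ?_, by
      simp [sobolevNorm_zero]⟩
    have hdiv : ∀ x, fieldDiv (0 : E → E) x = 0 := fun x => by simp [fieldDiv_eq]
    have : (fun x => fieldDiv (0 : E → E) x + (0 : E → ℝ) x - Q x) = fun x => -Q x := by
      funext x; simp [hdiv]
    rw [this]
    have := eLpNorm_neg Q 2 (volume : Measure E)
    exact (le_of_eq this).trans (by simp [hQ0])
  have hQpos : 0 < (eLpNorm Q 2 volume).toReal := ENNReal.toReal_pos hQ0 hQ.2.ne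
  obtain ⟨g, hgc, hg, hgQ⟩ := hQ.exist_eLpNorm_sub_le (by norm_num) (by norm_num)
    (ε := min η (eLpNorm Q 2 volume).toReal) (by positivity)
  let gC : 𝓢(E, ℂ) := HasCompactSupport.toSchwartzMap (f := fun x => (g x : ℂ))
    (hgc.comp_left Complex.ofReal_zero) (Complex.ofRealCLM.contDiff.comp hg)
  have hgC : ∀ x, gC x = (g x : ℂ) := fun _ => rfl
  have hgm : AEStronglyMeasurable g volume := hg.continuous.aestronglyMeasurable
  have hgQ1 : eLpNorm (Q - g) 2 volume ≤ η :=
    hgQ.trans ((ENNReal.ofReal_le_ofReal (min_le_left _ _)).trans (by simp))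
  have hgQ2 : eLpNorm (Q - g) 2 volume ≤ eLpNorm Q 2 volume :=
    hgQ.trans ((ENNReal.ofReal_le_ofReal (min_le_right _ _)).trans
      (by rw [ENNReal.ofReal_toReal hQ.2.ne]))
  have hN : eLpNorm gC 2 volume ≤ 2 * eLpNorm Q 2 volume := by
    have h1 : eLpNorm gC 2 volume = eLpNorm g 2 volume :=
      eLpNorm_congr_norm_ae (Eventually.of_forall fun x => by simp [hgC])
    rw [h1, two_mul]
    have h2 : g = Q + -(Q - g) := by abel
    rw [h2]
    refine (eLpNorm_add_le hQ.1 (hQ.1.sub hgm).neg (by norm_num)).trans ?_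
    rw [eLpNorm_neg]
    exact add_le_add_right hgQ2 _
  set N := eLpNorm gC 2 volume with hNdef
  let P := besselSmooth gC
  have hP0 : eLpNorm P 2 volume ≤ N := eLpNorm_besselSmooth_le gC
  have hP1 : ∀ i, eLpNorm (∂_{b i} P : 𝓢(E, ℂ)) 2 volume ≤ B * N := fun i =>
    eLpNorm_lineDeriv_besselSmooth_le (b.norm_eq_one i) gC
  have hP2 : ∀ i j, eLpNorm (∂_{b j} (∂_{b i} P) : 𝓢(E, ℂ)) 2 volume ≤ B * (B * N) := fun i j =>
    eLpNorm_lineDeriv_lineDeriv_besselSmooth_le (b.norm_eq_one i) (b.norm_eq_one j) gC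
  have hS1 : ∑ i, eLpNorm (∂_{b i} P : 𝓢(E, ℂ)) 2 volume ≤ d * (B * N) := by
    refine (Finset.sum_le_sum fun i _ => hP1 i).trans ?_
    simp [d]
  have hS2 : ∀ i, ∑ j, eLpNorm (∂_{b j} (∂_{b i} P) : 𝓢(E, ℂ)) 2 volume ≤ d * (B * (B * N)) := by
    intro i
    refine (Finset.sum_le_sum fun j _ => hP2 i j).trans ?_
    simp [d]
  let vi : Fin (Module.finrank ℝ E) → E → ℝ := fun i x => z x * ((∂_{b i} P : 𝓢(E, ℂ)) x).re
  let wi : Fin (Module.finrank ℝ E) → E → ℝ := fun i x =>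
    c • (zd i x * ((∂_{b i} P : 𝓢(E, ℂ)) x).re)
  let w0 : E → ℝ := fun x => z x * (P x).re
  have hvi : ∀ i, CompactLipschitz (fun x => T i (vi i x)) ∧ sobolevNorm (fun x => T i (vi i x)) ≤
      K i * (C0 * (B + d * (B * B))) * N := by
    intro i
    obtain ⟨h1, h2⟩ := hC0 (∂_{b i} P)
    obtain ⟨h3, h4⟩ := hK i _ h1
    refine ⟨h3, h4.trans ?_⟩
    rw [mul_assoc, mul_assoc]
    refine mul_le_mul_right (h2.trans (mul_le_mul_right ?_ _)) _
    refine (add_le_add (hP1 i) (hS2 i)).trans (le_of_eq ?_)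
    ring
  have hwi : ∀ i, CompactLipschitz (wi i) ∧ sobolevNorm (wi i) ≤
      Kc * (C1 i * (B + d * (B * B))) * N := by
    intro i
    obtain ⟨h1, h2⟩ := hC1 i (∂_{b i} P)
    obtain ⟨h3, h4⟩ := hKc _ h1
    refine ⟨h3, h4.trans ?_⟩
    rw [mul_assoc, mul_assoc]
    refine mul_le_mul_right (h2.trans (mul_le_mul_right ?_ _)) _
    refine (add_le_add (hP1 i) (hS2 i)).trans (le_of_eq ?_)
    ring
  have hw0 : CompactLipschitz w0 ∧ sobolevNorm w0 ≤ C0 * (1 + d * B) * N := by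
    obtain ⟨h1, h2⟩ := hC0 P
    refine ⟨h1, h2.trans ?_⟩
    rw [mul_assoc]
    refine mul_le_mul_right ((add_le_add hP0 hS1).trans (le_of_eq ?_)) _
    ring
  obtain ⟨hV, hVn⟩ := compactLipschitz_sum Finset.univ fun i _ => (hvi i).1
  obtain ⟨hW, hWn⟩ := compactLipschitz_sum Finset.univ fun i _ => (hwi i).1
  refine ⟨∑ i, fun x => T i (vi i x), w0 + ∑ i, wi i, hV, hw0.1.add hW, by simp, by simp, ?_, ?_⟩
  · have hval : ∀ x, fieldDiv (∑ i, fun x => T i (vi i x)) x + (w0 + ∑ i, wi i) x =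
        z x * g x := by
      intro x
      have hd : ∀ i, HasFDerivAt (fun x => T i (vi i x)) ((T i).comp
          (z x • Complex.reCLM.comp (fderiv ℝ (∂_{b i} P : 𝓢(E, ℂ)) x) +
            ((∂_{b i} P : 𝓢(E, ℂ)) x).re • fderiv ℝ z x)) x := fun i =>
        (T i).hasFDerivAt.comp x
          (((hz.differentiable (by simp)) x).hasFDerivAt.mul (hasFDerivAt_re _ x))
      have hsum := (HasFDerivAt.sum (u := Finset.univ) fun i _ => hd i).fderiv
      have htr : ∀ (i) (l : E →L[ℝ] ℝ), traceCLM E ((T i).comp l) = -c * l (b i) := by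
        intro i l
        have : (T i).comp l = l.smulRight (-c • b i) := by
          ext v; simp [T]
        rw [this, traceCLM_smulRight, map_smul, smul_eq_mul]
      have key := congrArg (fun f : 𝓢(E, ℂ) => (f x).re) (besselSmooth_sub_laplacian gC b)
      have hkey : (P x).re - c * ∑ i, ((∂_{b i} (∂_{b i} P) : 𝓢(E, ℂ)) x).re = g x := by
        rw [sub_apply, smul_apply, Complex.sub_re, Complex.smul_re, smul_eq_mul, sum_apply,
          Complex.re_sum] at key
        exact key
      rw [fieldDiv_eq]
      beta_reduce
      rw [hsum, map_sum]
      simp only [htr, Pi.add_apply, Finset.sum_apply, wi, w0, zd]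
      rw [← hkey, mul_sub, Finset.mul_sum, Finset.mul_sum]
      have e : ∀ i, ((∂_{b i} (∂_{b i} P) : 𝓢(E, ℂ)) x).re =
        (fderiv ℝ (∂_{b i} P : 𝓢(E, ℂ)) x (b i)).re := fun i => by
          rw [lineDerivOp_apply_eq_fderiv]
      simp only [e]
      rw [add_left_comm, ← Finset.sum_add_distrib, sub_eq_add_neg, ← Finset.sum_neg_distrib]
      congr 1
      refine Finset.sum_congr rfl fun i _ => ?_
      simp
      ring
    refine le_trans (eLpNorm_mono_ae (g := Q - g) (Eventually.of_forall fun x => ?_)) hgQ1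
    rw [hval]
    have hzQ : z x * Q x = Q x := by
      by_cases hx : r < ‖x‖
      · simp [hQr x hx]
      · have : z x = 1 := ζ.one_of_mem_closedBall (by
          have : ‖x‖ ≤ max r 0 + 1 := by linarith [le_max_left r 0, not_lt.1 hx]
          simpa [ζ] using this)
        rw [this, one_mul]
    have : z x * g x - Q x = -(z x * (Q x - g x)) := by rw [mul_sub, hzQ]; ring
    rw [this, norm_neg, norm_mul, Pi.sub_apply]
    have h1 : ‖z x‖ ≤ 1 := by
      rw [Real.norm_of_nonneg ζ.nonneg]
      exact ζ.le_one
    exact mul_le_of_le_one_left (norm_nonneg _) h1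
  · have e1 : sobolevNorm (∑ i, fun x => T i (vi i x)) ≤
        ((∑ i, K i * (C0 * (B + d * (B * B))) : ℝ≥0) : ℝ≥0∞) * N := by
      refine (hVn.trans (Finset.sum_le_sum fun i _ => (hvi i).2)).trans (le_of_eq ?_)
      rw [← Finset.sum_mul]; push_cast; rfl
    have e2 : sobolevNorm (∑ i, wi i) ≤
        ((∑ i, Kc * (C1 i * (B + d * (B * B))) : ℝ≥0) : ℝ≥0∞) * N := by
      refine (hWn.trans (Finset.sum_le_sum fun i _ => (hwi i).2)).trans (le_of_eq ?_)
      rw [← Finset.sum_mul]; push_cast; rfl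
    refine (add_le_add e1 ((sobolevNorm_add_le hw0.1 hW).trans (add_le_add hw0.2 e2))).trans ?_
    have e3 : ((Cmain * 2 : ℝ≥0) : ℝ≥0∞) * eLpNorm Q 2 volume =
      Cmain * (2 * eLpNorm Q 2 volume) := by push_cast; ring
    rw [e3]
    refine le_trans (le_of_eq ?_) (mul_le_mul_right hN _)
    simp only [Cmain]
    push_cast
    ring

end WholeSpace

end Pipe

namespace Pipe

/-! ### Density of test fields among Lipschitz fields vanishing off an open set. -/

section Density

variable {E : Type*} [NormedAddCommGroup E] [InnerProductSpace ℝ E] [FiniteDimensional ℝ E]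
  [MeasurableSpace E] [BorelSpace E]
variable {F : Type*} [NormedAddCommGroup F] [NormedSpace ℝ F] [FiniteDimensional ℝ F]

/-- Dominated convergence in `L²` for uniformly bounded functions on a set of finite measure. -/
lemma tendsto_eLpNorm_zero_of_bounded {μ : Measure E} {f : ℕ → E → ℝ} {K : Set E}
    (hK : MeasurableSet K) (hμK : μ K ≠ ⊤) {M : ℝ} (hf : ∀ k, AEStronglyMeasurable (f k) μ)
    (hM : ∀ k, ∀ᵐ x ∂μ, |f k x| ≤ M) (h0 : ∀ k, ∀ x ∉ K, f k x = 0)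
    (hlim : ∀ᵐ x ∂μ, Tendsto (fun k => f k x) atTop (𝓝 0)) :
    Tendsto (fun k => eLpNorm (f k) 2 μ) atTop (𝓝 0) := by
  have h1 : ∀ k, eLpNorm (f k) 2 μ = (∫⁻ x, ‖f k x‖ₑ ^ (2 : ℝ) ∂μ) ^ (1 / 2 : ℝ) := by
    intro k
    rw [eLpNorm_eq_lintegral_rpow_enorm_toReal (by norm_num) (by norm_num)]
    simp
  have h2 : Tendsto (fun k => ∫⁻ x, ‖f k x‖ₑ ^ (2 : ℝ) ∂μ) atTop (𝓝 (∫⁻ _, 0 ∂μ)) := by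
    refine tendsto_lintegral_of_dominated_convergence'
      (K.indicator fun _ => ENNReal.ofReal M ^ (2 : ℝ)) (fun k => (hf k).enorm.pow_const _)
      (fun k => ?_) ?_ ?_
    · filter_upwards [hM k] with x hx
      by_cases hxK : x ∈ K
      · rw [indicator_of_mem hxK, Real.enorm_eq_ofReal_abs]
        exact ENNReal.rpow_le_rpow (ENNReal.ofReal_le_ofReal hx) (by norm_num)
      · rw [indicator_of_notMem hxK, h0 k x hxK]; simp
    · rw [lintegral_indicator_const hK]
      exact ENNReal.mul_ne_top (by simp) hμK
    · filter_upwards [hlim] with x hx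
      have := (hx.enorm.ennrpow_const (2 : ℝ))
      simpa using this
  simp only [h1]
  have := h2.ennrpow_const (1 / 2 : ℝ)
  simpa using this

lemma norm_le_mul_infDist {K : ℝ≥0} {u : E → F} (hu : LipschitzWith K u) {S : Set E}
    (hS : IsClosed S) (hne : S.Nonempty) (h0 : ∀ x ∈ S, u x = 0) (x : E) :
    ‖u x‖ ≤ K * Metric.infDist x S := by
  obtain ⟨y, hy, hxy⟩ := hS.exists_infDist_eq_dist hne x
  have := hu.dist_le_mul x y
  rwa [h0 y hy, dist_zero_right, ← hxy] at this

/-- A cutoff function which vanishes near `S` and equals one at distance `2 / k` from `S`. -/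
noncomputable def distCutoff (S : Set E) (k : ℝ) (x : E) : ℝ :=
  max 0 (min 1 (k * Metric.infDist x S - 1))

lemma distCutoff_nonneg (S : Set E) (k : ℝ) (x : E) : 0 ≤ distCutoff S k x := le_max_left _ _

lemma distCutoff_le_one (S : Set E) (k : ℝ) (x : E) : distCutoff S k x ≤ 1 :=
  max_le zero_le_one (min_le_left _ _)

lemma distCutoff_eq_one {S : Set E} {k : ℝ} {x : E} (h : 2 ≤ k * Metric.infDist x S) :
    distCutoff S k x = 1 := by
  rw [distCutoff, min_eq_left (by linarith), max_eq_right zero_le_one]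

lemma distCutoff_eq_zero {S : Set E} {k : ℝ} {x : E} (h : k * Metric.infDist x S ≤ 1) :
    distCutoff S k x = 0 := by
  rw [distCutoff, max_eq_left]
  exact (min_le_right _ _).trans (by linarith)

lemma lipschitzWith_distCutoff (S : Set E) (k : ℝ≥0) : LipschitzWith k (distCutoff S k) := by
  have h1 : LipschitzWith k (fun x => k * Metric.infDist x S - 1) := by
    refine LipschitzWith.of_dist_le_mul fun x y => ?_
    have := (Metric.lipschitz_infDist_pt S).dist_le_mul x y
    rw [Real.dist_eq] at this ⊢
    have e : (k : ℝ) * Metric.infDist x S - 1 - (k * Metric.infDist y S - 1) =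
      k * (Metric.infDist x S - Metric.infDist y S) := by ring
    rw [e, abs_mul, NNReal.abs_eq]
    gcongr
    simpa using this
  exact (h1.const_min 1).const_max 0

/-- The cutoff has slope `k`, but it varies only where the distance to `S` is at most `2 / k`, and
there `‖u‖ ≤ 2 K / k`. Hence the bound does not depend on `k`. -/
lemma lipschitzWith_distCutoff_smul {K : ℝ≥0} {u : E → F} (hu : LipschitzWith K u) {S : Set E}
    (hS : IsClosed S) (hne : S.Nonempty) (h0 : ∀ x ∈ S, u x = 0) (k : ℝ≥0) :
    LipschitzWith (3 * K) (fun x => distCutoff S k x • u x) := by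
  have key : ∀ x y, Metric.infDist y S ≤ Metric.infDist x S →
      dist (distCutoff S k x • u x) (distCutoff S k y • u y) ≤ (3 * K : ℝ≥0) * dist x y := by
    intro x y hyx
    have h1 : ‖distCutoff S k x • (u x - u y)‖ ≤ K * dist x y := by
      rw [norm_smul, Real.norm_of_nonneg (distCutoff_nonneg _ _ _), ← dist_eq_norm]
      exact (mul_le_of_le_one_left dist_nonneg (distCutoff_le_one _ _ _)).trans
        (hu.dist_le_mul x y)
    -- Since `y` is the point nearer to `S`, a cutoff equal to `1` at `y` is also `1` at `x`, and
    -- the difference vanishes.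
    have h2 : ‖(distCutoff S k x - distCutoff S k y) • u y‖ ≤ 2 * K * dist x y := by
      by_cases h : 2 ≤ k * Metric.infDist y S
      · rw [distCutoff_eq_one h, distCutoff_eq_one (h.trans (by gcongr))]
        simp; positivity
      · rw [norm_smul, ← dist_eq_norm]
        have h3 := (lipschitzWith_distCutoff S k).dist_le_mul x y
        have h4 := norm_le_mul_infDist hu hS hne h0 y
        calc _ ≤ (k * dist x y) * (K * Metric.infDist y S) :=
              mul_le_mul h3 h4 (norm_nonneg _) (by positivity)
          _ = (k * Metric.infDist y S) * (K * dist x y) := by ring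
          _ ≤ 2 * (K * dist x y) := by gcongr; exact (not_le.1 h).le
          _ = _ := by ring
    have e : distCutoff S k x • u x - distCutoff S k y • u y =
        distCutoff S k x • (u x - u y) + (distCutoff S k x - distCutoff S k y) • u y := by module
    rw [dist_eq_norm, e]
    refine (norm_add_le _ _).trans ((add_le_add h1 h2).trans (le_of_eq ?_))
    push_cast; ring
  refine LipschitzWith.of_dist_le_mul fun x y => ?_
  rcases le_total (Metric.infDist y S) (Metric.infDist x S) with h | h
  · exact key x y h
  · rw [dist_comm, dist_comm x]; exact key y x h

/-- A Lipschitz map vanishing off an open set is approximated by such maps with support in it. -/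
lemma exists_approx_tsupport_subset {u : E → F} (hu : CompactLipschitz u) {U : Set E}
    (hU : IsOpen U) (h0 : ∀ x ∉ U, u x = 0) {ε : ℝ≥0∞} (hε : 0 < ε) :
    ∃ v : E → F, CompactLipschitz v ∧ tsupport v ⊆ U ∧
      eLpNorm (fun x => ‖v x - u x‖) 2 (volume.restrict U) ≤ ε ∧
      eLpNorm (fun x => ‖fderiv ℝ v x - fderiv ℝ u x‖) 2 (volume.restrict U) ≤ ε := by
  rcases eq_empty_or_nonempty Uᶜ with hne | hne
  · refine ⟨u, hu, ?_, by simp, by simp⟩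
    rw [compl_empty_iff.1 hne]; exact subset_univ _
  obtain ⟨K, hK⟩ := hu.exists_lipschitz
  obtain ⟨M, hM0, hM⟩ := hu.exists_norm_le
  have hS : IsClosed Uᶜ := hU.isClosed_compl
  let v : ℕ → E → F := fun k x => distCutoff Uᶜ (k : ℝ≥0) x • u x
  have hvL : ∀ k, LipschitzWith (3 * K) (v k) := fun k =>
    lipschitzWith_distCutoff_smul hK hS hne (fun x hx => h0 x hx) k
  have hsupp : ∀ k x, v k x ≠ 0 → u x ≠ 0 := by
    intro k x hx h
    exact hx (by simp [v, h])
  have hv : ∀ k, CompactLipschitz (v k) := fun k =>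
    ⟨⟨_, hvL k⟩, hu.hasCompactSupport.mono (hsupp k)⟩
  have hvU : ∀ k : ℕ, tsupport (v k) ⊆ U := by
    intro k x hx
    have hc : IsClosed {x | 1 ≤ (k : ℝ) * Metric.infDist x Uᶜ} :=
      isClosed_le continuous_const (continuous_const.mul (Metric.continuous_infDist_pt _))
    have hsub : Function.support (v k) ⊆ {x | 1 ≤ (k : ℝ) * Metric.infDist x Uᶜ} := by
      intro y hy
      by_contra h
      refine hy ?_
      have h2 : distCutoff Uᶜ ((k : ℝ≥0) : ℝ) y = 0 := distCutoff_eq_zero (by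
        simpa using (not_le.1 h).le)
      simp only [v, h2, zero_smul]
    have h1 : 1 ≤ (k : ℝ) * Metric.infDist x Uᶜ := closure_minimal hsub hc hx
    by_contra hxU
    rw [Metric.infDist_zero_of_mem (show x ∈ Uᶜ from hxU)] at h1
    linarith
  -- Near each point of `U` the truncations are eventually equal to `u`. With the uniform Lipschitz
  -- bound, dominated convergence applies to the maps and to their derivatives.
  have hev : ∀ x ∈ U, ∀ᶠ k : ℕ in atTop, v k =ᶠ[𝓝 x] u := by
    intro x hx
    have hpos : 0 < Metric.infDist x Uᶜ :=
      (hS.notMem_iff_infDist_pos hne).1 (fun h => h hx)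
    obtain ⟨k0, hk0⟩ := exists_nat_gt (4 / Metric.infDist x Uᶜ)
    filter_upwards [eventually_ge_atTop k0] with k hk
    have h2 : ∀ᶠ y in 𝓝 x, Metric.infDist x Uᶜ / 2 < Metric.infDist y Uᶜ :=
      (Metric.continuous_infDist_pt Uᶜ).continuousAt.eventually_const_lt (by linarith)
    filter_upwards [h2] with y hy
    have h3 : 4 < (k : ℝ) * Metric.infDist x Uᶜ := by
      rw [div_lt_iff₀ hpos] at hk0
      have : (k0 : ℝ) ≤ k := by exact_mod_cast hk
      nlinarith
    have h4 : distCutoff Uᶜ ((k : ℝ≥0) : ℝ) y = 1 := distCutoff_eq_one (by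
      have : (0 : ℝ) ≤ k := by positivity
      simp only [NNReal.coe_natCast]
      nlinarith)
    simp only [v, h4, one_smul]
  have hT : MeasurableSet (tsupport u) := (isClosed_tsupport u).measurableSet
  have hTf : (volume.restrict U) (tsupport u) ≠ ⊤ :=
    ((Measure.restrict_apply_le _ _).trans_lt hu.hasCompactSupport.isCompact.measure_lt_top).ne
  have hnot : ∀ x ∉ tsupport u, ∀ k, v k =ᶠ[𝓝 x] 0 := by
    intro x hx k
    filter_upwards [(isClosed_tsupport u).isOpen_compl.mem_nhds hx] with y hy
    by_contra h
    exact hy (subset_closure (hsupp k y h))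
  have hnot' : ∀ x ∉ tsupport u, u =ᶠ[𝓝 x] 0 := by
    intro x hx
    filter_upwards [(isClosed_tsupport u).isOpen_compl.mem_nhds hx] with y hy
    by_contra h
    exact hy (subset_closure h)
  have l1 := tendsto_eLpNorm_zero_of_bounded (μ := volume.restrict U)
    (f := fun k x => ‖v k x - u x‖) hT hTf (M := M)
    (fun k => ((hv k).aestronglyMeasurable _).sub (hu.aestronglyMeasurable _) |>.norm)
    (fun k => Eventually.of_forall fun x => by
      rw [abs_norm]
      have : v k x - u x = (distCutoff Uᶜ (k : ℝ≥0) x - 1) • u x := by simp only [v]; module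
      rw [this, norm_smul]
      refine (mul_le_of_le_one_left (norm_nonneg _) ?_).trans (hM x)
      rw [Real.norm_eq_abs, abs_le]
      constructor <;>
        linarith [distCutoff_nonneg Uᶜ (k : ℝ≥0) x, distCutoff_le_one Uᶜ (k : ℝ≥0) x])
    (fun k x hx => by simp [(hnot x hx k).eq_of_nhds, (hnot' x hx).eq_of_nhds])
    ((ae_restrict_iff' hU.measurableSet).2 (Eventually.of_forall fun x hx =>
      tendsto_const_nhds.congr' ((hev x hx).mono fun k hk => by simp [hk.eq_of_nhds])))
  have l2 := tendsto_eLpNorm_zero_of_bounded (μ := volume.restrict U)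
    (f := fun k x => ‖fderiv ℝ (v k) x - fderiv ℝ u x‖) hT hTf (M := (3 * K : ℝ≥0) + K)
    (fun k => ((measurable_fderiv ℝ (v k)).sub (measurable_fderiv ℝ u)).norm.aestronglyMeasurable)
    (fun k => Eventually.of_forall fun x => by
      rw [abs_norm]
      exact (norm_sub_le _ _).trans (add_le_add (norm_fderiv_le_of_lipschitz ℝ (hvL k))
        (norm_fderiv_le_of_lipschitz ℝ hK)))
    (fun k x hx => by
      rw [(hnot x hx k).fderiv_eq, (hnot' x hx).fderiv_eq]; simp)
    ((ae_restrict_iff' hU.measurableSet).2 (Eventually.of_forall fun x hx =>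
      tendsto_const_nhds.congr' ((hev x hx).mono fun k hk => by simp [hk.fderiv_eq])))
  obtain ⟨k, h1, h2⟩ := ((l1.eventually_le_const hε).and (l2.eventually_le_const hε)).exists
  exact ⟨v k, hv k, hvU k, h1, h2⟩

-- Differentiation under the integral needs only a Lipschitz bound and differentiability at almost
-- every point, which Rademacher's theorem provides.
open scoped Convolution in
lemma hasFDerivAt_convolution_lipschitz {u : E → F} (hu : CompactLipschitz u) {ρ : E → ℝ}
    (hρ : Continuous ρ) (hρc : HasCompactSupport ρ) (x : E) :
    HasFDerivAt (ρ ⋆[ContinuousLinearMap.lsmul ℝ ℝ, volume] u)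
      ((ρ ⋆[ContinuousLinearMap.lsmul ℝ ℝ, volume] fderiv ℝ u) x) x := by
  obtain ⟨K, hK⟩ := hu.exists_lipschitz
  have hcont : ∀ y, Continuous fun t => ρ t • u (y - t) := fun y =>
    hρ.smul (hu.continuous.comp (continuous_const.sub continuous_id))
  have hd : ∀ᵐ t, DifferentiableAt ℝ u (x - t) :=
    (Measure.measurePreserving_sub_left (volume : Measure E) x).quasiMeasurePreserving.ae
      hu.ae_differentiableAt
  refine (hasFDerivAt_integral_of_dominated_loc_of_lip (F := fun y t => ρ t • u (y - t))
    (F' := fun t => ρ t • fderiv ℝ u (x - t)) (bound := fun t => |ρ t| * K) (s := univ)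
    univ_mem ?_ ?_ ?_ ?_ ?_ ?_).2
  · exact Eventually.of_forall fun y => (hcont y).aestronglyMeasurable
  · exact (hcont x).integrable_of_hasCompactSupport (hρc.smul_right)
  · refine hρ.aestronglyMeasurable.smul ?_
    exact ((measurable_fderiv ℝ u).comp (measurable_const.sub measurable_id)).aestronglyMeasurable
  · refine Eventually.of_forall fun t => (LipschitzWith.of_dist_le_mul fun y z => ?_).lipschitzOnWith
    rw [dist_eq_norm, ← smul_sub, norm_smul, ← dist_eq_norm]
    have := hK.dist_le_mul (y - t) (z - t)
    rw [dist_sub_right] at this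
    calc _ ≤ |ρ t| * (K * dist y z) := by rw [Real.norm_eq_abs]; gcongr
      _ = _ := by simp [mul_assoc]
  · exact (hρ.abs.integrable_of_hasCompactSupport hρc.abs).mul_const _
  · filter_upwards [hd] with t ht
    have h1 : HasFDerivAt (fun y : E => y - t) (ContinuousLinearMap.id ℝ E) x :=
      (hasFDerivAt_id x).sub_const t
    have h2 := (ht.hasFDerivAt.comp x h1).const_smul (ρ t)
    rw [ContinuousLinearMap.comp_id] at h2
    exact h2

open scoped Convolution in
/-- Mollification of a Lipschitz map with compact support. -/
lemma exists_contDiff_approx_of_tsupport_subset {u : E → F} (hu : CompactLipschitz u) {U : Set E}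
    (hU : IsOpen U) (hsub : tsupport u ⊆ U) {ε : ℝ≥0∞} (hε : 0 < ε) :
    ∃ w : E → F, ContDiff ℝ ∞ w ∧ HasCompactSupport w ∧ tsupport w ⊆ U ∧
      eLpNorm (fun x => ‖w x - u x‖) 2 volume ≤ ε ∧
      eLpNorm (fun x => ‖fderiv ℝ w x - fderiv ℝ u x‖) 2 volume ≤ ε := by
  obtain ⟨K, hK⟩ := hu.exists_lipschitz
  have hcomp : IsCompact (tsupport u) := hu.hasCompactSupport
  obtain ⟨δ, hδ, hδU⟩ := hcomp.exists_cthickening_subset_open hU hsub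
  let φ : ℕ → ContDiffBump (0 : E) := fun k =>
    ⟨δ / (2 * (k + 1)), δ / (k + 1), by positivity, by
      rw [div_lt_div_iff_of_pos_left hδ (by positivity) (by positivity)]
      have : (0 : ℝ) ≤ k := by positivity
      linarith⟩
  have hφ0 : Tendsto (fun k => (φ k).rOut) atTop (𝓝 0) :=
    tendsto_const_nhds.div_atTop (tendsto_atTop_add_const_right _ 1 tendsto_natCast_atTop_atTop)
  have hφle : ∀ k, (φ k).rOut ≤ δ := fun k => div_le_self hδ.le (by
    have : (0 : ℝ) ≤ k := by positivity
    linarith)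
  let ρ : ℕ → E → ℝ := fun k => (φ k).normed volume
  have hρc : ∀ k, Continuous (ρ k) := fun k => (φ k).continuous_normed
  have hρs : ∀ k, HasCompactSupport (ρ k) := fun k => (φ k).hasCompactSupport_normed
  let w : ℕ → E → F := fun k => ρ k ⋆[ContinuousLinearMap.lsmul ℝ ℝ, volume] u
  have hwd : ∀ k x, fderiv ℝ (w k) x =
      (ρ k ⋆[ContinuousLinearMap.lsmul ℝ ℝ, volume] fderiv ℝ u) x := fun k x =>
    (hasFDerivAt_convolution_lipschitz hu (hρc k) (hρs k) x).fderiv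
  have hwsm : ∀ k, ContDiff ℝ ∞ (w k) := fun k =>
    (hρs k).contDiff_convolution_left _ (φ k).contDiff_normed hu.continuous.locallyIntegrable
  have hT : IsCompact (Metric.cthickening δ (tsupport u)) := hcomp.cthickening
  have hwsupp : ∀ k, tsupport (w k) ⊆ Metric.cthickening δ (tsupport u) := by
    intro k
    refine closure_minimal ?_ Metric.isClosed_cthickening
    refine (MeasureTheory.support_convolution_subset _).trans ?_
    rintro _ ⟨t, ht, y, hy, rfl⟩
    rw [(φ k).support_normed_eq] at ht
    refine Metric.mem_cthickening_of_dist_le _ y _ _ (subset_closure hy) ?_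
    have : ‖t‖ < (φ k).rOut := by simpa using ht
    simpa [dist_eq_norm] using this.le.trans (hφle k)
  have hnot : ∀ x ∉ Metric.cthickening δ (tsupport u), ∀ k,
      w k =ᶠ[𝓝 x] 0 ∧ u =ᶠ[𝓝 x] 0 := by
    intro x hx k
    constructor
    · filter_upwards [Metric.isClosed_cthickening.isOpen_compl.mem_nhds hx] with y hy
      by_contra h
      exact hy (hwsupp k (subset_closure h))
    · filter_upwards [Metric.isClosed_cthickening.isOpen_compl.mem_nhds hx] with y hy
      by_contra h
      exact hy (Metric.self_subset_cthickening _ (subset_closure h))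
  have hdli : LocallyIntegrable (fderiv ℝ u) (volume : Measure E) := by
    refine (locallyIntegrable_const (K : ℝ)).mono (measurable_fderiv ℝ u).aestronglyMeasurable
      (Eventually.of_forall fun x => ?_)
    rw [NNReal.norm_eq]
    exact norm_fderiv_le_of_lipschitz ℝ hK
  have l1 := tendsto_eLpNorm_zero_of_bounded (μ := volume) (f := fun k x => ‖w k x - u x‖)
    hT.measurableSet hT.measure_lt_top.ne (M := K * δ)
    (fun k => ((hwsm k).continuous.sub hu.continuous).norm.aestronglyMeasurable)
    (fun k => Eventually.of_forall fun x => by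
      rw [abs_norm, ← dist_eq_norm]
      refine (φ k).dist_normed_convolution_le (hu.aestronglyMeasurable _) fun y hy => ?_
      exact (hK.dist_le_mul y x).trans
        (by gcongr; exact (Metric.mem_ball.1 hy).le.trans (hφle k)))
    (fun k x hx => by simp [(hnot x hx k).1.eq_of_nhds, (hnot x hx k).2.eq_of_nhds])
    (Eventually.of_forall fun x => by
      have := ContDiffBump.convolution_tendsto_right_of_continuous (μ := (volume : Measure E)) hφ0
        hu.continuous x
      simpa using (this.sub_const (u x)).norm)
  have l2 := tendsto_eLpNorm_zero_of_bounded (μ := volume)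
    (f := fun k x => ‖fderiv ℝ (w k) x - fderiv ℝ u x‖)
    hT.measurableSet hT.measure_lt_top.ne (M := K + K)
    (fun k => ((measurable_fderiv ℝ (w k)).sub (measurable_fderiv ℝ u)).norm.aestronglyMeasurable)
    (fun k => Eventually.of_forall fun x => by
      rw [abs_norm]
      refine (norm_sub_le _ _).trans (add_le_add ?_ (norm_fderiv_le_of_lipschitz ℝ hK))
      rw [hwd, ← dist_zero_right]
      refine dist_convolution_le K.2 (φ k).support_normed_eq.subset (φ k).nonneg_normed
        (φ k).integral_normed (measurable_fderiv ℝ u).aestronglyMeasurable fun y _ => ?_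
      rw [dist_zero_right]
      exact norm_fderiv_le_of_lipschitz ℝ hK)
    (fun k x hx => by
      rw [(hnot x hx k).1.fderiv_eq, (hnot x hx k).2.fderiv_eq]; simp)
    (by
      -- The derivative is merely bounded and measurable, so its mollifications converge at Lebesgue
      -- points. This requires a bounded ratio of the outer and inner radii of the bumps; here it is
      -- `2`.
      have := ContDiffBump.ae_convolution_tendsto_right_of_locallyIntegrable (K := 2) hφ0
        (Eventually.of_forall fun k => le_of_eq (by simp only [φ]; field_simp)) hdli
      filter_upwards [this] with x hx
      simp only [hwd]
      simpa using (hx.sub_const (fderiv ℝ u x)).norm)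
  obtain ⟨k, h1, h2⟩ := ((l1.eventually_le_const hε).and (l2.eventually_le_const hε)).exists
  exact ⟨w k, hwsm k, (hρs k).convolution _ hu.hasCompactSupport, (hwsupp k).trans hδU, h1, h2⟩

lemma eLpNorm_norm_le_of_halves {U : Set E} {ε : ℝ≥0∞} {f g h : E → ℝ} (hg : Measurable g)
    (hh : Measurable h) (hfgh : ∀ x, |f x| ≤ |g x| + |h x|) (e1 : eLpNorm g 2 volume ≤ ε / 2)
    (e2 : eLpNorm h 2 (volume.restrict U) ≤ ε / 2) : eLpNorm f 2 (volume.restrict U) ≤ ε := by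
  refine (eLpNorm_mono_ae (g := (fun x => ‖g x‖) + fun x => ‖h x‖)
    (Eventually.of_forall fun x => ?_)).trans ((eLpNorm_add_le hg.norm.aestronglyMeasurable
      hh.norm.aestronglyMeasurable (by norm_num)).trans ?_)
  · rw [Pi.add_apply, Real.norm_of_nonneg (add_nonneg (norm_nonneg _) (norm_nonneg _))]
    exact hfgh x
  · rw [eLpNorm_norm, eLpNorm_norm]
    refine (add_le_add ((eLpNorm_mono_measure _ Measure.restrict_le_self).trans e1) e2).trans ?_
    rw [ENNReal.add_halves]

/-- Test fields are dense among the Lipschitz fields vanishing off an open set. -/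
theorem exists_contDiff_approx {u : E → F} (hu : CompactLipschitz u) {U : Set E} (hU : IsOpen U)
    (h0 : ∀ x ∉ U, u x = 0) {ε : ℝ≥0∞} (hε : 0 < ε) :
    ∃ w : E → F, ContDiff ℝ ∞ w ∧ HasCompactSupport w ∧ tsupport w ⊆ U ∧
      eLpNorm (fun x => ‖w x - u x‖) 2 (volume.restrict U) ≤ ε ∧
      eLpNorm (fun x => ‖fderiv ℝ w x - fderiv ℝ u x‖) 2 (volume.restrict U) ≤ ε := by
  have hε2 : 0 < ε / 2 := ENNReal.half_pos hε.ne'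
  obtain ⟨v, hv, hvU, h1, h2⟩ := exists_approx_tsupport_subset hu hU h0 hε2
  obtain ⟨w, hw, hwc, hwU, h3, h4⟩ := exists_contDiff_approx_of_tsupport_subset hv hU hvU hε2
  refine ⟨w, hw, hwc, hwU, eLpNorm_norm_le_of_halves ?_ ?_ (fun x => ?_) h3 h1,
    eLpNorm_norm_le_of_halves ?_ ?_ (fun x => ?_) h4 h2⟩
  · exact (hw.continuous.sub hv.continuous).norm.measurable
  · exact (hv.continuous.sub hu.continuous).norm.measurable
  · simp only [abs_norm]; exact norm_sub_le_norm_sub_add_norm_sub _ _ _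
  · exact ((measurable_fderiv ℝ w).sub (measurable_fderiv ℝ v)).norm
  · exact ((measurable_fderiv ℝ v).sub (measurable_fderiv ℝ u)).norm
  · simp only [abs_norm]; exact norm_sub_le_norm_sub_add_norm_sub _ _ _

end Density

end Pipe

namespace Pipe

/-! ### Compactness of the embedding in quantitative form: approximation by cell averages. -/

section FiniteRank

lemma eLpNorm_two_sq {α : Type*} [MeasurableSpace α] {V : Type*} [NormedAddCommGroup V]
    (f : α → V) (μ : Measure α) : eLpNorm f 2 μ ^ 2 = ∫⁻ x, ‖f x‖ₑ ^ 2 ∂μ := by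
  rw [eLpNorm_eq_lintegral_rpow_enorm_toReal (by norm_num) (by norm_num), ← ENNReal.rpow_natCast,
    ← ENNReal.rpow_mul]
  simp

/-- Jensen's inequality for the square of an integral. -/
lemma enorm_integral_sq_le {α : Type*} [MeasurableSpace α] {V : Type*} [NormedAddCommGroup V]
    [NormedSpace ℝ V] {μ : Measure α} [IsProbabilityMeasure μ] {f : α → V}
    (hf : AEStronglyMeasurable f μ) : ‖∫ x, f x ∂μ‖ₑ ^ 2 ≤ ∫⁻ x, ‖f x‖ₑ ^ 2 ∂μ := by
  rw [← eLpNorm_two_sq, ENNReal.pow_le_pow_left_iff (by norm_num)]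
  refine (enorm_integral_le_lintegral_enorm f).trans ?_
  rw [← eLpNorm_one_eq_lintegral_enorm]
  exact eLpNorm_le_eLpNorm_of_exponent_le (by norm_num) hf

/-- The Cauchy-Schwarz inequality. -/
lemma lintegral_enorm_mul_le {α : Type*} [MeasurableSpace α] {μ : Measure α} {f g : α → ℝ}
    (hf : AEStronglyMeasurable f μ) (hg : AEStronglyMeasurable g μ) :
    ∫⁻ x, ‖f x‖ₑ * ‖g x‖ₑ ∂μ ≤ eLpNorm f 2 μ * eLpNorm g 2 μ := by
  have := eLpNorm_smul_le_mul_eLpNorm (p := 2) (q := 2) (r := 1) hg hf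
  rw [eLpNorm_one_eq_lintegral_enorm] at this
  refine le_trans (le_of_eq (lintegral_congr fun x => ?_)) this
  rw [Pi.smul_apply', enorm_smul]

lemma enorm_integral_mul_le {α : Type*} [MeasurableSpace α] {μ : Measure α} {f g : α → ℝ}
    (hf : AEStronglyMeasurable f μ) (hg : AEStronglyMeasurable g μ) :
    ‖∫ x, f x * g x ∂μ‖ₑ ≤ eLpNorm f 2 μ * eLpNorm g 2 μ := by
  refine (enorm_integral_le_lintegral_enorm _).trans ?_
  simp only [enorm_mul]
  exact lintegral_enorm_mul_le hf hg

lemma exists_disjoint_refinement {α : Type*} [MeasurableSpace α] {N : ℕ} (B : Fin N → Set α)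
    (hB : ∀ i, MeasurableSet (B i)) : ∃ c : Fin N → Set α, (∀ i, MeasurableSet (c i)) ∧
      (∀ i, c i ⊆ B i) ∧ Pairwise (Function.onFun Disjoint c) ∧ ⋃ i, c i = ⋃ i, B i := by
  refine ⟨disjointed B, fun i => ?_, disjointed_subset B, disjoint_disjointed B, iUnion_disjointed⟩
  rw [disjointed_apply, Finset.sup_set_eq_biUnion]
  exact (hB i).diff (Finset.measurableSet_biUnion _ fun j _ => hB j)

variable {E : Type*} [NormedAddCommGroup E] [InnerProductSpace ℝ E] [FiniteDimensional ℝ E]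
  [MeasurableSpace E] [BorelSpace E]

/-- Translations of a differentiable function in `L²`. -/
lemma lintegral_translate_sub_sq_le {w : E → ℝ} (hw : ContDiff ℝ 1 w) (h : E) :
    ∫⁻ x, ‖w (x + h) - w x‖ₑ ^ 2 ≤ ‖h‖ₑ ^ 2 * ∫⁻ x, ‖fderiv ℝ w x‖ₑ ^ 2 := by
  have hdc : Continuous (fderiv ℝ w) := hw.continuous_fderiv (by norm_num)
  let μ : Measure ℝ := volume.restrict (Ioc 0 1)
  have hμ : IsProbabilityMeasure μ := ⟨by simp [μ]⟩
  have hcont : ∀ x, Continuous fun t : ℝ => fderiv ℝ w (x + t • h) h := fun x =>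
    (hdc.comp (continuous_const.add (continuous_id.smul continuous_const))).clm_apply
      continuous_const
  have h1 : ∀ x, ‖w (x + h) - w x‖ₑ ^ 2 ≤
      ∫⁻ t, ‖h‖ₑ ^ 2 * ‖fderiv ℝ w (x + t • h)‖ₑ ^ 2 ∂μ := by
    intro x
    have e : w (x + h) - w x = ∫ t, fderiv ℝ w (x + t • h) h ∂μ := by
      have hd : ∀ t : ℝ, HasDerivAt (fun t : ℝ => w (x + t • h)) (fderiv ℝ w (x + t • h) h) t := by
        intro t
        have h2 : HasDerivAt (fun t : ℝ => x + t • h) h t := by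
          simpa using ((hasDerivAt_id t).smul_const h).const_add x
        exact (hw.differentiable (by norm_num) (x + t • h)).hasFDerivAt.comp_hasDerivAt t h2
      have := intervalIntegral.integral_eq_sub_of_hasDerivAt (a := 0) (b := 1)
        (fun t _ => hd t) ((hcont x).intervalIntegrable _ _)
      rw [intervalIntegral.integral_of_le zero_le_one] at this
      simpa using this.symm
    rw [e]
    refine (enorm_integral_sq_le (hcont x).aestronglyMeasurable).trans (lintegral_mono fun t => ?_)
    rw [← mul_pow, mul_comm]
    exact pow_le_pow_left₀ (by simp) (ContinuousLinearMap.le_opENorm _ _) 2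
  have hm : Measurable fun z : E × ℝ => ‖h‖ₑ ^ 2 * ‖fderiv ℝ w (z.1 + z.2 • h)‖ₑ ^ 2 := by
    have : Continuous fun z : E × ℝ => fderiv ℝ w (z.1 + z.2 • h) :=
      hdc.comp (continuous_fst.add (continuous_snd.smul continuous_const))
    exact (this.enorm.measurable.pow_const 2).const_mul _
  calc _ ≤ ∫⁻ x, ∫⁻ t, ‖h‖ₑ ^ 2 * ‖fderiv ℝ w (x + t • h)‖ₑ ^ 2 ∂μ := lintegral_mono h1
    _ = ∫⁻ t, ∫⁻ x, ‖h‖ₑ ^ 2 * ‖fderiv ℝ w (x + t • h)‖ₑ ^ 2 ∂volume ∂μ :=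
        lintegral_lintegral_swap hm.aemeasurable
    _ = ∫⁻ _ : ℝ, (‖h‖ₑ ^ 2 * ∫⁻ x : E, ‖fderiv ℝ w x‖ₑ ^ 2) ∂μ := by
        refine lintegral_congr fun t => ?_
        rw [lintegral_add_right_eq_self (fun x => ‖h‖ₑ ^ 2 * ‖fderiv ℝ w x‖ₑ ^ 2),
          lintegral_const_mul _ (hdc.enorm.measurable.pow_const 2)]
    _ = _ := by simp

/-- Oscillation of a function around its average over a ball containing the point. -/
lemma enorm_sub_average_sq_le {w : E → ℝ} (hw : Continuous w) {δ : ℝ} (hδ : 0 < δ) {x z : E}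
    (hxz : dist x z < δ) : ‖w x - ⨍ y in Metric.ball z δ, w y‖ₑ ^ 2 ≤
      (volume (Metric.ball (0 : E) δ))⁻¹ *
        ∫⁻ h in Metric.ball (0 : E) (2 * δ), ‖w (x + h) - w x‖ₑ ^ 2 := by
  let B := Metric.ball z δ
  have hBpos : volume B ≠ 0 := (Metric.measure_ball_pos volume z hδ).ne'
  have hBfin : volume B ≠ ⊤ := measure_ball_lt_top.ne
  have hBvol : volume B = volume (Metric.ball (0 : E) δ) := Measure.addHaar_ball_center _ _ _
  let μ : Measure E := (volume B)⁻¹ • volume.restrict B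
  have hμ : IsProbabilityMeasure μ := ⟨by simp [μ, ENNReal.inv_mul_cancel hBpos hBfin]⟩
  have e : ⨍ y in B, w y = ∫ y, w y ∂μ := by
    simp [average, μ]
  have hint : Integrable w μ := by
    refine Integrable.smul_measure ?_ (by simpa using hBpos)
    exact (hw.continuousOn.integrableOn_compact (isCompact_closedBall z δ)).mono_set
      Metric.ball_subset_closedBall
  have e2 : w x - ⨍ y in B, w y = ∫ y, (w x - w y) ∂μ := by
    rw [e, integral_sub (integrable_const _) hint]; simp
  rw [e2]
  refine (enorm_integral_sq_le (by fun_prop)).trans ?_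
  simp only [μ]
  rw [lintegral_smul_measure, smul_eq_mul, hBvol]
  refine mul_le_mul_right ?_ _
  calc ∫⁻ y in B, ‖w x - w y‖ₑ ^ 2 ≤ ∫⁻ y in Metric.ball x (2 * δ), ‖w x - w y‖ₑ ^ 2 := by
        refine lintegral_mono_set (Metric.ball_subset_ball' ?_)
        rw [dist_comm]; linarith
    _ = ∫⁻ h in Metric.ball (0 : E) (2 * δ), ‖w (x + h) - w x‖ₑ ^ 2 := by
        have hmp := (measurePreserving_add_left (volume : Measure E) x)
        have := hmp.setLIntegral_comp_preimage_emb (MeasurableEquiv.addLeft x).measurableEmbedding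
          (fun y => ‖w x - w y‖ₑ ^ 2) (Metric.ball x (2 * δ))
        rw [← this]
        have hpre : (fun y => x + y) ⁻¹' Metric.ball x (2 * δ) = Metric.ball 0 (2 * δ) := by
          ext y; simp
        rw [hpre]
        refine lintegral_congr fun h => ?_
        rw [← enorm_neg, neg_sub]

lemma enorm_average_sq_le {w : E → ℝ} (hw : Continuous w) {δ : ℝ} (hδ : 0 < δ) (z : E) :
    ‖⨍ y in Metric.ball z δ, w y‖ₑ ^ 2 ≤
      (volume (Metric.ball (0 : E) δ))⁻¹ * eLpNorm w 2 volume ^ 2 := by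
  let B := Metric.ball z δ
  have hBpos : volume B ≠ 0 := (Metric.measure_ball_pos volume z hδ).ne'
  have hBfin : volume B ≠ ⊤ := measure_ball_lt_top.ne
  have hBvol : volume B = volume (Metric.ball (0 : E) δ) := Measure.addHaar_ball_center _ _ _
  let μ : Measure E := (volume B)⁻¹ • volume.restrict B
  have hμ : IsProbabilityMeasure μ := ⟨by simp [μ, ENNReal.inv_mul_cancel hBpos hBfin]⟩
  have e : ⨍ y in B, w y = ∫ y, w y ∂μ := by
    simp [average, μ]
  rw [e]
  refine (enorm_integral_sq_le (by fun_prop)).trans ?_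
  simp only [μ]
  rw [lintegral_smul_measure, smul_eq_mul, hBvol, eLpNorm_two_sq]
  exact mul_le_mul_right (lintegral_mono' Measure.restrict_le_self le_rfl) _

/-- The mean square oscillation of a function at scale `δ`. -/
noncomputable def oscillation (w : E → ℝ) (δ : ℝ) (x : E) : ℝ≥0∞ :=
  ((volume (Metric.ball (0 : E) δ))⁻¹ *
    ∫⁻ h in Metric.ball (0 : E) (2 * δ), ‖w (x + h) - w x‖ₑ ^ 2) ^ (1 / 2 : ℝ)

lemma measurable_oscillation {w : E → ℝ} (hw : Continuous w) (δ : ℝ) :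
    Measurable (oscillation w δ) := by
  have : Measurable fun z : E × E => ‖w (z.1 + z.2) - w z.1‖ₑ ^ 2 :=
    ((hw.comp (continuous_fst.add continuous_snd)).sub (hw.comp
      continuous_fst)).enorm.measurable.pow_const 2
  exact (this.lintegral_prod_right'.const_mul _).pow_const _

lemma lintegral_oscillation_sq_le {w : E → ℝ} (hw : ContDiff ℝ 1 w) {δ : ℝ} (hδ : 0 < δ) :
    ∫⁻ x, oscillation w δ x ^ 2 ≤ (2 ^ Module.finrank ℝ E * ENNReal.ofReal (2 * δ) *
      eLpNorm (fun x => ‖fderiv ℝ w x‖) 2 volume) ^ 2 := by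
  set d := Module.finrank ℝ E
  set b := volume (Metric.ball (0 : E) δ) with hb
  have hb0 : b ≠ 0 := (Metric.measure_ball_pos volume 0 hδ).ne'
  have hbt : b ≠ ⊤ := measure_ball_lt_top.ne
  have hb2 : volume (Metric.ball (0 : E) (2 * δ)) = 2 ^ d * b := by
    rw [hb, Measure.addHaar_ball_mul_of_pos volume (0 : E) two_pos δ, ENNReal.ofReal_pow two_pos.le]
    simp [d]
  have hsq : ∀ x, oscillation w δ x ^ 2 =
      b⁻¹ * ∫⁻ h in Metric.ball (0 : E) (2 * δ), ‖w (x + h) - w x‖ₑ ^ 2 := by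
    intro x
    rw [oscillation, ← ENNReal.rpow_natCast, ← ENNReal.rpow_mul]
    simp [hb]
  have hm : Measurable fun z : E × E => ‖w (z.1 + z.2) - w z.1‖ₑ ^ 2 :=
    ((hw.continuous.comp (continuous_fst.add continuous_snd)).sub (hw.continuous.comp
      continuous_fst)).enorm.measurable.pow_const 2
  simp only [hsq]
  rw [lintegral_const_mul _ hm.lintegral_prod_right',
    lintegral_lintegral_swap hm.aemeasurable]
  set D := eLpNorm (fun x => ‖fderiv ℝ w x‖) 2 volume with hD
  have hD2 : D ^ 2 = ∫⁻ x, ‖fderiv ℝ w x‖ₑ ^ 2 := by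
    rw [hD, eLpNorm_two_sq]; simp
  have h1 : ∫⁻ h in Metric.ball (0 : E) (2 * δ), ∫⁻ x, ‖w (x + h) - w x‖ₑ ^ 2 ≤
      ∫⁻ _ in Metric.ball (0 : E) (2 * δ), ENNReal.ofReal (2 * δ) ^ 2 * D ^ 2 := by
    refine setLIntegral_mono measurable_const fun h hh => ?_
    refine (lintegral_translate_sub_sq_le hw h).trans ?_
    rw [← hD2]
    gcongr
    rw [← ofReal_norm]
    exact ENNReal.ofReal_le_ofReal (by simpa using (Metric.mem_ball.1 hh).le)
  rw [setLIntegral_const, hb2] at h1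
  calc _ ≤ b⁻¹ * (ENNReal.ofReal (2 * δ) ^ 2 * D ^ 2 * (2 ^ d * b)) := mul_le_mul_right h1 _
    _ = (b⁻¹ * b) * (2 ^ d * (ENNReal.ofReal (2 * δ) ^ 2 * D ^ 2)) := by ring
    _ = 2 ^ d * (ENNReal.ofReal (2 * δ) ^ 2 * D ^ 2) := by
        rw [ENNReal.inv_mul_cancel hb0 hbt, one_mul]
    -- The volume ratio `2 ^ d` is enlarged to `4 ^ d` so that the bound is a perfect square.
    _ ≤ 2 ^ d * 2 ^ d * (ENNReal.ofReal (2 * δ) ^ 2 * D ^ 2) := by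
        gcongr
        exact le_mul_of_one_le_left (by simp) (one_le_pow₀ one_le_two)
    _ = _ := by ring

lemma lintegral_mul_oscillation_le {μ : Measure E} (hμ : μ ≤ volume) {p : E → ℝ}
    (hp : AEStronglyMeasurable p μ) {w : E → ℝ} (hw : ContDiff ℝ 1 w) {δ : ℝ} (hδ : 0 < δ) :
    ∫⁻ x, ‖p x‖ₑ * oscillation w δ x ∂μ ≤ eLpNorm p 2 μ *
      (2 ^ Module.finrank ℝ E * ENNReal.ofReal (2 * δ) *
        eLpNorm (fun x => ‖fderiv ℝ w x‖) 2 volume) := by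
  have h := ENNReal.lintegral_mul_le_Lp_mul_Lq μ Real.HolderConjugate.two_two hp.enorm
    (measurable_oscillation hw.continuous δ).aemeasurable
  refine h.trans (mul_le_mul' (le_of_eq ?_) ?_)
  · rw [eLpNorm_eq_lintegral_rpow_enorm_toReal (by norm_num) (by norm_num)]
    simp
  · rw [one_div, ENNReal.rpow_inv_le_iff two_pos]
    have := (lintegral_mono' hμ (le_refl fun x => oscillation w δ x ^ 2)).trans
      (lintegral_oscillation_sq_le hw hδ)
    simpa only [ENNReal.rpow_two] using this

/-- Up to a small error, integration against a function in `W^{1,2}` is a finite rank operation. -/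
theorem exists_finite_rank_bound {Ω : Set E} (hΩ : MeasurableSet Ω) (hb : Bornology.IsBounded Ω)
    {ε : ℝ≥0} (hε : 0 < ε) : ∃ (N : ℕ) (c : Fin N → Set E) (C : ℝ≥0), (∀ i, MeasurableSet (c i)) ∧
      ∀ p : E → ℝ, MemLp p 2 (volume.restrict Ω) → ∀ w : E → ℝ, CompactLipschitz w →
        ‖∫ x in Ω, p x * w x‖ₑ ≤ (ε * eLpNorm p 2 (volume.restrict Ω) +
          C * ∑ i, ‖∫ x in Ω ∩ c i, p x‖ₑ) * sobolevNorm w := by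
  set d := Module.finrank ℝ E
  -- The scale at which the oscillation estimate has the constant `2 ^ d * (2 * δ) = ε`.
  let δ : ℝ := ε / (2 * 2 ^ d)
  have hδ : 0 < δ := by positivity
  have hδε : 2 ^ d * ENNReal.ofReal (2 * δ) = ε := by
    have : 2 * δ = ε / 2 ^ d := by simp only [δ]; field_simp
    rw [this, ENNReal.ofReal_div_of_pos (by positivity), ENNReal.ofReal_pow two_pos.le]
    simp only [ENNReal.ofReal_ofNat, ENNReal.ofReal_coe_nnreal]
    exact ENNReal.mul_div_cancel (by positivity) (by finiteness)
  obtain ⟨t, ht, htΩ⟩ := Metric.totallyBounded_iff.1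
    (hb.isCompact_closure.totallyBounded.subset subset_closure) δ hδ
  obtain ⟨N, e⟩ : ∃ N, Nonempty (Fin N ≃ t) := by
    have := ht.fintype
    exact ⟨Fintype.card t, ⟨(Fintype.equivFin t).symm⟩⟩
  obtain ⟨e⟩ := e
  obtain ⟨c, hcm, hcB, hcd, hcU⟩ := exists_disjoint_refinement
    (fun i : Fin N => Metric.ball (e i : E) δ) fun i => measurableSet_ball
  set b := volume (Metric.ball (0 : E) δ) with hbdef
  have hb0 : b ≠ 0 := (Metric.measure_ball_pos volume 0 hδ).ne'
  have hbt : b ≠ ⊤ := measure_ball_lt_top.ne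
  have hΩc : Ω = ⋃ i, Ω ∩ c i := by
    rw [← inter_iUnion, hcU, eq_comm, inter_eq_left]
    intro x hx
    obtain ⟨y, hy, hxy⟩ := mem_iUnion₂.1 (htΩ hx)
    exact mem_iUnion.2 ⟨e.symm ⟨y, hy⟩, by simpa using hxy⟩
  have hdisj : Pairwise (Function.onFun Disjoint fun i => Ω ∩ c i) := fun i j hij =>
    (hcd hij).mono inter_subset_right inter_subset_right
  have hm : ∀ i, MeasurableSet (Ω ∩ c i) := fun i => hΩ.inter (hcm i)
  have hfin : IsFiniteMeasure (volume.restrict Ω) := ⟨by simpa using hb.measure_lt_top⟩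
  -- By Jensen's inequality an average over a ball of volume `b` is at most `b ^ (-1/2)` times the
  -- `L²` norm.
  let C : ℝ≥0 := (b⁻¹ ^ (1 / 2 : ℝ)).toNNReal
  have hC : (C : ℝ≥0∞) = b⁻¹ ^ (1 / 2 : ℝ) :=
    ENNReal.coe_toNNReal (ENNReal.rpow_ne_top_of_nonneg (by norm_num) (ENNReal.inv_ne_top.2 hb0))
  refine ⟨N, c, C, hcm, fun p hp => ?_⟩
  set A := ε * eLpNorm p 2 (volume.restrict Ω) + C * ∑ i, ‖∫ x in Ω ∩ c i, p x‖ₑ with hA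
  have hsmooth : ∀ w : E → ℝ, ContDiff ℝ 1 w → HasCompactSupport w →
      ‖∫ x in Ω, p x * w x‖ₑ ≤ A * sobolevNorm w := by
    intro w hw hwc
    let a : Fin N → ℝ := fun i => ⨍ y in Metric.ball (e i : E) δ, w y
    have hpint : Integrable p (volume.restrict Ω) := hp.integrable (by norm_num)
    have hwL : MemLp w 2 (volume.restrict Ω) :=
      (hw.continuous.memLp_of_hasCompactSupport hwc).restrict _
    have hpw : Integrable (fun x => p x * w x) (volume.restrict Ω) := hp.integrable_mul hwL
    have hΩi : ∀ i, Ω ∩ c i ⊆ Ω := fun i => inter_subset_left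
    -- In each cell `w` is replaced by its average over the full ball containing the cell. The
    -- difference is controlled by the oscillation of `w`, and the averages meet `p` only through
    -- its integrals over the cells.
    have h1 : ∫ x in Ω, p x * w x = (∑ i, ∫ x in Ω ∩ c i, p x * (w x - a i)) +
        ∑ i, a i * ∫ x in Ω ∩ c i, p x := by
      conv_lhs => rw [hΩc]
      rw [integral_iUnion_fintype hm hdisj fun i => IntegrableOn.mono_set hpw (hΩi i),
        ← Finset.sum_add_distrib]
      refine Finset.sum_congr rfl fun i _ => ?_
      have hpi : IntegrableOn p (Ω ∩ c i) := IntegrableOn.mono_set hpint (hΩi i)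
      have hpwi : IntegrableOn (fun x => p x * w x) (Ω ∩ c i) := IntegrableOn.mono_set hpw (hΩi i)
      rw [← integral_const_mul, ← integral_add]
      · refine integral_congr_ae (Eventually.of_forall fun x => ?_)
        change p x * w x = p x * (w x - a i) + a i * p x
        ring
      · have : (fun x => p x * (w x - a i)) = fun x => p x * w x - p x * a i := by
          funext x; ring
        rw [this]
        exact hpwi.sub (hpi.mul_const _)
      · exact hpi.const_mul _
    have h2 : ‖∑ i, ∫ x in Ω ∩ c i, p x * (w x - a i)‖ₑ ≤
        ε * eLpNorm p 2 (volume.restrict Ω) * eLpNorm (fun x => ‖fderiv ℝ w x‖) 2 volume := by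
      have h3 : ∀ i, ‖∫ x in Ω ∩ c i, p x * (w x - a i)‖ₑ ≤
          ∫⁻ x in Ω ∩ c i, ‖p x‖ₑ * oscillation w δ x := by
        intro i
        refine (enorm_integral_le_lintegral_enorm _).trans
          (setLIntegral_mono' (hm i) fun x hx => ?_)
        rw [enorm_mul]
        refine mul_le_mul_right ?_ _
        rw [oscillation, one_div, ENNReal.le_rpow_inv_iff two_pos]
        have := enorm_sub_average_sq_le hw.continuous hδ (hcB i hx.2)
        simpa only [ENNReal.rpow_two] using this
      refine (enorm_sum_le _ _).trans ((Finset.sum_le_sum fun i _ => h3 i).trans ?_)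
      have h4 : ∑ i, ∫⁻ x in Ω ∩ c i, ‖p x‖ₑ * oscillation w δ x =
          ∫⁻ x in Ω, ‖p x‖ₑ * oscillation w δ x := by
        conv_rhs => rw [hΩc]
        rw [lintegral_iUnion hm hdisj, tsum_fintype]
      rw [h4]
      refine (lintegral_mul_oscillation_le Measure.restrict_le_self hp.1 hw hδ).trans
        (le_of_eq ?_)
      rw [hδε]; ring
    have h5 : ‖∑ i, a i * ∫ x in Ω ∩ c i, p x‖ₑ ≤
        C * (∑ i, ‖∫ x in Ω ∩ c i, p x‖ₑ) * eLpNorm w 2 volume := by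
      refine (enorm_sum_le _ _).trans ?_
      rw [Finset.mul_sum, Finset.sum_mul]
      refine Finset.sum_le_sum fun i _ => ?_
      rw [enorm_mul, mul_right_comm]
      refine mul_le_mul_left ?_ _
      rw [← ENNReal.pow_le_pow_left_iff two_ne_zero]
      refine (enorm_average_sq_le hw.continuous hδ _).trans (le_of_eq ?_)
      rw [mul_pow, hC, ← ENNReal.rpow_natCast (b⁻¹ ^ (1 / 2 : ℝ)), ← ENNReal.rpow_mul]
      simp [hbdef]
    rw [h1]
    refine (enorm_add_le _ _).trans ((add_le_add h2 h5).trans ?_)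
    rw [hA, sobolevNorm, add_mul]
    gcongr
    · exact le_add_self
    · exact le_self_add
  intro w hw
  have hAfin : A ≠ ⊤ := by
    rw [hA]
    refine ENNReal.add_ne_top.2 ⟨ENNReal.mul_ne_top (by simp) hp.2.ne,
      ENNReal.mul_ne_top (by simp) (ENNReal.sum_ne_top.2 fun i _ => by simp)⟩
  -- Lipschitz `w` are reached by smooth approximation; all coefficients of `τ` are finite.
  have happrox : ∀ τ : ℝ≥0, 0 < τ → ‖∫ x in Ω, p x * w x‖ₑ ≤
      A * sobolevNorm w + τ * (2 * A + eLpNorm p 2 (volume.restrict Ω)) := by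
    intro τ hτ
    obtain ⟨v, hv, hvc, -, e1, e2⟩ := exists_contDiff_approx hw isOpen_univ
      (fun x hx => absurd (mem_univ x) hx) (ε := τ) (by exact_mod_cast hτ)
    rw [Measure.restrict_univ] at e1 e2
    have hv1 : ContDiff ℝ 1 v := hv.of_le (by simp)
    have hvL := CompactLipschitz.of_contDiff hv1 hvc
    have e3 : eLpNorm (w - v) 2 volume ≤ τ := by
      rw [← eLpNorm_neg, neg_sub]; rwa [eLpNorm_norm] at e1
    have hsplit : ∫ x in Ω, p x * w x = (∫ x in Ω, p x * v x) + ∫ x in Ω, p x * (w - v) x := by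
      refine Eq.trans (integral_congr_ae (Eventually.of_forall fun x => ?_))
        (integral_add (hp.integrable_mul (hvL.memLp.restrict _))
          (hp.integrable_mul ((hw.memLp.sub hvL.memLp).restrict _)))
      simp; ring
    have e4 : ‖∫ x in Ω, p x * (w - v) x‖ₑ ≤ eLpNorm p 2 (volume.restrict Ω) * τ := by
      refine (enorm_integral_mul_le hp.1
        ((hw.memLp.sub hvL.memLp).1.mono_measure Measure.restrict_le_self)).trans ?_
      exact mul_le_mul_right ((eLpNorm_mono_measure _ Measure.restrict_le_self).trans e3) _
    have e5 : sobolevNorm v ≤ sobolevNorm w + 2 * τ := by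
      have f1 : eLpNorm v 2 volume ≤ eLpNorm w 2 volume + τ := by
        have : v = w + (v - w) := by abel
        rw [this]
        refine (eLpNorm_add_le (hw.aestronglyMeasurable _) ((hvL.aestronglyMeasurable _).sub
          (hw.aestronglyMeasurable _)) (by norm_num)).trans (add_le_add_right ?_ _)
        rwa [eLpNorm_norm] at e1
      have f2 : eLpNorm (fun x => ‖fderiv ℝ v x‖) 2 volume ≤
          eLpNorm (fun x => ‖fderiv ℝ w x‖) 2 volume + τ := by
        refine (eLpNorm_mono_ae (g := (fun x => ‖fderiv ℝ w x‖) +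
          fun x => ‖fderiv ℝ v x - fderiv ℝ w x‖) (Eventually.of_forall fun x => ?_)).trans
          ((eLpNorm_add_le (aestronglyMeasurable_norm_fderiv w _)
            (((measurable_fderiv ℝ v).sub (measurable_fderiv ℝ w)).norm.aestronglyMeasurable)
            (by norm_num)).trans (add_le_add_right e2 _))
        rw [norm_norm, Pi.add_apply,
          Real.norm_of_nonneg (add_nonneg (norm_nonneg _) (norm_nonneg _))]
        exact norm_le_norm_add_norm_sub' _ _
      refine (add_le_add f1 f2).trans (le_of_eq ?_)
      rw [sobolevNorm]; ring
    rw [hsplit]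
    refine (enorm_add_le _ _).trans ((add_le_add ((hsmooth v hv1 hvc).trans
      (mul_le_mul_right e5 A)) e4).trans (le_of_eq ?_))
    ring
  refine ENNReal.le_of_forall_pos_le_add fun η hη _ => ?_
  set B := 2 * A + eLpNorm p 2 (volume.restrict Ω) with hB
  have hBfin : B ≠ ⊤ := ENNReal.add_ne_top.2 ⟨ENNReal.mul_ne_top (by simp) hAfin, hp.2.ne⟩
  refine (happrox (η / (B.toNNReal + 1)) (by positivity)).trans (add_le_add_right ?_ _)
  rw [← ENNReal.coe_toNNReal hBfin, ← ENNReal.coe_mul, ENNReal.coe_le_coe, ENNReal.toNNReal_coe,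
    div_mul_eq_mul_div, div_le_iff₀ (by positivity)]
  gcongr
  exact le_self_add

end FiniteRank

end Pipe

namespace Pipe

/-! ### The Nečas inequality modulo finitely many means. -/

section Necas

variable {E : Type*} [NormedAddCommGroup E] [InnerProductSpace ℝ E] [FiniteDimensional ℝ E]
  [MeasurableSpace E] [BorelSpace E]

/-- The functional `v ↦ ∫ p div v` on fields that vanish off `U` is bounded by `N`. -/
def GradientBound (Ω U : Set E) (p : E → ℝ) (N : ℝ≥0∞) : Prop :=
  ∀ v : E → E, CompactLipschitz v → (∀ x ∉ U, v x = 0) →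
    ‖∫ x in Ω, p x * fieldDiv v x‖ₑ ≤ N * sobolevNorm v

/-- The functional `w ↦ ∫ p w` is bounded by `M`. -/
def DualBound (Ω : Set E) (p : E → ℝ) (M : ℝ≥0∞) : Prop :=
  ∀ w : E → ℝ, CompactLipschitz w → ‖∫ x in Ω, p x * w x‖ₑ ≤ M * sobolevNorm w

lemma memLp_fieldDiv {v : E → E} (hv : CompactLipschitz v) : MemLp (fieldDiv v) 2 volume := by
  refine hv.memLp_norm_fderiv.of_le_mul (c := ‖traceCLM E‖)
    (measurable_fieldDiv v).aestronglyMeasurable (Eventually.of_forall fun x => ?_)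
  rw [fieldDiv_eq, norm_norm]
  exact (traceCLM E).le_opNorm _

lemma fieldDiv_smul_ae {ψ : E → ℝ} (hψ : Differentiable ℝ ψ) {v : E → E}
    (hv : CompactLipschitz v) : ∀ᵐ x, fieldDiv (fun x => ψ x • v x) x =
      ψ x * fieldDiv v x + fderiv ℝ ψ x (v x) := by
  filter_upwards [hv.ae_differentiableAt] with x hx
  rw [fieldDiv_eq, fieldDiv_eq]
  simp only
  rw [fderiv_fun_smul (hψ x) hx, map_add, map_smul, traceCLM_smulRight, smul_eq_mul]

lemma ENNReal.le_of_forall_pos_le_add_mul {a b c : ℝ≥0∞} (hc : c ≠ ⊤)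
    (h : ∀ η : ℝ≥0, 0 < η → a ≤ b + c * η) : a ≤ b := by
  refine ENNReal.le_of_forall_pos_le_add fun ε hε _ => ?_
  refine (h (ε / (c.toNNReal + 1)) (by positivity)).trans (add_le_add_right ?_ _)
  rw [← ENNReal.coe_toNNReal hc, ← ENNReal.coe_mul, ENNReal.coe_le_coe, ENNReal.toNNReal_coe,
    mul_div_assoc', div_le_iff₀ (by positivity), mul_comm]
  gcongr
  exact le_self_add

lemma integral_sub_add_sub {μ : Measure E} {f₁ f₂ f₃ f₄ : E → ℝ} (h₁ : Integrable f₁ μ)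
    (h₂ : Integrable f₂ μ) (h₃ : Integrable f₃ μ) (h₄ : Integrable f₄ μ) :
    ∫ x, (f₁ x - f₂ x + f₃ x - f₄ x) ∂μ =
      (∫ x, f₁ x ∂μ) - (∫ x, f₂ x ∂μ) + (∫ x, f₃ x ∂μ) - ∫ x, f₄ x ∂μ := by
  rw [integral_sub (f := fun x => f₁ x - f₂ x + f₃ x) ((h₁.sub h₂).add h₃) h₄,
    integral_add (f := fun x => f₁ x - f₂ x) (h₁.sub h₂) h₃, integral_sub h₁ h₂]

/-- Solve `div V + W = Q` approximately with `Q = p` on `Ω ∩ B` and zero elsewhere. Then `‖Q‖²` is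
the integral of `p ψ Q`, and `ψ div V = div (ψ V) - ∇ψ · V`. The first term is seen by the gradient
of `p`, while `∇ψ · V` and `ψ W` are admissible for the dual bound. All norms are linear in `‖Q‖`,
one factor of which is cancelled. -/
lemma exists_eLpNorm_le_of_parametrix {Ω U D B : Set E} (hΩ : MeasurableSet Ω)
    (hD : DivParametrix D) {ψ : E → ℝ} (hψ : ContDiff ℝ ∞ ψ) (hψc : HasCompactSupport ψ)
    (hψU : ∀ x ∈ D, ψ x ≠ 0 → x ∈ U) (hB : MeasurableSet B) (hBb : Bornology.IsBounded B)
    (hBD : Ω ∩ B ⊆ D) (hψB : ∀ x ∈ B, ψ x = 1) :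
    ∃ C : ℝ≥0, ∀ p, MemLp p 2 (volume.restrict Ω) → ∀ N M, GradientBound Ω U p N →
      DualBound Ω p M → eLpNorm p 2 (volume.restrict (Ω ∩ B)) ≤ C * (N + M) := by
  have hψL : CompactLipschitz ψ := .of_contDiff (hψ.of_le (by simp)) hψc
  obtain ⟨K, hK⟩ := hψL.exists_lipschitz
  obtain ⟨m, hm0, hm⟩ := hψL.exists_norm_le
  have hdL : CompactLipschitz (fderiv ℝ ψ) :=
    .of_contDiff ((hψ.fderiv_right (m := ∞) (by simp)).of_le (by simp)) (hψc.fderiv (𝕜 := ℝ))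
  obtain ⟨K', hK'⟩ := hdL.exists_lipschitz
  obtain ⟨m', hm'0, hm'⟩ := hdL.exists_norm_le
  lift m to ℝ≥0 using hm0
  lift m' to ℝ≥0 using hm'0
  obtain ⟨C1, hC1⟩ := BoundedOperation.bilin (F := E) (ContinuousLinearMap.lsmul ℝ ℝ) hK hm
  obtain ⟨C2, hC2⟩ := BoundedOperation.bilin (F := E) (ContinuousLinearMap.id ℝ (E →L[ℝ] ℝ)) hK' hm'
  obtain ⟨C3, hC3⟩ := BoundedOperation.bilin (F := ℝ) (ContinuousLinearMap.lsmul ℝ ℝ) hK hm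
  obtain ⟨r, hr⟩ := hBb.exists_norm_le
  obtain ⟨C0, hC0⟩ := hD r
  refine ⟨(C1 + C2 + C3) * C0, fun p hp N M hN hM => ?_⟩
  set Q : E → ℝ := (Ω ∩ B).indicator p with hQ
  have hΩB : MeasurableSet (Ω ∩ B) := hΩ.inter hB
  have hpB : MemLp p 2 (volume.restrict (Ω ∩ B)) :=
    hp.mono_measure (Measure.restrict_mono inter_subset_left le_rfl)
  have hQL : MemLp Q 2 volume := (memLp_indicator_iff_restrict hΩB).2 hpB
  have hQn : eLpNorm Q 2 volume = eLpNorm p 2 (volume.restrict (Ω ∩ B)) :=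
    eLpNorm_indicator_eq_eLpNorm_restrict hΩB
  rw [← hQn]
  set a := eLpNorm Q 2 volume with ha
  have hQD : ∀ x ∉ D, Q x = 0 := fun x hx => indicator_of_notMem (fun h => hx (hBD h)) _
  have hQr : ∀ x, r < ‖x‖ → Q x = 0 := fun x hx =>
    indicator_of_notMem (fun h => hx.not_ge (hr x h.2)) _
  have hsq : a ^ 2 = ‖∫ x in Ω, p x * (ψ x * Q x)‖ₑ := by
    have e1 : ∀ x, p x * (ψ x * Q x) = Q x * Q x := by
      intro x
      by_cases hx : x ∈ Ω ∩ B
      · simp [hQ, hx, hψB x hx.2]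
      · simp [hQ, hx]
    simp only [e1]
    have e2 : ∫ x in Ω, Q x * Q x = ∫ x, Q x * Q x := by
      refine setIntegral_eq_integral_of_forall_compl_eq_zero fun x hx => ?_
      simp [hQ, hx]
    have e3 := ofReal_integral_eq_lintegral_ofReal (f := fun x => Q x * Q x)
      (hQL.integrable_mul hQL) (Eventually.of_forall fun x => mul_self_nonneg (Q x))
    rw [e2, ha, eLpNorm_two_sq, ← ofReal_norm, Real.norm_of_nonneg
      (integral_nonneg fun x => mul_self_nonneg _), e3]
    refine lintegral_congr fun x => ?_
    rw [← pow_two, ← sq_abs, ENNReal.ofReal_pow (abs_nonneg _), ← Real.norm_eq_abs, ofReal_norm]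
  have hmain : ∀ η : ℝ≥0, 0 < η → a ^ 2 ≤ ((C1 + C2 + C3) * C0 : ℝ≥0) * (N + M) * a +
      eLpNorm p 2 (volume.restrict Ω) * m * η := by
    intro η hη
    obtain ⟨V, W, hV, hW, hVD, hWD, he, hb⟩ := hC0 Q hQL hQD hQr η hη
    set e : E → ℝ := fun x => fieldDiv V x + W x - Q x with hedef
    obtain ⟨f1, g1⟩ := hC1 V hV
    obtain ⟨f2, g2⟩ := hC2 V hV
    obtain ⟨f3, g3⟩ := hC3 W hW
    simp only [ContinuousLinearMap.lsmul_apply, ContinuousLinearMap.id_apply] at f1 g1 f2 g2 f3 g3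
    have heL : MemLp e 2 volume := ((memLp_fieldDiv hV).add hW.memLp).sub hQL
    have hψe : MemLp (fun x => ψ x * e x) 2 volume := by
      refine heL.of_le_mul (c := m) (hψ.continuous.aestronglyMeasurable.mul heL.1)
        (Eventually.of_forall fun x => ?_)
      rw [norm_mul]
      exact mul_le_mul_of_nonneg_right (hm x) (norm_nonneg _)
    have hψen : eLpNorm (fun x => ψ x * e x) 2 volume ≤ m * η := by
      refine (eLpNorm_le_nnreal_smul_eLpNorm_of_ae_le_mul (c := m) (g := e)
        (Eventually.of_forall fun x => ?_) 2).trans ?_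
      · rw [← NNReal.coe_le_coe]
        simp only [coe_nnnorm, NNReal.coe_mul, norm_mul]
        exact mul_le_mul_of_nonneg_right (hm x) (norm_nonneg _)
      · rw [ENNReal.smul_def, smul_eq_mul]
        exact mul_le_mul_right he _
    have i1 : Integrable (fun x => p x * fieldDiv (fun x => ψ x • V x) x) (volume.restrict Ω) :=
      hp.integrable_mul ((memLp_fieldDiv f1).restrict _)
    have i2 : Integrable (fun x => p x * fderiv ℝ ψ x (V x)) (volume.restrict Ω) :=
      hp.integrable_mul (f2.memLp.restrict _)
    have i3 : Integrable (fun x => p x * (ψ x • W x)) (volume.restrict Ω) :=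
      hp.integrable_mul (f3.memLp.restrict _)
    have i4 : Integrable (fun x => p x * (ψ x * e x)) (volume.restrict Ω) :=
      hp.integrable_mul (hψe.restrict _)
    have hsplit : ∫ x in Ω, p x * (ψ x * Q x) =
        (∫ x in Ω, p x * fieldDiv (fun x => ψ x • V x) x) - (∫ x in Ω, p x * fderiv ℝ ψ x (V x)) +
        (∫ x in Ω, p x * (ψ x • W x)) - ∫ x in Ω, p x * (ψ x * e x) := by
      refine Eq.trans (integral_congr_ae (ae_restrict_of_ae ?_))
        (integral_sub_add_sub i1 i2 i3 i4)
      filter_upwards [fieldDiv_smul_ae (hψ.differentiable (by simp)) hV] with x hx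
      simp only [hx, hedef, smul_eq_mul]
      ring
    -- The field `V` vanishes off `D`, and the part of `D` seen by `ψ` lies in `U`.
    have hU : ∀ x ∉ U, ψ x • V x = 0 := by
      intro x hx
      by_cases hxD : x ∈ D
      · have : ψ x = 0 := by
          by_contra h
          exact hx (hψU x hxD h)
        simp [this]
      · simp [hVD x hxD]
    have hb1 : sobolevNorm V ≤ C0 * a := le_self_add.trans hb
    have hb2 : sobolevNorm W ≤ C0 * a := le_add_self.trans hb
    have j1 : ‖∫ x in Ω, p x * fieldDiv (fun x => ψ x • V x) x‖ₑ ≤ N * (C1 * (C0 * a)) :=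
      (hN _ f1 hU).trans (mul_le_mul_right (g1.trans (mul_le_mul_right hb1 _)) _)
    have j2 : ‖∫ x in Ω, p x * fderiv ℝ ψ x (V x)‖ₑ ≤ M * (C2 * (C0 * a)) :=
      (hM _ f2).trans (mul_le_mul_right (g2.trans (mul_le_mul_right hb1 _)) _)
    have j3 : ‖∫ x in Ω, p x * (ψ x • W x)‖ₑ ≤ M * (C3 * (C0 * a)) :=
      (hM _ f3).trans (mul_le_mul_right (g3.trans (mul_le_mul_right hb2 _)) _)
    have j4 : ‖∫ x in Ω, p x * (ψ x * e x)‖ₑ ≤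
        eLpNorm p 2 (volume.restrict Ω) * (m * η) := by
      refine (enorm_integral_mul_le hp.1 (hψe.restrict _).1).trans (mul_le_mul_right ?_ _)
      exact (eLpNorm_mono_measure _ Measure.restrict_le_self).trans hψen
    rw [hsq, hsplit]
    refine (enorm_sub_le.trans (add_le_add ((enorm_add_le _ _).trans
      (add_le_add (enorm_sub_le.trans (add_le_add j1 j2)) j3)) j4)).trans ?_
    rw [← mul_assoc (eLpNorm p 2 (volume.restrict Ω))]
    refine add_le_add_left ?_ _
    push_cast
    -- The missing mixed terms are added so that the bound factors through `N + M`.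
    have : (C1 : ℝ≥0∞) * C0 * a * M + (C2 + C3) * C0 * a * N + (N * (C1 * (C0 * a)) +
        M * (C2 * (C0 * a)) + M * (C3 * (C0 * a))) = (C1 + C2 + C3) * C0 * (N + M) * a := by ring
    rw [← this]
    exact le_add_self
  have hfin : eLpNorm p 2 (volume.restrict Ω) * m ≠ ⊤ :=
    ENNReal.mul_ne_top hp.2.ne (by simp)
  -- The constants do not depend on `η`, so the error of the parametrix can be sent to zero.
  have hle := ENNReal.le_of_forall_pos_le_add_mul hfin hmain
  rcases eq_or_ne a 0 with h0 | h0
  · simp [h0]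
  · rw [pow_two] at hle
    exact (ENNReal.mul_le_mul_iff_left h0 hQL.2.ne).1 hle

lemma eLpNorm_union_le {V : Type*} [NormedAddCommGroup V] (f : E → V) (A B : Set E) :
    eLpNorm f 2 (volume.restrict (A ∪ B)) ≤
      eLpNorm f 2 (volume.restrict A) + eLpNorm f 2 (volume.restrict B) := by
  rw [← ENNReal.pow_le_pow_left_iff two_ne_zero, eLpNorm_two_sq]
  refine (lintegral_union_le _ _ _).trans ?_
  rw [← eLpNorm_two_sq, ← eLpNorm_two_sq, add_sq]
  exact add_le_add_left le_self_add _

/-- The domain `Ω` is covered by open sets on which it coincides with sets that have a parametrix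
contained in `U`. -/
def HasLocalParametrix (Ω U : Set E) : Prop :=
  ∀ x ∈ closure Ω, ∃ (r : ℝ) (D : Set E), 0 < r ∧ DivParametrix D ∧ D ∩ Metric.ball x r ⊆ U ∧
    Ω ∩ Metric.ball x r ⊆ D

theorem HasLocalParametrix.exists_eLpNorm_le {Ω U : Set E} (h : HasLocalParametrix Ω U)
    (hΩ : MeasurableSet Ω) (hb : Bornology.IsBounded Ω) :
    ∃ C : ℝ≥0, ∀ p, MemLp p 2 (volume.restrict Ω) → ∀ N M, GradientBound Ω U p N →
      DualBound Ω p M → eLpNorm p 2 (volume.restrict Ω) ≤ C * (N + M) := by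
  suffices ∃ C : ℝ≥0, ∀ p, MemLp p 2 (volume.restrict Ω) → ∀ N M, GradientBound Ω U p N →
      DualBound Ω p M → eLpNorm p 2 (volume.restrict (Ω ∩ closure Ω)) ≤ C * (N + M) by
    rwa [inter_eq_left.2 subset_closure] at this
  -- The estimate passes to subsets and to finite unions, so compactness of the closure reduces it
  -- to small balls.
  refine IsCompact.induction_on (p := fun s => ∃ C : ℝ≥0, ∀ p, MemLp p 2 (volume.restrict Ω) →
    ∀ N M, GradientBound Ω U p N → DualBound Ω p M →
      eLpNorm p 2 (volume.restrict (Ω ∩ s)) ≤ C * (N + M)) hb.isCompact_closure ?_ ?_ ?_ ?_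
  · exact ⟨0, fun p _ N M _ _ => by simp⟩
  · rintro s t hst ⟨C, hC⟩
    refine ⟨C, fun p hp N M hN hM => (eLpNorm_mono_measure _ ?_).trans (hC p hp N M hN hM)⟩
    exact Measure.restrict_mono (inter_subset_inter_right _ hst) le_rfl
  · rintro s t ⟨C, hC⟩ ⟨C', hC'⟩
    refine ⟨C + C', fun p hp N M hN hM => ?_⟩
    rw [inter_union_distrib_left, ENNReal.coe_add, add_mul]
    exact (eLpNorm_union_le _ _ _).trans (add_le_add (hC p hp N M hN hM) (hC' p hp N M hN hM))
  · intro x hx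
    obtain ⟨r, D, hr, hD, hDU, hΩD⟩ := h x hx
    let ψ : ContDiffBump x := ⟨r / 2, r, by positivity, by linarith⟩
    refine ⟨Metric.ball x (r / 2), mem_nhdsWithin_of_mem_nhds (Metric.ball_mem_nhds x (by positivity)),
      exists_eLpNorm_le_of_parametrix hΩ hD (ψ := ψ) ψ.contDiff ψ.hasCompactSupport ?_
      measurableSet_ball Metric.isBounded_ball ?_ ?_⟩
    · intro y hy hψy
      refine hDU ⟨hy, ?_⟩
      have : y ∈ Function.support ψ := hψy
      rwa [ψ.support_eq] at this
    · exact fun y hy => hΩD ⟨hy.1, Metric.ball_subset_ball (by linarith) hy.2⟩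
    · exact fun y hy => ψ.one_of_mem_closedBall (Metric.ball_subset_closedBall hy)

/-- Up to finitely many means, a function is controlled by its gradient in the dual of the fields that
vanish off `U`. -/
theorem HasLocalParametrix.exists_eLpNorm_le_add_sum {Ω U : Set E} (h : HasLocalParametrix Ω U)
    (hΩ : MeasurableSet Ω) (hb : Bornology.IsBounded Ω) :
    ∃ (n : ℕ) (c : Fin n → Set E) (C : ℝ≥0), (∀ i, MeasurableSet (c i)) ∧
      ∀ p, MemLp p 2 (volume.restrict Ω) → ∀ N, GradientBound Ω U p N →
        eLpNorm p 2 (volume.restrict Ω) ≤ C * (N + ∑ i, ‖∫ x in Ω ∩ c i, p x‖ₑ) := by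
  obtain ⟨C, hC⟩ := h.exists_eLpNorm_le hΩ hb
  obtain ⟨n, c, C', hc, hC'⟩ := exists_finite_rank_bound hΩ hb
    -- With this `ε` the term `C ε ‖p‖` is at most half of `‖p‖` and is absorbed on the left.
    (ε := 1 / (2 * (C + 1))) (by positivity)
  refine ⟨n, c, 2 * (C * (1 + C')), hc, fun p hp N hN => ?_⟩
  set S := ∑ i, ‖∫ x in Ω ∩ c i, p x‖ₑ
  set x := eLpNorm p 2 (volume.restrict Ω) with hx
  have h1 := hC p hp N _ hN (hC' p hp)
  have h2 : (C : ℝ≥0∞) * ((1 / (2 * (C + 1)) : ℝ≥0) * x) ≤ x / 2 := by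
    rw [← mul_assoc, ← ENNReal.coe_mul, ENNReal.div_eq_inv_mul]
    refine mul_le_mul_left ?_ _
    have : C * (1 / (2 * (C + 1))) ≤ 2⁻¹ := by
      rw [mul_one_div, div_le_iff₀ (by positivity), ← mul_assoc, inv_mul_cancel₀ two_ne_zero, one_mul]
      exact le_self_add
    calc _ ≤ ((2⁻¹ : ℝ≥0) : ℝ≥0∞) := ENNReal.coe_le_coe.2 this
      _ = _ := by rw [ENNReal.coe_inv two_ne_zero]; rfl
  have h3 : x / 2 + x / 2 ≤ x / 2 + C * (1 + C') * (N + S) := by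
    rw [ENNReal.add_halves]
    refine h1.trans ?_
    have e : (C : ℝ≥0∞) * (N + ((1 / (2 * (C + 1)) : ℝ≥0) * x + C' * S)) =
      C * ((1 / (2 * (C + 1)) : ℝ≥0) * x) + (C * N + C * C' * S) := by ring
    rw [e]
    refine add_le_add h2 ?_
    have e' : (C : ℝ≥0∞) * (1 + C') * (N + S) = C * N + C * C' * S + (C * C' * N + C * S) := by ring
    rw [e']
    exact le_self_add
  have hx2 : x / 2 ≠ ⊤ := ENNReal.div_ne_top hp.2.ne two_ne_zero
  have h4 := (ENNReal.add_le_add_iff_left hx2).1 h3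
  rw [← ENNReal.add_halves x]
  refine (add_le_add h4 h4).trans (le_of_eq ?_)
  push_cast
  ring

end Necas

end Pipe

namespace Pipe

/-! ### Functions with vanishing distributional gradient. -/

section ZeroGradient

open scoped Convolution

variable {E : Type*} [NormedAddCommGroup E] [InnerProductSpace ℝ E] [FiniteDimensional ℝ E]
  [MeasurableSpace E] [BorelSpace E]

/-- Smooth fields with compact support in `U`. -/
structure IsTestField {F : Type*} [NormedAddCommGroup F] [NormedSpace ℝ F] (U : Set E)
    (v : E → F) : Prop where
  contDiff : ContDiff ℝ ∞ v
  hasCompactSupport : HasCompactSupport v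
  tsupport_subset : tsupport v ⊆ U

/-- The distributional gradient of `P` vanishes in `U`. -/
def HasZeroGradient (U : Set E) (P : E → ℝ) : Prop :=
  ∀ v : E → E, IsTestField U v → ∫ x, P x * fieldDiv v x = 0

/-- The derivative falls on the mollifier, and `t ↦ ρ (x - t) e` is a test field whose divergence
is, up to sign, the kernel of the derivative in the direction `e`. -/
lemma HasZeroGradient.hasFDerivAt_convolution {U : Set E} {P : E → ℝ} (h : HasZeroGradient U P)
    (hP : LocallyIntegrable P volume) (φ : ContDiffBump (0 : E)) {x : E}
    (hx : Metric.closedBall x φ.rOut ⊆ U) :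
    HasFDerivAt (φ.normed volume ⋆[ContinuousLinearMap.lsmul ℝ ℝ, volume] P) (0 : E →L[ℝ] ℝ) x := by
  set ρ := φ.normed (volume : Measure E) with hρ
  have hρd : ContDiff ℝ ∞ ρ := φ.contDiff_normed
  have hρc : HasCompactSupport ρ := φ.hasCompactSupport_normed
  have hd := hρc.hasFDerivAt_convolution_left (ContinuousLinearMap.lsmul ℝ ℝ)
    (hρd.of_le (by simp)) hP x
  have hex : ConvolutionExistsAt (fderiv ℝ ρ) P x
      ((ContinuousLinearMap.lsmul ℝ ℝ : ℝ →L[ℝ] ℝ →L[ℝ] ℝ).precompL E) volume :=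
    (hρc.fderiv (𝕜 := ℝ)).convolutionExists_left _
      (hρd.continuous_fderiv (by simp)) hP x
  have hint := hex.integrable_swap
  suffices key : (fderiv ℝ ρ ⋆[(ContinuousLinearMap.lsmul ℝ ℝ : ℝ →L[ℝ] ℝ →L[ℝ] ℝ).precompL E, volume]
      P) x = 0 by
    rwa [key] at hd
  ext e
  rw [convolution_eq_swap, ContinuousLinearMap.integral_apply hint]
  have hsub : ∀ t, HasFDerivAt (fun t : E => x - t) (-ContinuousLinearMap.id ℝ E) t := fun t =>
    (hasFDerivAt_id t).const_sub x
  have hv : IsTestField U (fun t => ρ (x - t) • e) := by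
    have hsupp : tsupport (fun t => ρ (x - t) • e) ⊆ Metric.closedBall x φ.rOut := by
      refine closure_minimal (fun t ht => ?_) Metric.isClosed_closedBall
      have h1 : ρ (x - t) ≠ 0 := fun h0 => ht (by simp [h0])
      have h2 : x - t ∈ Function.support ρ := h1
      rw [φ.support_normed_eq, mem_ball_zero_iff] at h2
      rw [Metric.mem_closedBall, dist_comm, dist_eq_norm]
      exact h2.le
    exact ⟨(hρd.comp (contDiff_const.sub contDiff_id)).smul contDiff_const,
      HasCompactSupport.of_support_subset_isCompact (isCompact_closedBall x φ.rOut)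
        ((subset_tsupport _).trans hsupp), hsupp.trans hx⟩
  have hdiv : ∀ t, fieldDiv (fun t => ρ (x - t) • e) t = -fderiv ℝ ρ (x - t) e := by
    intro t
    have h1 : HasFDerivAt (fun t => ρ (x - t) • e)
        (((fderiv ℝ ρ (x - t)).comp (-ContinuousLinearMap.id ℝ E)).smulRight e) t :=
      (((hρd.differentiable (by simp)) (x - t)).hasFDerivAt.comp t (hsub t)).smul_const e
    rw [fieldDiv_eq]
    simp only [h1.fderiv, traceCLM_smulRight]
    simp
  have := h _ hv
  simp only [hdiv, mul_neg, integral_neg, neg_eq_zero] at this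
  rw [zero_apply, ← this]
  refine integral_congr_ae (Eventually.of_forall fun t => ?_)
  simp [mul_comm]

/-- The mollifications are constant on the ball and converge to `P` almost everywhere. The double
radius leaves room for the mollifiers. -/
lemma HasZeroGradient.exists_ae_eq_const {U : Set E} {P : E → ℝ} (h : HasZeroGradient U P)
    (hP : LocallyIntegrable P volume) {x : E} {r : ℝ} (hr : 0 < r) (hU : Metric.ball x (2 * r) ⊆ U) :
    ∃ c, ∀ᵐ y ∂(volume.restrict (Metric.ball x r)), P y = c := by
  let φ : ℕ → ContDiffBump (0 : E) := fun k =>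
    ⟨r / 2 / (k + 1), r / (k + 1), by positivity, by
      gcongr; linarith⟩
  have hφ0 : Tendsto (fun k => (φ k).rOut) atTop (𝓝 0) :=
    tendsto_const_div_atTop_nhds_zero_nat r |>.comp (tendsto_add_atTop_nat 1) |>.congr
      fun k => by simp [φ]
  have hconv := ContDiffBump.ae_convolution_tendsto_right_of_locallyIntegrable (μ := volume)
    (φ := φ) (l := atTop) (K := 2) hφ0 (Eventually.of_forall fun k => by
      simp only [φ]; apply le_of_eq; ring) hP
  have hconst : ∀ k, ∀ y ∈ Metric.ball x r,
      ((φ k).normed volume ⋆[ContinuousLinearMap.lsmul ℝ ℝ, volume] P) y =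
      ((φ k).normed volume ⋆[ContinuousLinearMap.lsmul ℝ ℝ, volume] P) x := by
    intro k y hy
    have hd : ∀ z ∈ Metric.ball x r, HasFDerivAt
        ((φ k).normed volume ⋆[ContinuousLinearMap.lsmul ℝ ℝ, volume] P) (0 : E →L[ℝ] ℝ) z := by
      intro z hz
      refine h.hasFDerivAt_convolution hP (φ k) ((Metric.closedBall_subset_ball' ?_).trans hU)
      have h1 : (φ k).rOut ≤ r := div_le_self hr.le (by simp)
      have := Metric.mem_ball.1 hz
      linarith
    refine Metric.isOpen_ball.is_const_of_fderiv_eq_zero (𝕜 := ℝ)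
      (convex_ball x r).isPreconnected
      (fun z hz => (hd z hz).differentiableAt.differentiableWithinAt)
      (fun z hz => (hd z hz).fderiv) hy (Metric.mem_ball_self hr)
  have hconv' := ae_restrict_of_ae (s := Metric.ball x r) hconv
  have hmem := ae_restrict_mem (μ := volume) (measurableSet_ball (x := x) (ε := r))
  -- One point of convergence in the ball fixes the constant; in its absence the almost everywhere
  -- statement is vacuous.
  by_cases hex : ∃ y ∈ Metric.ball x r, Tendsto (fun k =>
      ((φ k).normed volume ⋆[ContinuousLinearMap.lsmul ℝ ℝ, volume] P) y) atTop (𝓝 (P y))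
  · obtain ⟨y, hy, hyt⟩ := hex
    refine ⟨P y, ?_⟩
    filter_upwards [hconv', hmem] with z hz hzm
    refine tendsto_nhds_unique hz (hyt.congr fun k => ?_)
    rw [hconst k y hy, hconst k z hzm]
  · refine ⟨0, ?_⟩
    filter_upwards [hconv', hmem] with z hz hzm
    exact absurd ⟨z, hzm, hz⟩ hex

lemma eq_of_ae_restrict_eq_const {P : E → ℝ} {A B : Set E} (hA : IsOpen A) (hB : IsOpen B)
    (hne : (A ∩ B).Nonempty) {a b : ℝ} (ha : ∀ᵐ y ∂(volume.restrict A), P y = a)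
    (hb : ∀ᵐ y ∂(volume.restrict B), P y = b) : a = b := by
  have h1 := ae_restrict_of_ae_restrict_of_subset (inter_subset_left (s := A) (t := B)) ha
  have h2 := ae_restrict_of_ae_restrict_of_subset (inter_subset_right (s := A) (t := B)) hb
  have : NeBot (ae ((volume : Measure E).restrict (A ∩ B))) := by
    rw [ae_neBot, Ne, Measure.restrict_eq_zero]
    exact ((hA.inter hB).measure_pos volume hne).ne'
  obtain ⟨y, hy1, hy2⟩ := (h1.and h2).exists
  rw [← hy1, hy2]

/-- A function supported in a connected set whose gradient vanishes in a neighborhood reaching out of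
the set vanishes. -/
theorem HasZeroGradient.ae_eq_zero {Ω U : Set E} {P : E → ℝ} (h : HasZeroGradient U P)
    (hP : LocallyIntegrable P volume) (hU : IsOpen U) (hΩU : Ω ⊆ U) (hΩ : IsPreconnected Ω)
    (hP0 : ∀ x ∉ Ω, P x = 0) {z : E} (hzU : z ∈ U) (hz : z ∈ closure Ω)
    (hz' : z ∈ closure (closure Ω)ᶜ) : P =ᵐ[volume] 0 := by
  have hloc : ∀ x ∈ U, ∃ r > 0, ∃ c, ∀ᵐ y ∂(volume.restrict (Metric.ball x r)), P y = c := by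
    intro x hx
    obtain ⟨r, hr, hrU⟩ := Metric.isOpen_iff.1 hU x hx
    refine ⟨r / 2, by positivity, h.exists_ae_eq_const hP (by positivity) ?_⟩
    rwa [mul_div_cancel₀ r two_ne_zero]
  let A : Set E := {x | ∃ V, IsOpen V ∧ x ∈ V ∧ ∀ᵐ y ∂(volume.restrict V), P y = 0}
  have hA : IsOpen A := by
    rw [isOpen_iff_forall_mem_open]
    rintro x ⟨V, hV, hxV, hVP⟩
    exact ⟨V, fun y hy => ⟨V, hV, hy, hVP⟩, hV, hxV⟩
  have hout : ∀ᵐ y ∂(volume.restrict (closure Ω)ᶜ), P y = 0 := by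
    filter_upwards [ae_restrict_mem isClosed_closure.measurableSet.compl] with y hy
    exact hP0 y fun hyΩ => hy (subset_closure hyΩ)
  -- The set `A`, where `P` vanishes locally, is open, and closed relative to `Ω` because `P` is
  -- locally constant. It meets `Ω` near `z`: a ball around `z` also meets the exterior, so the
  -- constant there is zero.
  have hsub : Ω ⊆ A := by
    refine hΩ.subset_of_closure_inter_subset hA ?_ ?_
    · obtain ⟨r, hr, c, hc⟩ := hloc z hzU
      obtain ⟨y, hy⟩ := mem_closure_iff.1 hz' _ Metric.isOpen_ball (Metric.mem_ball_self hr)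
      have : c = 0 := eq_of_ae_restrict_eq_const Metric.isOpen_ball
        isClosed_closure.isOpen_compl ⟨y, hy⟩ hc hout
      obtain ⟨w, hw, hwΩ⟩ := mem_closure_iff.1 hz _ Metric.isOpen_ball (Metric.mem_ball_self hr)
      exact ⟨w, hwΩ, _, Metric.isOpen_ball, hw, this ▸ hc⟩
    · rintro x ⟨hxA, hxΩ⟩
      obtain ⟨r, hr, c, hc⟩ := hloc x (hΩU hxΩ)
      obtain ⟨y, hy, V, hV, hyV, hVP⟩ :=
        mem_closure_iff.1 hxA _ Metric.isOpen_ball (Metric.mem_ball_self hr)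
      have : c = 0 := eq_of_ae_restrict_eq_const Metric.isOpen_ball hV ⟨y, hy, hyV⟩ hc hVP
      exact ⟨_, Metric.isOpen_ball, Metric.mem_ball_self hr, this ▸ hc⟩
  refine measure_null_of_locally_null _ fun x hx => ?_
  have hxΩ : x ∈ Ω := by
    by_contra hxΩ
    exact hx (hP0 x hxΩ)
  obtain ⟨V, hV, hxV, hVP⟩ := hsub hxΩ
  refine ⟨V ∩ {y | P y ≠ 0}, inter_mem (mem_nhdsWithin_of_mem_nhds (hV.mem_nhds hxV))
    self_mem_nhdsWithin, ?_⟩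
  have := ae_iff.1 hVP
  rwa [Measure.restrict_apply' hV.measurableSet, inter_comm] at this

end ZeroGradient

/-! ### Functional analysis: lower bounds and surjectivity. -/

section ClosedRange

/-- An injective operator that is bounded below up to a finite rank operator is bounded below. -/
lemma exists_bound_of_finite_rank {X Y Z : Type*} [NormedAddCommGroup X] [NormedSpace ℝ X]
    [CompleteSpace X] [NormedAddCommGroup Y] [NormedSpace ℝ Y] [NormedAddCommGroup Z]
    [NormedSpace ℝ Z] [FiniteDimensional ℝ Z] (T : X →L[ℝ] Y) (F : X →L[ℝ] Z) {C : ℝ}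
    (hC : ∀ x, ‖x‖ ≤ C * (‖T x‖ + ‖F x‖)) (hT : ∀ x, T x = 0 → x = 0) :
    ∃ c > 0, ∀ x, c * ‖x‖ ≤ ‖T x‖ := by
  by_contra! hno
  have h1 : ∀ k : ℕ, ∃ x, ‖x‖ = 1 ∧ ‖T x‖ < 1 / (k + 1) := by
    intro k
    obtain ⟨x, hx⟩ := hno (1 / (k + 1)) (by positivity)
    have hx0 : 0 < ‖x‖ := by
      rw [norm_pos_iff]
      rintro rfl
      simp at hx
    refine ⟨‖x‖⁻¹ • x, ?_, ?_⟩
    · rw [norm_smul, norm_inv, norm_norm, inv_mul_cancel₀ hx0.ne']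
    · rw [map_smul, norm_smul, norm_inv, norm_norm, inv_mul_lt_iff₀ hx0, mul_comm]
      exact hx
  choose x hx1 hxT using h1
  have hbdd : ∀ k, F (x k) ∈ Metric.closedBall (0 : Z) ‖F‖ := fun k => by
    have := F.le_opNorm (x k)
    simpa [hx1 k] using this
  have : ProperSpace Z := FiniteDimensional.proper_real Z
  obtain ⟨a, -, s, hs, ha⟩ := (isCompact_closedBall (0 : Z) ‖F‖).tendsto_subseq hbdd
  have hT0 : Tendsto (fun k => T (x k)) atTop (𝓝 0) :=
    squeeze_zero_norm (fun k => (hxT k).le) tendsto_one_div_add_atTop_nhds_zero_nat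
  have hc1 := (hT0.comp hs.tendsto_atTop).cauchySeq
  have hc2 := ha.cauchySeq
  -- The images under `T` tend to zero and those under `F` converge along a subsequence; by `hC`,
  -- applied to differences, the vectors themselves are Cauchy. Their limit is a unit vector in the
  -- kernel of `T`.
  have hcauchy : CauchySeq (x ∘ s) := by
    rw [Metric.cauchySeq_iff']
    intro ε hε
    have hC1 : 0 < |C| + 1 := by positivity
    have hε2 : 0 < ε / (2 * (|C| + 1)) := by positivity
    obtain ⟨N1, hN1⟩ := Metric.cauchySeq_iff.1 hc1 _ hε2
    obtain ⟨N2, hN2⟩ := Metric.cauchySeq_iff.1 hc2 _ hε2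
    refine ⟨max N1 N2, fun k hk => ?_⟩
    have e1 := hN1 k ((le_max_left _ _).trans hk) (max N1 N2) (le_max_left _ _)
    have e2 := hN2 k ((le_max_right _ _).trans hk) (max N1 N2) (le_max_right _ _)
    have e3 := hC (x (s k) - x (s (max N1 N2)))
    rw [map_sub, map_sub] at e3
    simp only [Function.comp_apply, dist_eq_norm] at e1 e2 ⊢
    have e4 : C * (‖T (x (s k)) - T (x (s (max N1 N2)))‖ + ‖F (x (s k)) - F (x (s (max N1 N2)))‖) ≤
        (|C| + 1) * (‖T (x (s k)) - T (x (s (max N1 N2)))‖ +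
          ‖F (x (s k)) - F (x (s (max N1 N2)))‖) := by
      gcongr
      linarith [le_abs_self C]
    have e5 : (|C| + 1) * (ε / (2 * (|C| + 1)) + ε / (2 * (|C| + 1))) = ε := by
      field_simp
      ring
    calc _ ≤ _ := e3.trans e4
      _ < (|C| + 1) * (ε / (2 * (|C| + 1)) + ε / (2 * (|C| + 1))) := by gcongr
      _ = ε := e5
  obtain ⟨y, hy⟩ := cauchySeq_tendsto_of_complete hcauchy
  have hy1 : ‖y‖ = 1 := by
    refine tendsto_nhds_unique hy.norm ?_
    simp [hx1]
  have hyT : T y = 0 :=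
    tendsto_nhds_unique ((T.continuous.tendsto y).comp hy) (hT0.comp hs.tendsto_atTop)
  rw [hT y hyT, norm_zero] at hy1
  exact zero_ne_one hy1

open ContinuousLinearMap in
/-- An operator between Hilbert spaces with adjoint bounded below is surjective. -/
lemma surjective_of_adjoint_bounded_below {X Y : Type*} [NormedAddCommGroup X]
    [InnerProductSpace ℝ X] [CompleteSpace X] [NormedAddCommGroup Y] [InnerProductSpace ℝ Y]
    [CompleteSpace Y] (D : X →L[ℝ] Y) {c : ℝ} (hc : 0 < c)
    (h : ∀ y, c * ‖y‖ ≤ ‖adjoint D y‖) : Function.Surjective D := by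
  -- The form of `D D*` is coercive since `⟨D D* y, y⟩ = ‖D* y‖²`. By Lax–Milgram `D D*` is onto,
  -- hence so is `D`.
  let B : Y →L[ℝ] Y →L[ℝ] ℝ := (innerSL ℝ).comp (D ∘L adjoint D)
  have hB : IsCoercive B := by
    refine ⟨c ^ 2, by positivity, fun y => ?_⟩
    have : B y y = ‖adjoint D y‖ ^ 2 := by
      simp only [B, comp_apply, innerSL_apply_apply]
      rw [← adjoint_inner_right, real_inner_self_eq_norm_sq]
    rw [this]
    nlinarith [h y, norm_nonneg y, mul_nonneg hc.le (norm_nonneg y)]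
  intro y
  obtain ⟨w, hw⟩ := hB.continuousLinearEquivOfBilin.surjective y
  refine ⟨adjoint D w, ext_inner_right ℝ fun z => ?_⟩
  rw [← hw, hB.continuousLinearEquivOfBilin_apply]
  simp [B]

end ClosedRange

end Pipe

namespace Pipe

/-! ### From test fields to Lipschitz fields. -/

section TestBound

variable {E : Type*} [NormedAddCommGroup E] [InnerProductSpace ℝ E] [FiniteDimensional ℝ E]
  [MeasurableSpace E] [BorelSpace E]

/-- The Hilbert space of the problem sees test fields and their norms on `Ω`, whereas the parametrix
produces Lipschitz fields on the whole space. Density of test fields bridges the gap. -/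
lemma gradientBound_of_isTestField {Ω U : Set E} (hU : IsOpen U) (hΩU : Ω ⊆ U) {p : E → ℝ}
    (hp : MemLp p 2 (volume.restrict Ω)) {N : ℝ≥0∞} (hN : N ≠ ⊤)
    (h : ∀ v : E → E, IsTestField U v → ‖∫ x in Ω, p x * fieldDiv v x‖ₑ ≤
      N * (eLpNorm v 2 (volume.restrict Ω) +
        eLpNorm (fun x => ‖fderiv ℝ v x‖) 2 (volume.restrict Ω))) :
    GradientBound Ω U p N := by
  intro v hv hv0
  have hfin : N * 2 + eLpNorm p 2 (volume.restrict Ω) * ‖traceCLM E‖ₑ ≠ ⊤ :=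
    ENNReal.add_ne_top.2 ⟨ENNReal.mul_ne_top hN (by simp), ENNReal.mul_ne_top hp.2.ne (by simp)⟩
  refine ENNReal.le_of_forall_pos_le_add_mul hfin fun η hη => ?_
  obtain ⟨w, hw, hwc, hwU, e1, e2⟩ := exists_contDiff_approx hv hU hv0 (ε := η)
    (by exact_mod_cast hη)
  have hμ : (volume : Measure E).restrict Ω ≤ volume.restrict U := Measure.restrict_mono hΩU le_rfl
  replace e1 := (eLpNorm_mono_measure _ hμ).trans e1
  replace e2 := (eLpNorm_mono_measure _ hμ).trans e2
  have hwL := CompactLipschitz.of_contDiff (hw.of_le (by simp)) hwc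
  have i1 : Integrable (fun x => p x * fieldDiv w x) (volume.restrict Ω) :=
    hp.integrable_mul ((memLp_fieldDiv hwL).restrict _)
  have i2 : Integrable (fun x => p x * (fieldDiv w x - fieldDiv v x)) (volume.restrict Ω) :=
    hp.integrable_mul (((memLp_fieldDiv hwL).sub (memLp_fieldDiv hv)).restrict _)
  have hsplit : ∫ x in Ω, p x * fieldDiv v x =
      (∫ x in Ω, p x * fieldDiv w x) - ∫ x in Ω, p x * (fieldDiv w x - fieldDiv v x) := by
    rw [← integral_sub i1 i2]
    refine integral_congr_ae (Eventually.of_forall fun x => ?_)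
    simp only
    ring
  have f1 : eLpNorm w 2 (volume.restrict Ω) ≤ eLpNorm v 2 (volume.restrict Ω) + η := by
    have : w = v + (w - v) := by abel
    rw [this]
    refine (eLpNorm_add_le (hv.aestronglyMeasurable _) ((hwL.aestronglyMeasurable _).sub
      (hv.aestronglyMeasurable _)) (by norm_num)).trans (add_le_add_right ?_ _)
    rwa [eLpNorm_norm] at e1
  have f2 : eLpNorm (fun x => ‖fderiv ℝ w x‖) 2 (volume.restrict Ω) ≤
      eLpNorm (fun x => ‖fderiv ℝ v x‖) 2 (volume.restrict Ω) + η := by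
    refine (eLpNorm_mono_ae (g := (fun x => ‖fderiv ℝ v x‖) +
      fun x => ‖fderiv ℝ w x - fderiv ℝ v x‖) (Eventually.of_forall fun x => ?_)).trans
      ((eLpNorm_add_le (aestronglyMeasurable_norm_fderiv v _)
        (((measurable_fderiv ℝ w).sub (measurable_fderiv ℝ v)).norm.aestronglyMeasurable)
        (by norm_num)).trans (add_le_add_right e2 _))
    rw [norm_norm, Pi.add_apply,
      Real.norm_of_nonneg (add_nonneg (norm_nonneg _) (norm_nonneg _))]
    exact norm_le_norm_add_norm_sub' _ _
  have f3 : eLpNorm (fun x => fieldDiv w x - fieldDiv v x) 2 (volume.restrict Ω) ≤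
      ‖traceCLM E‖ₑ * η := by
    refine (eLpNorm_le_nnreal_smul_eLpNorm_of_ae_le_mul (c := ‖traceCLM E‖₊)
      (g := fun x => fderiv ℝ w x - fderiv ℝ v x) (Eventually.of_forall fun x => ?_) 2).trans ?_
    · rw [fieldDiv_eq, fieldDiv_eq]
      simp only
      rw [← map_sub]
      exact (traceCLM E).le_opNNNorm _
    · rw [eLpNorm_norm] at e2
      exact mul_le_mul_right e2 _
  have f4 := (enorm_integral_mul_le hp.1
    ((memLp_fieldDiv hwL).sub (memLp_fieldDiv hv)).1.restrict).trans (mul_le_mul_right f3 _)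
  have f5 := (h w ⟨hw, hwc, hwU⟩).trans (mul_le_mul_right (add_le_add f1 f2) _)
  have f6 : eLpNorm v 2 (volume.restrict Ω) +
      eLpNorm (fun x => ‖fderiv ℝ v x‖) 2 (volume.restrict Ω) ≤ sobolevNorm v :=
    add_le_add (eLpNorm_mono_measure _ Measure.restrict_le_self)
      (eLpNorm_mono_measure _ Measure.restrict_le_self)
  rw [hsplit]
  refine (enorm_sub_le.trans (add_le_add f5 f4)).trans ?_
  calc _ = N * (eLpNorm v 2 (volume.restrict Ω) +
        eLpNorm (fun x => ‖fderiv ℝ v x‖) 2 (volume.restrict Ω)) +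
        (N * 2 + eLpNorm p 2 (volume.restrict Ω) * ‖traceCLM E‖ₑ) * η := by ring
    _ ≤ _ := add_le_add_left (mul_le_mul_right f6 _) _

end TestBound

/-! ### The divergence operator on the closure of the test fields. -/

section Solve

variable {n : ℕ}

/-- The matrix of an endomorphism, as a continuous linear map. -/
noncomputable def gradCLM (n : ℕ) : (E n →L[ℝ] E n) →L[ℝ] Mat n :=
  LinearMap.toContinuousLinearMap
    { toFun := fun A => WithLp.toLp 2 fun p => A (EuclideanSpace.single p.2 1) p.1
      map_add' := fun A B => by ext p; simp
      map_smul' := fun c A => by ext p; simp }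

lemma classicalGradient_eq (u : E n → E n) (x : E n) :
    classicalGradient u x = gradCLM n (fderiv ℝ u x) := rfl

/-- The trace of a matrix, as a continuous linear functional. -/
noncomputable def divCLM (n : ℕ) : Mat n →L[ℝ] ℝ := ∑ i : Fin n, EuclideanSpace.proj (i, i)

lemma divCLM_apply (G : Mat n) : divCLM n G = ∑ i, G (i, i) := by
  simp [divCLM]

lemma divCLM_classicalGradient (u : E n → E n) (x : E n) :
    divCLM n (classicalGradient u x) = fieldDiv u x := by
  rw [fieldDiv, LinearMap.trace_eq_sum_inner _ (EuclideanSpace.basisFun (Fin n) ℝ), divCLM_apply]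
  refine Finset.sum_congr rfl fun i _ => ?_
  simp [classicalGradient, EuclideanSpace.inner_single_left]

lemma IsTestField.memLp {U : Set (E n)} {v : E n → E n} (hv : IsTestField U v)
    (μ : Measure (E n)) [IsFiniteMeasureOnCompacts μ] : MemLp v 2 μ :=
  hv.contDiff.continuous.memLp_of_hasCompactSupport hv.hasCompactSupport

lemma IsTestField.continuous_classicalGradient {U : Set (E n)} {v : E n → E n}
    (hv : IsTestField U v) : Continuous (classicalGradient v) :=
  (gradCLM n).continuous.comp (hv.contDiff.continuous_fderiv (by simp))

lemma IsTestField.memLp_classicalGradient {U : Set (E n)} {v : E n → E n} (hv : IsTestField U v)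
    (μ : Measure (E n)) [IsFiniteMeasureOnCompacts μ] : MemLp (classicalGradient v) 2 μ :=
  hv.continuous_classicalGradient.memLp_of_hasCompactSupport
    ((hv.hasCompactSupport.fderiv (𝕜 := ℝ)).comp_left (map_zero (gradCLM n)))

/-- Pairs of square integrable fields and matrix fields. -/
abbrev FieldPair (Ω : Set (E n)) : Type :=
  WithLp 2 (Lp (E n) 2 (volume.restrict Ω) × Lp (Mat n) 2 (volume.restrict Ω))

/-- The pair of a test field and its gradient. -/
noncomputable def IsTestField.pair {U : Set (E n)} {v : E n → E n} (hv : IsTestField U v)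
    (Ω : Set (E n)) : FieldPair Ω :=
  WithLp.toLp 2 ((hv.memLp (volume.restrict Ω)).toLp, (hv.memLp_classicalGradient _).toLp)

/-- The pairs formed by a test field and its gradient. -/
noncomputable def testPairs (Ω U : Set (E n)) : Submodule ℝ (FieldPair Ω) where
  carrier := {z | ∃ u, IsTestField U u ∧ z.fst =ᵐ[volume.restrict Ω] u ∧
    z.snd =ᵐ[volume.restrict Ω] classicalGradient u}
  zero_mem' := by
    refine ⟨0, ⟨contDiff_const, HasCompactSupport.zero, by simp⟩, Lp.coeFn_zero _ _ _, ?_⟩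
    filter_upwards [Lp.coeFn_zero (Mat n) 2 (volume.restrict Ω)] with x hx
    refine hx.trans ?_
    simp [classicalGradient_eq]
  add_mem' := by
    rintro z w ⟨u, hu, hz1, hz2⟩ ⟨v, hv, hw1, hw2⟩
    refine ⟨u + v, ⟨hu.contDiff.add hv.contDiff, hu.hasCompactSupport.add hv.hasCompactSupport,
      (tsupport_add u v).trans (union_subset hu.tsupport_subset hv.tsupport_subset)⟩,
      (Lp.coeFn_add _ _).trans (hz1.add hw1), (Lp.coeFn_add _ _).trans ((hz2.add hw2).trans ?_)⟩
    refine Eventually.of_forall fun x => ?_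
    simp only [Pi.add_apply, classicalGradient_eq]
    rw [fderiv_add (hu.contDiff.differentiable (by simp) x)
      (hv.contDiff.differentiable (by simp) x), map_add]
  smul_mem' := by
    rintro c z ⟨u, hu, hz1, hz2⟩
    refine ⟨c • u, ⟨contDiff_const.smul hu.contDiff, hu.hasCompactSupport.smul_left,
      (tsupport_smul_subset_right (fun _ => c) u).trans hu.tsupport_subset⟩,
      (Lp.coeFn_smul _ _).trans (hz1.const_smul c),
      (Lp.coeFn_smul _ _).trans ((hz2.const_smul c).trans ?_)⟩
    refine Eventually.of_forall fun x => ?_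
    simp only [Pi.smul_apply, classicalGradient_eq]
    rw [fderiv_const_smul (hu.contDiff.differentiable (by simp) x), map_smul]

lemma IsTestField.pair_mem {U : Set (E n)} {v : E n → E n} (hv : IsTestField U v) (Ω : Set (E n)) :
    hv.pair Ω ∈ testPairs Ω U :=
  ⟨v, hv, (hv.memLp (volume.restrict Ω)).coeFn_toLp,
    (hv.memLp_classicalGradient (volume.restrict Ω)).coeFn_toLp⟩

lemma exists_seq_of_mem_closure {Ω U : Set (E n)} {z : FieldPair Ω}
    (hz : z ∈ (testPairs Ω U).topologicalClosure) : ∃ u : ℕ → E n → E n,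
      (∀ k, IsTestField U (u k)) ∧
      Tendsto (fun k => eLpNorm (u k - ⇑z.fst) 2 (volume.restrict Ω)) atTop (𝓝 0) ∧
      Tendsto (fun k => eLpNorm (classicalGradient (u k) - ⇑z.snd) 2 (volume.restrict Ω))
        atTop (𝓝 0) := by
  obtain ⟨w, hw, hwz⟩ := mem_closure_iff_seq_limit.1 hz
  choose u hu h1 h2 using hw
  refine ⟨u, hu, ?_, ?_⟩
  · have h : Tendsto (fun k => (w k).fst) atTop (𝓝 z.fst) :=
      ((WithLp.fstL 2 ℝ _ _).continuous.tendsto z).comp hwz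
    refine ((Lp.tendsto_Lp_iff_tendsto_eLpNorm' _ _).1 h).congr fun k => eLpNorm_congr_ae ((h1 k).sub (ae_eq_refl _))
  · have h : Tendsto (fun k => (w k).snd) atTop (𝓝 z.snd) :=
      ((WithLp.sndL 2 ℝ _ _).continuous.tendsto z).comp hwz
    refine ((Lp.tendsto_Lp_iff_tendsto_eLpNorm' _ _).1 h).congr fun k => eLpNorm_congr_ae ((h2 k).sub (ae_eq_refl _))

lemma memLp_smul_single {ι : Type*} [Fintype ι] [DecidableEq ι] {g : E n → ℝ} (hg : Continuous g)
    (hc : HasCompactSupport g) (i : ι) (μ : Measure (E n)) [IsFiniteMeasureOnCompacts μ] :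
    MemLp (fun x => g x • EuclideanSpace.single i (1 : ℝ)) 2 μ :=
  (hg.smul continuous_const).memLp_of_hasCompactSupport hc.smul_right

lemma inner_toLp_smul_single {ι : Type*} [Fintype ι] [DecidableEq ι] {g : E n → ℝ}
    {i : ι} {μ : Measure (E n)} (hg : MemLp (fun x => g x • EuclideanSpace.single i (1 : ℝ)) 2 μ)
    (f : Lp (EuclideanSpace ℝ ι) 2 μ) : inner ℝ hg.toLp f = ∫ x, f x i * g x ∂μ := by
  rw [L2.inner_def]
  refine integral_congr_ae ?_
  filter_upwards [hg.coeFn_toLp] with x hx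
  rw [hx, real_inner_smul_left, EuclideanSpace.inner_single_left]
  simp [mul_comm]

lemma integral_classicalGradient {U Ω : Set (E n)} {u : E n → E n} (hu : IsTestField U u)
    {φ : E n → ℝ} (hφ : ContDiff ℝ ∞ φ) (hφc : HasCompactSupport φ) (hφΩ : tsupport φ ⊆ Ω)
    (i j : Fin n) : ∫ x in Ω, u x i * fderiv ℝ φ x (EuclideanSpace.single j 1) =
      -∫ x in Ω, classicalGradient u x (i, j) * φ x := by
  have hdu := hu.contDiff.differentiable (by simp)
  have hui : ∀ x, HasFDerivAt (fun x => u x i)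
      ((EuclideanSpace.proj i : E n →L[ℝ] ℝ).comp (fderiv ℝ u x)) x := fun x =>
    (EuclideanSpace.proj i : E n →L[ℝ] ℝ).hasFDerivAt.comp x (hdu x).hasFDerivAt
  have hcu : Continuous fun x => u x i :=
    (EuclideanSpace.proj i : E n →L[ℝ] ℝ).continuous.comp hu.contDiff.continuous
  have hcdφ : Continuous fun x => fderiv ℝ φ x (EuclideanSpace.single j 1) :=
    (hφ.continuous_fderiv (by simp)).clm_apply continuous_const
  have hcdu : Continuous fun x => fderiv ℝ (fun x => u x i) x (EuclideanSpace.single j 1) := by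
    have : (fun x => fderiv ℝ (fun x => u x i) x (EuclideanSpace.single j 1)) =
        fun x => (EuclideanSpace.proj i : E n →L[ℝ] ℝ)
          (fderiv ℝ u x (EuclideanSpace.single j 1)) := by
      funext x
      rw [(hui x).fderiv]
      rfl
    rw [this]
    exact (EuclideanSpace.proj i : E n →L[ℝ] ℝ).continuous.comp
      ((hu.contDiff.continuous_fderiv (by simp)).clm_apply continuous_const)
  have hφ0 : ∀ x ∉ Ω, φ x = 0 := fun x hx => image_eq_zero_of_notMem_tsupport fun h => hx (hφΩ h)
  have hdφ0 : ∀ x ∉ Ω, fderiv ℝ φ x = 0 := fun x hx => by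
    have := (tsupport_fderiv_subset ℝ (f := φ)).trans hφΩ
    exact image_eq_zero_of_notMem_tsupport fun h => hx (this h)
  have key := integral_mul_fderiv_eq_neg_fderiv_mul_of_integrable (μ := (volume : Measure (E n)))
    (f := fun x => u x i) (g := φ) (v := EuclideanSpace.single j 1)
    ((hcdu.mul hφ.continuous).integrable_of_hasCompactSupport hφc.mul_left)
    ((hcu.mul hcdφ).integrable_of_hasCompactSupport
      ((hφc.fderiv_apply (𝕜 := ℝ) _).mul_left))
    ((hcu.mul hφ.continuous).integrable_of_hasCompactSupport hφc.mul_left)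
    (fun x _ => (hui x).differentiableAt) (fun x _ => hφ.differentiable (by simp) x)
  rw [setIntegral_eq_integral_of_forall_compl_eq_zero fun x hx => by simp [hdφ0 x hx],
    setIntegral_eq_integral_of_forall_compl_eq_zero fun x hx => by simp [hφ0 x hx], key]
  congr 1
  refine integral_congr_ae (Eventually.of_forall fun x => ?_)
  simp only [(hui x).fderiv]
  rfl

/-- For a fixed test function, integration by parts is a linear equation between `L²` inner
products. It therefore passes to the closure. -/
lemma hasW12Gradient_of_mem_closure {Ω U : Set (E n)} {z : FieldPair Ω}
    (hz : z ∈ (testPairs Ω U).topologicalClosure) : HasW12Gradient Ω z.fst z.snd := by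
  refine ⟨Lp.memLp _, Lp.memLp _, fun φ hφ hφc hφΩ i j => ?_⟩
  have hdφ : Continuous fun x => fderiv ℝ φ x (EuclideanSpace.single j 1) :=
    (hφ.continuous_fderiv (by simp)).clm_apply continuous_const
  have m1 := memLp_smul_single hdφ (hφc.fderiv_apply (𝕜 := ℝ) _) i (volume.restrict Ω)
  have m2 := memLp_smul_single hφ.continuous hφc (i, j) (volume.restrict Ω)
  have hclosed : IsClosed {w : FieldPair Ω |
      inner ℝ m1.toLp (WithLp.fstL 2 ℝ _ _ w) + inner ℝ m2.toLp (WithLp.sndL 2 ℝ _ _ w) = 0} :=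
    isClosed_eq (by fun_prop) continuous_const
  have hsub : (testPairs Ω U : Set (FieldPair Ω)) ⊆ {w : FieldPair Ω |
      inner ℝ m1.toLp (WithLp.fstL 2 ℝ _ _ w) + inner ℝ m2.toLp (WithLp.sndL 2 ℝ _ _ w) = 0} := by
    rintro w ⟨u, hu, h1, h2⟩
    have e1 : inner ℝ m1.toLp w.fst =
        ∫ x in Ω, u x i * fderiv ℝ φ x (EuclideanSpace.single j 1) := by
      rw [inner_toLp_smul_single]
      exact integral_congr_ae (by filter_upwards [h1] with x hx; rw [hx])
    have e2 : inner ℝ m2.toLp w.snd = ∫ x in Ω, classicalGradient u x (i, j) * φ x := by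
      rw [inner_toLp_smul_single]
      exact integral_congr_ae (by filter_upwards [h2] with x hx; rw [hx])
    change inner ℝ m1.toLp w.fst + inner ℝ m2.toLp w.snd = 0
    rw [e1, e2, integral_classicalGradient hu hφ hφc hφΩ, neg_add_cancel]
  have := closure_minimal hsub hclosed hz
  change inner ℝ m1.toLp z.fst + inner ℝ m2.toLp z.snd = 0 at this
  rw [inner_toLp_smul_single, inner_toLp_smul_single] at this
  linarith

/-- The approximating test fields vanish identically off `U`, so on `Γ` there is nothing to
estimate. -/
lemma hasTrace_zero_of_mem_closure {Ω U Γ : Set (E n)} (hU : IsOpen U) (hΓ : Γ ⊆ Uᶜ)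
    {z : FieldPair Ω} (hz : z ∈ (testPairs Ω U).topologicalClosure) :
    HasTrace Ω Γ z.fst z.snd 0 := by
  obtain ⟨u, hu, h1, h2⟩ := exists_seq_of_mem_closure hz
  refine ⟨u, fun k => (hu k).contDiff, h1, h2, ?_⟩
  have h0 : ∀ k, eLpNorm (u k - 0) 2 (μHE[n - 1].restrict Γ) = 0 := by
    intro k
    refine (eLpNorm_congr_ae ?_).trans eLpNorm_zero
    refine ae_restrict_of_ae_restrict_of_subset hΓ ?_
    filter_upwards [ae_restrict_mem hU.measurableSet.compl] with x hx
    rw [sub_zero]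
    exact image_eq_zero_of_notMem_tsupport fun h => hx ((hu k).tsupport_subset h)
  simp only [h0]
  exact tendsto_const_nhds

/-- The divergence operator on pairs. -/
noncomputable def pairDivergence (Ω : Set (E n)) :
    FieldPair Ω →L[ℝ] Lp ℝ 2 (volume.restrict Ω) :=
  ((divCLM n).compLpL 2 (volume.restrict Ω)).comp (WithLp.sndL 2 ℝ _ _)

lemma pairDivergence_ae (Ω : Set (E n)) (z : FieldPair Ω) :
    pairDivergence Ω z =ᵐ[volume.restrict Ω] fun x => divergence z.snd x := by
  filter_upwards [(divCLM n).coeFn_compLpL z.snd] with x hx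
  rw [divergence, ← divCLM_apply]
  exact hx

lemma inner_pairDivergence_pair {Ω U : Set (E n)} {v : E n → E n} (hv : IsTestField U v)
    (p : Lp ℝ 2 (volume.restrict Ω)) :
    inner ℝ p (pairDivergence Ω (hv.pair Ω)) = ∫ x in Ω, p x * fieldDiv v x := by
  rw [L2.inner_def]
  refine integral_congr_ae ?_
  filter_upwards [pairDivergence_ae Ω (hv.pair Ω),
    (hv.memLp_classicalGradient (volume.restrict Ω)).coeFn_toLp] with x hx hx'
  have : (hv.pair Ω).snd x = classicalGradient v x := hx'
  rw [hx, divergence, ← divCLM_apply, this, divCLM_classicalGradient]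
  simp [mul_comm]

lemma enorm_pair_le {Ω U : Set (E n)} {v : E n → E n} (hv : IsTestField U v) :
    ‖hv.pair Ω‖ₑ ≤ (1 + ‖gradCLM n‖ₑ) * (eLpNorm v 2 (volume.restrict Ω) +
      eLpNorm (fun x => ‖fderiv ℝ v x‖) 2 (volume.restrict Ω)) := by
  have h1 : ‖hv.pair Ω‖ ≤ ‖(hv.pair Ω).fst‖ + ‖(hv.pair Ω).snd‖ := by
    rw [WithLp.prod_norm_eq_of_L2]
    refine Real.sqrt_le_iff.2 ⟨by positivity, ?_⟩
    nlinarith [norm_nonneg (hv.pair Ω).fst, norm_nonneg (hv.pair Ω).snd,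
      mul_nonneg (norm_nonneg (hv.pair Ω).fst) (norm_nonneg (hv.pair Ω).snd)]
  have h2 : ‖hv.pair Ω‖ₑ ≤ ‖(hv.pair Ω).fst‖ₑ + ‖(hv.pair Ω).snd‖ₑ := by
    simp only [← ofReal_norm]
    rw [← ENNReal.ofReal_add (norm_nonneg _) (norm_nonneg _)]
    exact ENNReal.ofReal_le_ofReal h1
  have h3 : ‖(hv.pair Ω).fst‖ₑ = eLpNorm v 2 (volume.restrict Ω) :=
    Lp.enorm_toLp (hv.memLp _)
  have h4 : ‖(hv.pair Ω).snd‖ₑ = eLpNorm (classicalGradient v) 2 (volume.restrict Ω) :=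
    Lp.enorm_toLp (hv.memLp_classicalGradient _)
  have h5 : eLpNorm (classicalGradient v) 2 (volume.restrict Ω) ≤
      ‖gradCLM n‖ₑ * eLpNorm (fun x => ‖fderiv ℝ v x‖) 2 (volume.restrict Ω) := by
    rw [eLpNorm_norm]
    exact eLpNorm_le_nnreal_smul_eLpNorm_of_ae_le_mul (c := ‖gradCLM n‖₊)
      (Eventually.of_forall fun x => (gradCLM n).le_opNNNorm _) 2
  refine h2.trans ?_
  rw [h3, h4, add_mul, mul_add, one_mul, one_mul]
  exact add_le_add le_self_add (h5.trans (mul_le_mul_right le_add_self _))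

lemma norm_bound_of_nnnorm_bound {m : ℕ} {X Y : Type*} [NormedAddCommGroup X]
    [NormedAddCommGroup Y] {p : X} {t : Y} {K C : ℝ≥0} {f : Fin m → ℝ}
    (h : ‖p‖₊ ≤ C * (‖t‖₊ * (1 + K) + ∑ i, ‖f i‖₊)) :
    ‖p‖ ≤ (C * (1 + K + m)) * (‖t‖ + ‖f‖) := by
  have h3 : ‖p‖ ≤ C * (‖t‖ * (1 + K) + ∑ i, ‖f i‖) := by
    have := NNReal.coe_le_coe.2 h
    push_cast at this
    simpa using this
  have h4 : ∑ i, ‖f i‖ ≤ m * ‖f‖ := by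
    refine (Finset.sum_le_card_nsmul _ _ ‖f‖ fun i _ => norm_le_pi_norm _ i).trans ?_
    simp
  refine h3.trans ?_
  rw [mul_assoc]
  refine mul_le_mul_of_nonneg_left ?_ C.2
  have h5 := mul_nonneg (add_nonneg zero_le_one K.2) (norm_nonneg f)
  have h6 := mul_nonneg (Nat.cast_nonneg (α := ℝ) m) (norm_nonneg t)
  simp only [NNReal.val_eq_coe] at h5
  linarith

/-- Solvability of the divergence equation with homogeneous conditions on the complement of `U`. -/
theorem exists_divergence_solution {Ω U Γ : Set (E n)} (hΩ : IsOpen Ω)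
    (hb : Bornology.IsBounded Ω) (hc : IsPreconnected Ω) (hU : IsOpen U) (hΩU : Ω ⊆ U)
    (hloc : HasLocalParametrix Ω U) {z : E n} (hzU : z ∈ U) (hz : z ∈ closure Ω)
    (hz' : z ∈ closure (closure Ω)ᶜ) (hΓ : Γ ⊆ Uᶜ) :
    ∃ C : ℝ, 0 < C ∧ ∀ q : E n → ℝ, MemLp q 2 (volume.restrict Ω) →
      ∃ (X : E n → E n) (G : E n → Mat n), HasW12Gradient Ω X G ∧
        (∀ᵐ x ∂(volume.restrict Ω), divergence G x = q x) ∧ HasTrace Ω Γ X G 0 ∧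
        eLpNorm G 2 (volume.restrict Ω) ≤ ENNReal.ofReal C * eLpNorm q 2 (volume.restrict Ω) := by
  let H := (testPairs Ω U).topologicalClosure
  let D : H →L[ℝ] Lp ℝ 2 (volume.restrict Ω) := (pairDivergence Ω).comp H.subtypeL
  let T := ContinuousLinearMap.adjoint D
  have hmem : ∀ {v : E n → E n} (hv : IsTestField U v), hv.pair Ω ∈ H := fun hv =>
    (testPairs Ω U).le_topologicalClosure (hv.pair_mem Ω)
  -- The vector `T p` represents the functional `v ↦ ∫ p div v`, so `‖T p‖` is in substance the dual
  -- norm of the gradient of `p`.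
  have hT : ∀ (p : Lp ℝ 2 (volume.restrict Ω)) {v : E n → E n} (hv : IsTestField U v),
      ∫ x in Ω, p x * fieldDiv v x = inner ℝ (T p) (⟨hv.pair Ω, hmem hv⟩ : H) := by
    intro p v hv
    rw [ContinuousLinearMap.adjoint_inner_left, ← inner_pairDivergence_pair hv p]
    rfl
  obtain ⟨m, c, C, hcm, hC⟩ := hloc.exists_eLpNorm_le_add_sum hΩ.measurableSet hb
  have hfin : IsFiniteMeasure (volume.restrict Ω) := ⟨by simpa using hb.measure_lt_top⟩
  let F : Lp ℝ 2 (volume.restrict Ω) →L[ℝ] Fin m → ℝ := ContinuousLinearMap.pi fun i =>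
    innerSL ℝ (indicatorConstLp 2 (hcm i) (measure_ne_top (volume.restrict Ω) (c i)) (1 : ℝ))
  have hF : ∀ p i, F p i = ∫ x in Ω ∩ c i, p x := by
    intro p i
    change inner ℝ (indicatorConstLp 2 (hcm i) (measure_ne_top (volume.restrict Ω) (c i)) (1 : ℝ))
      p = _
    rw [L2.inner_indicatorConstLp_one, Measure.restrict_restrict (hcm i), inter_comm]
  have hbound : ∀ p, ‖p‖ ≤ (C * (1 + ‖gradCLM n‖₊ + m)) * (‖T p‖ + ‖F p‖) := by
    intro p
    have hG : GradientBound Ω U p (‖T p‖ₑ * (1 + ‖gradCLM n‖ₑ)) := by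
      refine gradientBound_of_isTestField hU hΩU (Lp.memLp p)
        (ENNReal.mul_ne_top (by simp) (by simp)) fun v hv => ?_
      rw [hT p hv, mul_assoc]
      refine (?_ : _ ≤ ‖T p‖ₑ * ‖hv.pair Ω‖ₑ).trans (mul_le_mul_right (enorm_pair_le hv) _)
      simp only [← ofReal_norm]
      rw [← ENNReal.ofReal_mul (norm_nonneg _)]
      exact ENNReal.ofReal_le_ofReal (norm_inner_le_norm _ _)
    have h1 := hC p (Lp.memLp p) _ hG
    simp only [← hF] at h1
    rw [← Lp.enorm_def] at h1
    have h2 : ‖p‖₊ ≤ C * (‖T p‖₊ * (1 + ‖gradCLM n‖₊) + ∑ i, ‖F p i‖₊) := by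
      simp only [enorm_eq_nnnorm] at h1
      exact_mod_cast h1
    exact norm_bound_of_nnnorm_bound h2
  have hinj : ∀ p, T p = 0 → p = 0 := by
    intro p hp
    rw [Lp.eq_zero_iff_ae_eq_zero]
    have hpL := Lp.memLp p
    have hPL : MemLp (Ω.indicator p) 2 volume :=
      (memLp_indicator_iff_restrict hΩ.measurableSet).2 hpL
    have hzero : HasZeroGradient U (Ω.indicator p) := by
      intro v hv
      have := hT p hv
      rw [hp, inner_zero_left, ← integral_indicator hΩ.measurableSet] at this
      rw [← this]
      refine integral_congr_ae (Eventually.of_forall fun x => ?_)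
      by_cases hx : x ∈ Ω <;> simp [hx]
    have h0 := hzero.ae_eq_zero (hPL.locallyIntegrable (by norm_num)) hU hΩU hc
      (fun x hx => indicator_of_notMem hx _) hzU hz hz'
    filter_upwards [ae_restrict_of_ae h0, ae_restrict_mem hΩ.measurableSet] with x hx hxΩ
    rwa [indicator_of_mem hxΩ] at hx
  obtain ⟨c₀, hc₀, hTc⟩ := exists_bound_of_finite_rank T F hbound hinj
  have hsurj : Function.Surjective D := surjective_of_adjoint_bounded_below D hc₀ hTc
  -- The open mapping theorem gives preimages with a norm bound independent of `q`.
  obtain ⟨K, hK, hpre⟩ := D.exists_preimage_norm_le hsurj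
  refine ⟨K, hK, fun q hq => ?_⟩
  obtain ⟨⟨w, hw⟩, hwq, hwK⟩ := hpre hq.toLp
  refine ⟨w.fst, w.snd, hasW12Gradient_of_mem_closure hw, ?_,
    hasTrace_zero_of_mem_closure hU hΓ hw, ?_⟩
  · have e : pairDivergence Ω w = hq.toLp := hwq
    filter_upwards [pairDivergence_ae Ω w, hq.coeFn_toLp] with x h1 h2
    rw [← h1, e, h2]
  · have h1 : ‖w.snd‖ ≤ ‖w‖ := by
      rw [WithLp.prod_norm_eq_of_L2]
      exact Real.le_sqrt_of_sq_le (le_add_of_nonneg_left (sq_nonneg _))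
    have h2 : ‖w.snd‖ ≤ K * ‖hq.toLp‖ := h1.trans hwK
    have h3 := ENNReal.ofReal_le_ofReal h2
    rw [ENNReal.ofReal_mul hK.le, ofReal_norm, ofReal_norm, Lp.enorm_toLp, Lp.enorm_def] at h3
    exact h3

end Solve

end Pipe

namespace Pipe

/-! ### Boundary charts, flat ends and the local parametrices of a channel. -/

section Geometry

variable {E : Type*} [NormedAddCommGroup E] [InnerProductSpace ℝ E] [FiniteDimensional ℝ E]
  [MeasurableSpace E] [BorelSpace E]

/-- Near `x` the set `D` is the epigraph, in the direction `ν`, of a graph function. -/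
def HasGraphChart (D : Set E) (x ν : E) : Prop :=
  ∃ Φ, IsGraphFunction ν Φ ∧ ∀ᶠ y in 𝓝 x, (y ∈ D ↔ y ∈ epigraphOf ν Φ)

/-- The projection along a direction. -/
noncomputable def projectionAlong (ν : E) : E →L[ℝ] E :=
  ContinuousLinearMap.id ℝ E - (innerSL ℝ ν).smulRight ν

lemma projectionAlong_apply (ν y : E) : projectionAlong ν y = y - inner ℝ ν y • ν := by
  simp [projectionAlong]

lemma projectionAlong_add_smul {ν : E} (hν : ‖ν‖ = 1) (y : E) (t : ℝ) :
    projectionAlong ν (y + t • ν) = projectionAlong ν y := by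
  rw [projectionAlong_apply, projectionAlong_apply, inner_add_right, real_inner_smul_right,
    real_inner_self_eq_norm_sq, hν]
  module

lemma isGraphFunction_comp_projectionAlong {ν : E} (hν : ‖ν‖ = 1) {g : E → ℝ}
    (hg : ContDiff ℝ 2 g) (hc : HasCompactSupport g) :
    IsGraphFunction ν (fun y => g (projectionAlong ν y)) := by
  have hd : ∀ y, HasFDerivAt (fun y => g (projectionAlong ν y))
      ((fderiv ℝ g (projectionAlong ν y)).comp (projectionAlong ν)) y := fun y =>
    (hg.differentiable (by norm_num) _).hasFDerivAt.comp y (projectionAlong ν).hasFDerivAt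
  refine ⟨hν, hg.comp (projectionAlong ν).contDiff, fun y t => ?_, ?_, ?_⟩
  · rw [projectionAlong_add_smul hν]
  · obtain ⟨K, hK⟩ :=
      (hg.of_le (m := 1) (by norm_num)).lipschitzWith_of_hasCompactSupport hc one_ne_zero
    exact ⟨_, hK.comp (projectionAlong ν).lipschitz⟩
  · obtain ⟨K, hK⟩ :=
      (hg.fderiv_right (m := 1) (by norm_num)).lipschitzWith_of_hasCompactSupport
        (hc.fderiv (𝕜 := ℝ)) one_ne_zero
    have e : fderiv ℝ (fun y => g (projectionAlong ν y)) = fun y =>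
        (ContinuousLinearMap.compL ℝ E E ℝ).flip (projectionAlong ν)
          (fderiv ℝ g (projectionAlong ν y)) := by
      funext y
      rw [(hd y).fderiv]
      rfl
    rw [e]
    exact ⟨_, ((ContinuousLinearMap.compL ℝ E E ℝ).flip (projectionAlong ν)).lipschitz.comp
      (hK.comp (projectionAlong ν).lipschitz)⟩

/-- Cutting `Φ` off makes it and its derivative globally Lipschitz. The cutoff is composed with the
projection along `ν`, which keeps the function invariant in that direction. -/
lemma HasGraphChart.of_contDiff {D : Set E} {x ν : E} (hν : ‖ν‖ = 1) {Φ : E → ℝ}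
    (hΦ : ContDiff ℝ 2 Φ) (hinv : ∀ y (t : ℝ), Φ (y + t • ν) = Φ y)
    (h : ∀ᶠ y in 𝓝 x, (y ∈ D ↔ Φ y < inner ℝ ν y)) : HasGraphChart D x ν := by
  let χ : ContDiffBump (projectionAlong ν x) := ⟨1, 2, one_pos, one_lt_two⟩
  have hg : ContDiff ℝ 2 (fun y => χ y * Φ y) := χ.contDiff.mul hΦ
  have hgc : HasCompactSupport (fun y => χ y * Φ y) := χ.hasCompactSupport.mul_right
  refine ⟨_, isGraphFunction_comp_projectionAlong hν hg hgc, ?_⟩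
  have h1 : ∀ᶠ y in 𝓝 x, χ (projectionAlong ν y) = 1 :=
    ((projectionAlong ν).continuous.tendsto x).eventually χ.eventuallyEq_one
  filter_upwards [h, h1] with y hy hy1
  have hp : Φ (projectionAlong ν y) = Φ y := by
    rw [projectionAlong_apply, sub_eq_add_neg, ← neg_smul, hinv]
  rw [hy, epigraphOf, mem_ofPred_eq, hy1, one_mul, hp]

lemma HasGraphChart.of_const {D : Set E} {x ν : E} (hν : ‖ν‖ = 1) (k : ℝ)
    (h : ∀ᶠ y in 𝓝 x, (y ∈ D ↔ k < inner ℝ ν y)) : HasGraphChart D x ν :=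
  .of_contDiff hν contDiff_const (fun _ _ => rfl) h

lemma isGraphFunction_const {ν : E} (hν : ‖ν‖ = 1) (k : ℝ) :
    IsGraphFunction ν (fun _ => k) :=
  ⟨hν, contDiff_const, fun _ _ => rfl, ⟨0, LipschitzWith.const k⟩, ⟨0, by
    simp only [fderiv_fun_const]
    exact LipschitzWith.const 0⟩⟩

lemma divParametrix_epigraphOf {ν : E} {Φ : E → ℝ} (h : IsGraphFunction ν Φ) :
    DivParametrix (epigraphOf ν Φ) := by
  have := divParametrix_univ.inter_epigraphOf h fun x hx => absurd (mem_univ x) hx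
  rwa [univ_inter] at this

/-- `Γ` is a flat end of `Ω`, across the axis `a`: near its closure, `Ω` is the part of the cylinder
`Z` on one side of the hyperplane containing `Γ`. -/
structure IsStraightEnd (Ω Γ Z : Set E) (a : E) (c : ℝ) : Prop where
  isOpen : IsOpen Z
  norm_eq_one : ‖a‖ = 1
  mem_iff : ∀ y, y ∈ Γ ↔ y ∈ Z ∧ inner ℝ a y = c
  nonempty : Γ.Nonempty
  eventually : ∀ x ∈ closure Γ, ∀ᶠ y in 𝓝 x, (y ∈ Ω ↔ y ∈ Z ∧ c < inner ℝ a y)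
  exists_chart : ∀ x ∈ frontier Z, ∃ ν, inner ℝ a ν = 0 ∧ HasGraphChart Z x ν

namespace IsStraightEnd

variable {Ω Γ Z : Set E} {a : E} {c : ℝ}

lemma mem_frontier_or (h : IsStraightEnd Ω Γ Z a c) {x : E} (hx : x ∈ closure Γ) :
    x ∈ Z ∨ x ∈ frontier Z := by
  by_cases hxZ : x ∈ Z
  · exact .inl hxZ
  · refine .inr ⟨closure_mono (fun y hy => ((h.mem_iff y).1 hy).1) hx, fun hi => hxZ ?_⟩
    exact interior_subset hi

lemma eventually_inner_lt (a : E) {y : E} {c : ℝ} (h : inner ℝ a y < c) :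
    ∀ᶠ w in 𝓝 y, inner ℝ a w < c :=
  (innerSL ℝ a).continuous.tendsto y |>.eventually (gt_mem_nhds h)

lemma eventually_lt_inner (a : E) {y : E} {c : ℝ} (h : c < inner ℝ a y) :
    ∀ᶠ w in 𝓝 y, c < inner ℝ a w :=
  (innerSL ℝ a).continuous.tendsto y |>.eventually (lt_mem_nhds h)

lemma eventually_notMem_closure (h : IsStraightEnd Ω Γ Z a c) {x : E} (hx : x ∈ closure Γ) :
    ∀ᶠ y in 𝓝 x, inner ℝ a y < c → y ∉ closure Ω := by
  filter_upwards [(h.eventually x hx).eventually_nhds] with y hy hlt hcl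
  rw [mem_closure_iff_frequently] at hcl
  obtain ⟨w, hw, hw1, hw2⟩ := (hcl.and_eventually (hy.and (eventually_inner_lt a hlt))).exists
  exact hw2.not_gt (hw1.1 hw).2

lemma eventually_mem_of_mem_frontier (h : IsStraightEnd Ω Γ Z a c) {x : E} (hx : x ∈ closure Γ) :
    ∀ᶠ y in 𝓝 x, y ∈ Z → y ∈ frontier Ω → y ∈ Γ := by
  filter_upwards [(h.eventually x hx).eventually_nhds, h.eventually_notMem_closure hx]
    with y hy hlt hyZ hyf
  rcases lt_trichotomy (inner ℝ a y) c with hc | hc | hc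
  · exact absurd hyf.1 (hlt hc)
  · exact (h.mem_iff y).2 ⟨hyZ, hc⟩
  · refine absurd ?_ hyf.2
    rw [mem_interior_iff_mem_nhds]
    filter_upwards [hy, h.isOpen.mem_nhds hyZ, eventually_lt_inner a hc] with w h1 h2 h3
    exact h1.2 ⟨h2, h3⟩

/-- Inside the cylinder the only boundary points near the end are those of `Γ`. At the outlet,
fields are thus unconstrained on both sides of `Γ` and may cross it. -/
lemma eventually_notMem_closure_frontier (h : IsStraightEnd Ω Γ Z a c) {x : E}
    (hx : x ∈ closure Γ) : ∀ᶠ y in 𝓝 x, y ∈ Z → y ∈ (closure (frontier Ω \ Γ))ᶜ := by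
  filter_upwards [(h.eventually_mem_of_mem_frontier hx).eventually_nhds] with y hy hyZ hcl
  rw [mem_closure_iff_frequently] at hcl
  obtain ⟨w, ⟨hw, hwΓ⟩, hw1, hw2⟩ := (hcl.and_eventually (hy.and (h.isOpen.mem_nhds hyZ))).exists
  exact hwΓ (hw1 hw2 hw)

lemma inner_add_smul (h : IsStraightEnd Ω Γ Z a c) (s : ℝ) (y : E) :
    inner ℝ a (y + s • a) = inner ℝ a y + s := by
  rw [inner_add_right, real_inner_smul_right, real_inner_self_eq_norm_sq, h.norm_eq_one]
  ring

lemma tendsto_add_smul (y a : E) (l : Filter ℝ) (hl : l ≤ 𝓝 0) :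
    Tendsto (fun s : ℝ => y + s • a) l (𝓝 y) := by
  have : Tendsto (fun s : ℝ => y + s • a) (𝓝 0) (𝓝 (y + (0 : ℝ) • a)) :=
    (continuous_const.add (continuous_id.smul continuous_const)).tendsto 0
  rw [zero_smul, add_zero] at this
  exact this.mono_left hl

lemma mem_closure (h : IsStraightEnd Ω Γ Z a c) {y : E} (hy : y ∈ Γ) : y ∈ closure Ω := by
  have ht := tendsto_add_smul y a (𝓝[>] 0) nhdsWithin_le_nhds
  refine mem_closure_of_tendsto ht ?_
  filter_upwards [ht.eventually (h.eventually y (subset_closure hy)),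
    ht.eventually (h.isOpen.mem_nhds ((h.mem_iff y).1 hy).1), self_mem_nhdsWithin] with s h1 h2 h3
  refine h1.2 ⟨h2, ?_⟩
  rw [h.inner_add_smul, ((h.mem_iff y).1 hy).2]
  exact lt_add_of_pos_right c h3

lemma mem_closure_compl (h : IsStraightEnd Ω Γ Z a c) {y : E} (hy : y ∈ Γ) :
    y ∈ closure (closure Ω)ᶜ := by
  have ht := tendsto_add_smul y a (𝓝[<] 0) nhdsWithin_le_nhds
  refine mem_closure_of_tendsto ht ?_
  filter_upwards [ht.eventually (h.eventually_notMem_closure (subset_closure hy)),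
    self_mem_nhdsWithin] with s h1 h2
  refine h1 ?_
  rw [h.inner_add_smul, ((h.mem_iff y).1 hy).2]
  exact add_lt_of_neg_right c h2

lemma notMem (h : IsStraightEnd Ω Γ Z a c) {y : E} (hy : y ∈ Γ) : y ∉ Ω := fun hyΩ =>
  (((h.eventually y (subset_closure hy)).self_of_nhds.1 hyΩ).2).ne' ((h.mem_iff y).1 hy).2

lemma mem_frontier (h : IsStraightEnd Ω Γ Z a c) {y : E} (hy : y ∈ Γ) : y ∈ frontier Ω :=
  ⟨h.mem_closure hy, fun hi => h.notMem hy (interior_subset hi)⟩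

end IsStraightEnd

/-- The fields vanishing on the boundary up to a flat end have local parametrices. -/
theorem hasLocalParametrix_of_isStraightEnd {Ω Γ Γ' Z Z' : Set E} {a a' : E} {c c' : ℝ}
    (hΩ : IsOpen Ω) (h : IsStraightEnd Ω Γ Z a c) (h' : IsStraightEnd Ω Γ' Z' a' c')
    (hw : ∀ x ∈ frontier Ω \ (closure Γ ∪ closure Γ'), ∃ ν, HasGraphChart Ω x ν) :
    HasLocalParametrix Ω (closure (frontier Ω \ Γ'))ᶜ := by
  set U := (closure (frontier Ω \ Γ'))ᶜ with hUdef
  have hΩU : Ω ⊆ U := by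
    intro y hy hcl
    have := (closure_mono sdiff_subset).trans isClosed_frontier.closure_subset hcl
    exact this.2 (hΩ.interior_eq.symm ▸ hy)
  have key : ∀ x, (∃ D, DivParametrix D ∧ ∀ᶠ y in 𝓝 x, (y ∈ D → y ∈ U) ∧ (y ∈ Ω → y ∈ D)) →
      ∃ (r : ℝ) (D : Set E), 0 < r ∧ DivParametrix D ∧ D ∩ Metric.ball x r ⊆ U ∧
        Ω ∩ Metric.ball x r ⊆ D := by
    rintro x ⟨D, hD, hev⟩
    obtain ⟨r, hr, hrD⟩ := Metric.eventually_nhds_iff_ball.1 hev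
    exact ⟨r, D, hr, hD, fun y hy => (hrD y hy.2).1 hy.1, fun y hy => (hrD y hy.2).2 hy.1⟩
  intro x hx
  apply key
  by_cases hxΩ : x ∈ Ω
  · refine ⟨univ, divParametrix_univ, ?_⟩
    filter_upwards [hΩ.mem_nhds hxΩ] with y hy
    exact ⟨fun _ => hΩU hy, fun _ => mem_univ y⟩
  have hxf : x ∈ frontier Ω := ⟨hx, fun hi => hxΩ (interior_subset hi)⟩
  by_cases hxΓ : x ∈ closure Γ
  · have hB : DivParametrix (epigraphOf a fun _ => c) :=
      divParametrix_epigraphOf (isGraphFunction_const h.norm_eq_one c)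
    rcases h.mem_frontier_or hxΓ with hxZ | hxZ
    · refine ⟨_, hB, ?_⟩
      filter_upwards [h.eventually x hxΓ, h.isOpen.mem_nhds hxZ] with y hy hyZ
      exact ⟨fun hyB => hΩU (hy.2 ⟨hyZ, hyB⟩), fun hyΩ => (hy.1 hyΩ).2⟩
    -- At the rim of the inlet the half-space is cut once more by the wall. Since `ν` is orthogonal
    -- to `a`, moving along `ν` preserves the half-space and its complement, as the second
    -- reflection requires.
    · obtain ⟨ν, hν, Φ, hΦ, hZ⟩ := h.exists_chart x hxZ
      refine ⟨_, hB.inter_epigraphOf hΦ fun y hy t => ?_, ?_⟩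
      · rw [epigraphOf, mem_ofPred_eq] at hy ⊢
        rwa [inner_add_right, real_inner_smul_right, hν, mul_zero, add_zero]
      · filter_upwards [h.eventually x hxΓ, hZ] with y hy hyZ
        exact ⟨fun hyB => hΩU (hy.2 ⟨hyZ.2 hyB.2, hyB.1⟩),
          fun hyΩ => ⟨(hy.1 hyΩ).2, hyZ.1 (hy.1 hyΩ).1⟩⟩
  by_cases hxΓ' : x ∈ closure Γ'
  · rcases h'.mem_frontier_or hxΓ' with hxZ | hxZ
    · refine ⟨univ, divParametrix_univ, ?_⟩
      filter_upwards [h'.eventually_notMem_closure_frontier hxΓ', h'.isOpen.mem_nhds hxZ]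
        with y hy hyZ
      exact ⟨fun _ => hy hyZ, fun _ => mem_univ y⟩
    -- At the rim of the outlet only the wall counts: the model is the cylinder continued beyond the
    -- outlet.
    · obtain ⟨ν, -, Φ, hΦ, hZ⟩ := h'.exists_chart x hxZ
      refine ⟨_, divParametrix_epigraphOf hΦ, ?_⟩
      filter_upwards [h'.eventually_notMem_closure_frontier hxΓ', h'.eventually x hxΓ', hZ]
        with y hyU hy hyZ
      exact ⟨fun hyA => hyU (hyZ.2 hyA), fun hyΩ => hyZ.1 (hy.1 hyΩ).1⟩
  · obtain ⟨ν, Φ, hΦ, hev⟩ := hw x ⟨hxf, fun hu => hu.elim hxΓ hxΓ'⟩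
    refine ⟨_, divParametrix_epigraphOf hΦ, ?_⟩
    filter_upwards [hev] with y hy
    exact ⟨fun hyA => hΩU (hy.2 hyA), hy.1⟩

end Geometry

/-- Solvability of the divergence equation in a domain with two flat ends. -/
theorem exists_divergence_solution_of_isStraightEnd {n : ℕ} {Ω Γ Γ' Z Z' : Set (E n)} {a a' : E n}
    {c c' : ℝ} (hΩ : IsOpen Ω) (hb : Bornology.IsBounded Ω) (hc : IsPreconnected Ω)
    (h : IsStraightEnd Ω Γ Z a c) (h' : IsStraightEnd Ω Γ' Z' a' c') (hd : Disjoint Γ Γ')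
    (hw : ∀ x ∈ frontier Ω \ (closure Γ ∪ closure Γ'), ∃ ν, HasGraphChart Ω x ν) :
    ∃ C : ℝ, 0 < C ∧ ∀ q : E n → ℝ, MemLp q 2 (volume.restrict Ω) →
      ∃ (X : E n → E n) (G : E n → Mat n), HasW12Gradient Ω X G ∧
        (∀ᵐ x ∂(volume.restrict Ω), divergence G x = q x) ∧
        HasTrace Ω (Γ ∪ wall Ω Γ Γ') X G 0 ∧
        eLpNorm G 2 (volume.restrict Ω) ≤ ENNReal.ofReal C * eLpNorm q 2 (volume.restrict Ω) := by
  obtain ⟨z, hz⟩ := h'.nonempty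
  refine exists_divergence_solution hΩ hb hc (U := (closure (frontier Ω \ Γ'))ᶜ)
    isClosed_closure.isOpen_compl ?_ (hasLocalParametrix_of_isStraightEnd hΩ h h' hw) (z := z) ?_
    (h'.mem_closure hz) (h'.mem_closure_compl hz) ?_
  · intro y hy hcl
    have := (closure_mono sdiff_subset).trans isClosed_frontier.closure_subset hcl
    exact this.2 (hΩ.interior_eq.symm ▸ hy)
  -- A point of the outlet lies in `U` and touches the exterior of `Ω`, which excludes nonzero
  -- constants from the kernel of the gradient.
  · exact (h'.eventually_notMem_closure_frontier (subset_closure hz)).self_of_nhds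
      ((h'.mem_iff z).1 hz).1
  · rw [compl_compl]
    refine Subset.trans ?_ subset_closure
    rintro y (hy | hy)
    · exact ⟨h.mem_frontier hy, fun hy' => disjoint_left.1 hd hy hy'⟩
    · exact ⟨hy.1, fun hy' => hy.2 (.inr hy')⟩

end Pipe

namespace Pipe

/-! ### Flat ends in the coordinates of a rigid motion. -/

section RigidMotion

variable {n : ℕ}

lemma inner_linearIsometryEquiv (e : E n ≃ᵃⁱ[ℝ] E n) (v y : E n) :
    inner ℝ (e.linearIsometryEquiv v) y =
      inner ℝ v (e.symm y) + inner ℝ (e.linearIsometryEquiv v) (e 0) := by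
  have h : y = e.linearIsometryEquiv (e.symm y) + e 0 := by
    have := e.map_vadd 0 (e.symm y)
    simpa using this
  conv_lhs => rw [h]
  rw [inner_add_right, LinearIsometryEquiv.inner_map_map]

lemma apply_symm_eq_inner (e : E n ≃ᵃⁱ[ℝ] E n) (i : Fin n) (y : E n) :
    e.symm y i = inner ℝ (e.linearIsometryEquiv (EuclideanSpace.single i 1)) y -
      inner ℝ (e.linearIsometryEquiv (EuclideanSpace.single i 1)) (e 0) := by
  rw [inner_linearIsometryEquiv, EuclideanSpace.inner_single_left]
  simp

lemma mem_image_iff_symm_mem (e : E n ≃ᵃⁱ[ℝ] E n) (S : Set (E n)) (y : E n) :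
    y ∈ e '' S ↔ e.symm y ∈ S := by
  constructor
  · rintro ⟨x, hx, rfl⟩
    simpa using hx
  · exact fun h => ⟨_, h, by simp⟩

/-- As `ℓ > 0`, the far end of the straight piece is away from `Γ`, and its inequality holds
automatically nearby. -/
lemma IsStraightEnd.of_eventually {Ω Ω' Γ Z : Set (E n)} {b : E n} {k ℓ : ℝ} (hZ : IsOpen Z)
    (hb : ‖b‖ = 1) (hch : ∀ x ∈ frontier Z, ∃ ν, inner ℝ b ν = 0 ∧ HasGraphChart Z x ν)
    (hℓ : 0 < ℓ) (hev : ∀ᶠ y in 𝓝ˢ (closure Γ), (y ∈ Ω ↔ y ∈ Ω'))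
    (hΩ' : ∀ y, y ∈ Ω' ↔ y ∈ Z ∧ k < inner ℝ b y ∧ inner ℝ b y < k + ℓ)
    (hΓ : ∀ y, y ∈ Γ ↔ y ∈ Z ∧ inner ℝ b y = k) (hne : Γ.Nonempty) :
    IsStraightEnd Ω Γ Z b k := by
  refine ⟨hZ, hb, hΓ, hne, fun x hx => ?_, hch⟩
  have hxk : inner ℝ b x = k := by
    have hcl : IsClosed {y : E n | inner ℝ b y = k} :=
      isClosed_eq (innerSL ℝ b).continuous continuous_const
    exact closure_minimal (fun y hy => ((hΓ y).1 hy).2) hcl hx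
  filter_upwards [eventually_nhdsSet_iff_forall.1 hev x hx,
    IsStraightEnd.eventually_inner_lt b (y := x) (c := k + ℓ) (by linarith)] with y h1 h2
  rw [h1, hΩ']
  tauto

/-- The outlet sits at the far end of its piece; reversing the axis reduces it to the form of an
inlet. -/
lemma IsStraightEnd.of_eventually_neg {Ω Ω' Γ Z : Set (E n)} {b : E n} {k ℓ : ℝ} (hZ : IsOpen Z)
    (hb : ‖b‖ = 1) (hch : ∀ x ∈ frontier Z, ∃ ν, inner ℝ b ν = 0 ∧ HasGraphChart Z x ν)
    (hℓ : 0 < ℓ) (hev : ∀ᶠ y in 𝓝ˢ (closure Γ), (y ∈ Ω ↔ y ∈ Ω'))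
    (hΩ' : ∀ y, y ∈ Ω' ↔ y ∈ Z ∧ k < inner ℝ b y ∧ inner ℝ b y < k + ℓ)
    (hΓ : ∀ y, y ∈ Γ ↔ y ∈ Z ∧ inner ℝ b y = k + ℓ) (hne : Γ.Nonempty) :
    IsStraightEnd Ω Γ Z (-b) (-(k + ℓ)) := by
  refine IsStraightEnd.of_eventually hZ (by rwa [norm_neg]) (fun x hx => ?_) hℓ hev (fun y => ?_)
    (fun y => ?_) hne
  · obtain ⟨ν, hν, hx'⟩ := hch x hx
    exact ⟨ν, by rw [inner_neg_left, hν, neg_zero], hx'⟩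
  · rw [hΩ', inner_neg_left]
    refine and_congr_right fun _ => ⟨fun ⟨h1, h2⟩ => ⟨?_, ?_⟩, fun ⟨h1, h2⟩ => ⟨?_, ?_⟩⟩ <;> linarith
  · rw [hΓ, inner_neg_left, neg_inj]

/-- Near a common point of both ends, points of `Ω` would belong to both straight pieces, which are
disjoint. -/
lemma disjoint_of_isStraightEnd {Ω Ω₁ Ω₂ Γ_I Γ_O Z : Set (E n)} {a : E n} {c : ℝ}
    (hΩ : IsChannel Ω Ω₁ Ω₂ Γ_I Γ_O) (h : IsStraightEnd Ω Γ_I Z a c) : Disjoint Γ_I Γ_O := by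
  rw [disjoint_left]
  intro y hI hO
  have h1 := eventually_nhdsSet_iff_forall.1 hΩ.inlet y (subset_closure hI)
  have h2 := eventually_nhdsSet_iff_forall.1 hΩ.outlet y (subset_closure hO)
  have h3 := mem_closure_iff_frequently.1 (h.mem_closure hI)
  obtain ⟨w, hw, hw1, hw2⟩ := (h3.and_eventually (h1.and h2)).exists
  exact disjoint_left.1 hΩ.disjoint (hw1.1 hw) (hw2.1 hw)

lemma IsC2BoundaryPoint.exists_hasGraphChart {D : Set (E n)} {x : E n}
    (h : IsC2BoundaryPoint D x) : ∃ ν, HasGraphChart D x ν := by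
  obtain ⟨ν, φ, hν, hφ, hev⟩ := h
  refine ⟨ν, .of_contDiff hν (Φ := fun y => φ (projectionAlong ν y))
    (hφ.comp (projectionAlong ν).contDiff) (fun y t => ?_) ?_⟩
  · simp only [projectionAlong_add_smul hν]
  · simpa only [projectionAlong_apply] using hev

lemma IsChannel.exists_divergence_solution {Ω Ω₁ Ω₂ Γ_I Γ_O Z Z' : Set (E n)} {a a' : E n}
    {c c' : ℝ} (hΩ : IsChannel Ω Ω₁ Ω₂ Γ_I Γ_O) (h : IsStraightEnd Ω Γ_I Z a c)
    (h' : IsStraightEnd Ω Γ_O Z' a' c') :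
    ∃ C : ℝ, 0 < C ∧ ∀ q : E n → ℝ, MemLp q 2 (volume.restrict Ω) →
      ∃ (X : E n → E n) (G : E n → Mat n), HasW12Gradient Ω X G ∧
        (∀ᵐ x ∂(volume.restrict Ω), divergence G x = q x) ∧
        HasTrace Ω (Γ_I ∪ wall Ω Γ_I Γ_O) X G 0 ∧
        eLpNorm G 2 (volume.restrict Ω) ≤ ENNReal.ofReal C * eLpNorm q 2 (volume.restrict Ω) :=
  exists_divergence_solution_of_isStraightEnd hΩ.isOpen hΩ.isBounded
    hΩ.isSimplyConnected.isPathConnected.isConnected.isPreconnected h h'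
    (disjoint_of_isStraightEnd hΩ h) fun x hx => (hΩ.c2 x hx).exists_hasGraphChart

end RigidMotion

/-! ### Planar channels: strips. -/

section Planar

/-- The infinite strip of half width `h`. -/
def strip (e : E 2 ≃ᵃⁱ[ℝ] E 2) (h : ℝ) : Set (E 2) := {y | e.symm y 1 ∈ Ioo (-h) h}

lemma isOpen_strip (e : E 2 ≃ᵃⁱ[ℝ] E 2) (h : ℝ) : IsOpen (strip e h) :=
  isOpen_Ioo.preimage ((EuclideanSpace.proj (1 : Fin 2) : E 2 →L[ℝ] ℝ).continuous.comp
    e.symm.continuous)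

lemma strip_chart (e : E 2 ≃ᵃⁱ[ℝ] E 2) {h : ℝ} (hh : 0 < h) {x : E 2} (hx : x ∈ frontier (strip e h)) :
    ∃ ν, inner ℝ (e.linearIsometryEquiv (EuclideanSpace.single 0 1)) ν = 0 ∧
      HasGraphChart (strip e h) x ν := by
  set d := e.linearIsometryEquiv (EuclideanSpace.single (1 : Fin 2) (1 : ℝ)) with hd
  have hd1 : ‖d‖ = 1 := by simp [hd]
  have hperp : inner ℝ (e.linearIsometryEquiv (EuclideanSpace.single 0 1)) d = 0 := by
    rw [hd, LinearIsometryEquiv.inner_map_map, EuclideanSpace.inner_single_left]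
    simp
  set k := inner ℝ d (e 0) with hk
  have hcoord : ∀ y, e.symm y 1 = inner ℝ d y - k := apply_symm_eq_inner e 1
  have hcont : Continuous fun y => e.symm y 1 :=
    (EuclideanSpace.proj (1 : Fin 2) : E 2 →L[ℝ] ℝ).continuous.comp e.symm.continuous
  have hf : e.symm x 1 ∈ frontier (Ioo (-h) h) := hcont.frontier_preimage_subset _ hx
  rw [frontier_Ioo (by linarith)] at hf
  rcases hf with hf | hf
  -- Near one side of the strip the other inequality is automatic, leaving a half-plane with inward
  -- normal `d`; on the opposite side the normal is `-d`.
  · refine ⟨d, hperp, .of_const hd1 (k - h) ?_⟩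
    have : ∀ᶠ y in 𝓝 x, e.symm y 1 < h :=
      (hcont.tendsto x).eventually (gt_mem_nhds (by rw [hf]; linarith))
    filter_upwards [this] with y hy
    change -h < e.symm y 1 ∧ e.symm y 1 < h ↔ _
    rw [hcoord] at hy ⊢
    exact ⟨fun h1 => by linarith [h1.1], fun h1 => ⟨by linarith, hy⟩⟩
  · refine ⟨-d, by rw [inner_neg_right, hperp, neg_zero],
      .of_const (by rwa [norm_neg]) (-(k + h)) ?_⟩
    have hf : e.symm x 1 = h := hf
    have : ∀ᶠ y in 𝓝 x, -h < e.symm y 1 :=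
      (hcont.tendsto x).eventually (lt_mem_nhds (by rw [hf]; linarith))
    filter_upwards [this] with y hy
    change -h < e.symm y 1 ∧ e.symm y 1 < h ↔ _
    rw [hcoord] at hy ⊢
    rw [inner_neg_left]
    exact ⟨fun h1 => by linarith [h1.2], fun h1 => ⟨hy, by linarith⟩⟩

lemma mem_image_rectangle_iff (e : E 2 ≃ᵃⁱ[ℝ] E 2) (ℓ h : ℝ) (y : E 2) :
    y ∈ e '' rectangle ℓ h ↔ y ∈ strip e h ∧
      inner ℝ (e.linearIsometryEquiv (EuclideanSpace.single 0 1)) (e 0) <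
        inner ℝ (e.linearIsometryEquiv (EuclideanSpace.single 0 1)) y ∧
      inner ℝ (e.linearIsometryEquiv (EuclideanSpace.single 0 1)) y <
        inner ℝ (e.linearIsometryEquiv (EuclideanSpace.single 0 1)) (e 0) + ℓ := by
  rw [mem_image_iff_symm_mem]
  change (0 < e.symm y 0 ∧ e.symm y 0 < ℓ) ∧ y ∈ strip e h ↔ _
  rw [apply_symm_eq_inner e 0, and_comm, sub_pos, sub_lt_iff_lt_add']

lemma mem_image_rectangleSection_iff (e : E 2 ≃ᵃⁱ[ℝ] E 2) (h t : ℝ) (y : E 2) :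
    y ∈ e '' rectangleSection h t ↔ y ∈ strip e h ∧
      inner ℝ (e.linearIsometryEquiv (EuclideanSpace.single 0 1)) y =
        inner ℝ (e.linearIsometryEquiv (EuclideanSpace.single 0 1)) (e 0) + t := by
  rw [mem_image_iff_symm_mem]
  change e.symm y 0 = t ∧ y ∈ strip e h ↔ _
  rw [apply_symm_eq_inner e 0, and_comm, sub_eq_iff_eq_add']

lemma rectangleSection_nonempty {h : ℝ} (hh : 0 < h) (t : ℝ) : (rectangleSection h t).Nonempty :=
  ⟨!₂[t, 0], by simp [rectangleSection, hh]⟩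

theorem IsAdmissiblePlanar.exists_divergence_solution {Ω Γ_I Γ_O : Set (E 2)}
    (hΩ : IsAdmissiblePlanar Ω Γ_I Γ_O) :
    ∃ C : ℝ, 0 < C ∧ ∀ q : E 2 → ℝ, MemLp q 2 (volume.restrict Ω) →
      ∃ (X : E 2 → E 2) (G : E 2 → Mat 2), HasW12Gradient Ω X G ∧
        (∀ᵐ x ∂(volume.restrict Ω), divergence G x = q x) ∧
        HasTrace Ω (Γ_I ∪ wall Ω Γ_I Γ_O) X G 0 ∧
        eLpNorm G 2 (volume.restrict Ω) ≤ ENNReal.ofReal C * eLpNorm q 2 (volume.restrict Ω) := by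
  obtain ⟨e₁, e₂, ℓ₁, h₁, ℓ₂, h₂, hℓ₁, hh₁, hℓ₂, hh₂, rfl, rfl, hch⟩ := hΩ
  refine hch.exists_divergence_solution
    (IsStraightEnd.of_eventually (isOpen_strip e₁ h₁) (by simp) (fun x => strip_chart e₁ hh₁) hℓ₁
      hch.inlet (mem_image_rectangle_iff e₁ ℓ₁ h₁) (fun y => ?_)
      ((rectangleSection_nonempty hh₁ 0).image _))
    (IsStraightEnd.of_eventually_neg (isOpen_strip e₂ h₂) (by simp) (fun x => strip_chart e₂ hh₂)
      hℓ₂ hch.outlet (mem_image_rectangle_iff e₂ ℓ₂ h₂) (mem_image_rectangleSection_iff e₂ h₂ ℓ₂)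
      ((rectangleSection_nonempty hh₂ ℓ₂).image _))
  rw [mem_image_rectangleSection_iff, add_zero]

end Planar

/-! ### Spatial channels: cylinders over `C²` cross-sections. -/

section Spatial

/-- The projection to the first two coordinates. -/
noncomputable def planeProj : E 3 →L[ℝ] E 2 :=
  LinearMap.toContinuousLinearMap
    { toFun := fun p => !₂[p 0, p 1]
      map_add' := fun p q => by ext i; fin_cases i <;> simp
      map_smul' := fun c p => by ext i; fin_cases i <;> simp }

lemma planeProj_apply (p : E 3) : planeProj p = !₂[p 0, p 1] := rfl

lemma inner_planeProj (v : E 2) (p : E 3) :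
    inner ℝ (!₂[v 0, v 1, 0] : E 3) p = inner ℝ v (planeProj p) := by
  simp [PiLp.inner_apply, Fin.sum_univ_three, planeProj_apply]

/-- The infinite cylinder over `Θ`. -/
def infiniteCylinder (e : E 3 ≃ᵃⁱ[ℝ] E 3) (Θ : Set (E 2)) : Set (E 3) :=
  {y | planeProj (e.symm y) ∈ Θ}

lemma isOpen_infiniteCylinder (e : E 3 ≃ᵃⁱ[ℝ] E 3) {Θ : Set (E 2)} (hΘ : IsOpen Θ) :
    IsOpen (infiniteCylinder e Θ) :=
  hΘ.preimage (planeProj.continuous.comp e.symm.continuous)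

/-- A chart of the cross-section, made constant along the axis, is a chart of the cylinder. Its
direction is the planar one with third component zero, hence orthogonal to the axis; `κ` accounts
for the origin of the coordinate system. -/
lemma infiniteCylinder_chart (e : E 3 ≃ᵃⁱ[ℝ] E 3) {Θ : Set (E 2)} (hΘ : IsCrossSection Θ) {x : E 3}
    (hx : x ∈ frontier (infiniteCylinder e Θ)) :
    ∃ ν, inner ℝ (e.linearIsometryEquiv (EuclideanSpace.single 2 1)) ν = 0 ∧
      HasGraphChart (infiniteCylinder e Θ) x ν := by
  have hcont : Continuous fun y => planeProj (e.symm y) :=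
    planeProj.continuous.comp e.symm.continuous
  have hf : planeProj (e.symm x) ∈ frontier Θ := hcont.frontier_preimage_subset _ hx
  obtain ⟨v, φ, hv, hφ, hev⟩ := hΘ.c2 _ hf
  set w : E 3 := !₂[v 0, v 1, 0] with hw
  set ν := e.linearIsometryEquiv w with hν
  set κ := inner ℝ ν (e 0) with hκ
  have hπw : planeProj w = v := by
    ext i
    fin_cases i <;> simp [planeProj_apply, hw]
  have hν1 : ‖ν‖ = 1 := by
    rw [hν, LinearIsometryEquiv.norm_map, ← sq_eq_sq₀ (norm_nonneg _) zero_le_one,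
      ← real_inner_self_eq_norm_sq, hw, inner_planeProj, ← hw, hπw, real_inner_self_eq_norm_sq, hv]
  have hinner : ∀ y, inner ℝ ν y = inner ℝ v (planeProj (e.symm y)) + κ := by
    intro y
    rw [hν, inner_linearIsometryEquiv, hw, inner_planeProj]
  have hsymm : ∀ y (t : ℝ), e.symm (y + t • ν) = e.symm y + t • w := by
    intro y t
    apply e.injective
    have := e.map_vadd (e.symm y) (t • w)
    simp only [vadd_eq_add, map_smul, AffineIsometryEquiv.apply_symm_apply] at this
    rw [AffineIsometryEquiv.apply_symm_apply, add_comm (e.symm y), this, add_comm]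
  have hsmooth : ContDiff ℝ 2 fun y => planeProj (e.symm y) := by
    have he : ∀ y, e.symm y = e.symm.linearIsometryEquiv y + e.symm 0 := fun y => by
      simpa using e.symm.map_vadd 0 y
    have hfun : (fun y => planeProj (e.symm y)) = fun y =>
        planeProj (e.symm.linearIsometryEquiv y + e.symm 0) := funext fun y => by rw [← he]
    rw [hfun]
    exact planeProj.contDiff.comp (e.symm.linearIsometryEquiv.contDiff.add contDiff_const)
  refine ⟨ν, ?_, .of_contDiff hν1
    (Φ := fun y => φ (projectionAlong v (planeProj (e.symm y))) + κ)
    ((hφ.comp ((projectionAlong v).contDiff.comp hsmooth)).add contDiff_const) (fun y t => ?_) ?_⟩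
  · rw [hν, LinearIsometryEquiv.inner_map_map, EuclideanSpace.inner_single_left]
    simp [hw]
  · simp only [hsymm, map_add, map_smul, hπw]
    rw [← map_smul, ← map_add, projectionAlong_add_smul hv]
  · filter_upwards [(hcont.tendsto x).eventually hev] with y hy
    rw [hinner, add_lt_add_iff_right, projectionAlong_apply]
    exact hy

lemma mem_image_cylinder_iff (e : E 3 ≃ᵃⁱ[ℝ] E 3) (Θ : Set (E 2)) (ℓ : ℝ) (y : E 3) :
    y ∈ e '' cylinder Θ ℓ ↔ y ∈ infiniteCylinder e Θ ∧
      inner ℝ (e.linearIsometryEquiv (EuclideanSpace.single 2 1)) (e 0) <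
        inner ℝ (e.linearIsometryEquiv (EuclideanSpace.single 2 1)) y ∧
      inner ℝ (e.linearIsometryEquiv (EuclideanSpace.single 2 1)) y <
        inner ℝ (e.linearIsometryEquiv (EuclideanSpace.single 2 1)) (e 0) + ℓ := by
  rw [mem_image_iff_symm_mem]
  change y ∈ infiniteCylinder e Θ ∧ (0 < e.symm y 2 ∧ e.symm y 2 < ℓ) ↔ _
  rw [apply_symm_eq_inner e 2, sub_pos, sub_lt_iff_lt_add']

lemma mem_image_cylinderSection_iff (e : E 3 ≃ᵃⁱ[ℝ] E 3) (Θ : Set (E 2)) (t : ℝ) (y : E 3) :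
    y ∈ e '' cylinderSection Θ t ↔ y ∈ infiniteCylinder e Θ ∧
      inner ℝ (e.linearIsometryEquiv (EuclideanSpace.single 2 1)) y =
        inner ℝ (e.linearIsometryEquiv (EuclideanSpace.single 2 1)) (e 0) + t := by
  rw [mem_image_iff_symm_mem]
  change y ∈ infiniteCylinder e Θ ∧ e.symm y 2 = t ↔ _
  rw [apply_symm_eq_inner e 2, sub_eq_iff_eq_add']

lemma cylinderSection_nonempty {Θ : Set (E 2)} (hΘ : Θ.Nonempty) (t : ℝ) :
    (cylinderSection Θ t).Nonempty := by
  obtain ⟨v, hv⟩ := hΘ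
  refine ⟨!₂[v 0, v 1, t], ?_, by simp⟩
  have : (!₂[v 0, v 1] : E 2) = v := by
    ext i
    fin_cases i <;> simp
  simpa [this] using hv

theorem IsAdmissibleSpatial.exists_divergence_solution {Ω Γ_I Γ_O : Set (E 3)}
    (hΩ : IsAdmissibleSpatial Ω Γ_I Γ_O) :
    ∃ C : ℝ, 0 < C ∧ ∀ q : E 3 → ℝ, MemLp q 2 (volume.restrict Ω) →
      ∃ (X : E 3 → E 3) (G : E 3 → Mat 3), HasW12Gradient Ω X G ∧
        (∀ᵐ x ∂(volume.restrict Ω), divergence G x = q x) ∧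
        HasTrace Ω (Γ_I ∪ wall Ω Γ_I Γ_O) X G 0 ∧
        eLpNorm G 2 (volume.restrict Ω) ≤ ENNReal.ofReal C * eLpNorm q 2 (volume.restrict Ω) := by
  obtain ⟨e₁, e₂, Θ₁, Θ₂, ℓ₁, ℓ₂, hℓ₁, hℓ₂, hΘ₁, hΘ₂, -, rfl, rfl, hch⟩ := hΩ
  refine hch.exists_divergence_solution
    (IsStraightEnd.of_eventually (isOpen_infiniteCylinder e₁ hΘ₁.isOpen) (by simp)
      (fun x => infiniteCylinder_chart e₁ hΘ₁) hℓ₁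
      hch.inlet (mem_image_cylinder_iff e₁ Θ₁ ℓ₁) (fun y => ?_)
      ((cylinderSection_nonempty hΘ₁.isConnected.nonempty 0).image _))
    (IsStraightEnd.of_eventually_neg (isOpen_infiniteCylinder e₂ hΘ₂.isOpen) (by simp)
      (fun x => infiniteCylinder_chart e₂ hΘ₂)
      hℓ₂ hch.outlet (mem_image_cylinder_iff e₂ Θ₂ ℓ₂) (mem_image_cylinderSection_iff e₂ Θ₂ ℓ₂)
      ((cylinderSection_nonempty hΘ₂.isConnected.nonempty ℓ₂).image _))
  rw [mem_image_cylinderSection_iff, add_zero]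

end Spatial

end Pipe

theorem lemma2p5 (n : ℕ) (Ω Γ_I Γ_O : Set (Pipe.E n)) (hΩ : Pipe.IsAdmissible n Ω Γ_I Γ_O) :
    ∃ C : ℝ, 0 < C ∧ ∀ q : Pipe.E n → ℝ, MemLp q 2 (volume.restrict Ω) →
      ∃ (X : Pipe.E n → Pipe.E n) (G : Pipe.E n → Pipe.Mat n),
        Pipe.HasW12Gradient Ω X G ∧
        (∀ᵐ x ∂(volume.restrict Ω), Pipe.divergence G x = q x) ∧
        Pipe.HasTrace Ω (Γ_I ∪ Pipe.wall Ω Γ_I Γ_O) X G 0 ∧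
        eLpNorm G 2 (volume.restrict Ω) ≤ ENNReal.ofReal C * eLpNorm q 2 (volume.restrict Ω) := by
  match n, Ω, Γ_I, Γ_O, hΩ with
  | 0, _, _, _, hΩ => exact hΩ.elim
  | 1, _, _, _, hΩ => exact hΩ.elim
  | 2, _, _, _, hΩ => exact Pipe.IsAdmissiblePlanar.exists_divergence_solution hΩ
  | 3, _, _, _, hΩ => exact Pipe.IsAdmissibleSpatial.exists_divergence_solution hΩ
  | _ + 4, _, _, _, hΩ => exact hΩ.elim
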